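/- Let $\mathcal C(5,3;2,2;2,3)$ be the Coxeter tetrahedron in the 3-sphere $S^3$ whose pairs of opposite edges have labels $(5,3)$, $(2,2)$, $(2,3)$ (an edge with label $l$ has dihedral angle $\pi/l$); it exists. Let $C(5,3;2,2;2,3)\subset O(4)$ be the group generated by the reflections in its four faces, and let $T=T(5,3;2,2;2,3)$ be its orientation-preserving subgroup. Then there exist surjective homomorphisms $T\to\mathbb A_5$. For every surjection $\varphi:T\to\mathbb A_5$, the kernel $K=\ker\varphi$ acts freely on $S^3$, and the quotient manifold $S^3/K$ (with the smooth structure for which $S^3\to S^3/K$ is a local diffeomorphism) is the spherical Poincaré homology 3-sphere, i.e. it is isometric to the quotient of the group $S^3$ of unit quaternions by left multiplication with the binary icosahedral group of order 120. The action of $T$ on $S^3$ projects to an action of $T/K\cong\mathbb A_5$ on $S^3/K$ which is of type $12(g-1)$ and genus $g=6$. In particular, the spherical Poincaré homology 3-sphere is a 3-manifold of type $12(g-1)$ and genus $g=6$, for an action of $\mathbb A_5$. Here an action of a finite group $G$ on a closed, connected, orientable smooth 3-manifold $M$ is *of type $12(g-1)$ and genus $g$* ($g>1$) if $G$ acts faithfully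 by orientation-preserving diffeomorphisms, $|G|=12(g-1)$, and $M$ has a (smooth) Heegaard splitting $M=V\cup W$ into two handlebodies of genus $g$, meeting exactly in their common boundary surface, such that every element of $G$ maps $V$ to $V$ and $W$ to $W$. -/

import Mathlib

open scoped Manifold ContDiff

noncomputable section

namespace PoincareSphere

/-! ### Heegaard splittings and group actions on 3-manifolds -/

abbrev E2 : Type := EuclideanSpace ℝ (Fin 2)
abbrev E3 : Type := EuclideanSpace ℝ (Fin 3)
abbrev E4 : Type := EuclideanSpace ℝ (Fin 4)

/-- The solid cylinder `[-1, 1] × D²`, the model of a 1-handle. -/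
def cylinder : Set (ℝ × E2) := Set.Icc (-1) 1 ×ˢ Metric.closedBall 0 1

/-- The attaching region `{-1, 1} × D²` of a 1-handle. -/
def cylinderEnds : Set (ℝ × E2) := {-1, 1} ×ˢ Metric.closedBall 0 1

/-- A presentation of the subset `V` of a (Hausdorff) space as a union of `n` disjoint 3-balls
(0-handles) and of `k` disjoint 1-handles `[-1, 1] × D²`, each of which meets the balls exactly
in its two ends, these ends being embedded in the boundary spheres of the balls. -/
structure HandleDecomposition {X : Type*} [TopologicalSpace X] (V : Set X) (n k : ℕ) where
  ball : Fin n → E3 → X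
  handle : Fin k → ℝ × E2 → X
  ball_continuous : ∀ i, ContinuousOn (ball i) (Metric.closedBall 0 1)
  ball_injective : ∀ i, Set.InjOn (ball i) (Metric.closedBall 0 1)
  handle_continuous : ∀ j, ContinuousOn (handle j) cylinder
  handle_injective : ∀ j, Set.InjOn (handle j) cylinder
  ball_disjoint : ∀ i i', i ≠ i' →
    Disjoint (ball i '' Metric.closedBall 0 1) (ball i' '' Metric.closedBall 0 1)
  handle_disjoint : ∀ j j', j ≠ j' → Disjoint (handle j '' cylinder) (handle j' '' cylinder)
  ends_attached : ∀ j, handle j '' cylinderEnds ⊆ ⋃ i, ball i '' Metric.sphere 0 1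
  meets_in_ends : ∀ i j, ball i '' Metric.closedBall 0 1 ∩ handle j '' cylinder ⊆
    ball i '' Metric.sphere 0 1 ∩ handle j '' cylinderEnds
  union_eq : (⋃ i, ball i '' Metric.closedBall 0 1) ∪ (⋃ j, handle j '' cylinder) = V

/-- `V` is a handlebody of genus `g`: connected, and built from 3-balls and 1-handles along a
graph of Euler characteristic `n - k = 1 - g`. (Inside an orientable 3-manifold, such a `V` is
the orientable handlebody of genus `g`.) -/
def IsHandlebody {X : Type*} [TopologicalSpace X] (V : Set X) (g : ℕ) : Prop :=
  IsConnected V ∧ ∃ n k : ℕ, k + 1 = n + g ∧ Nonempty (HandleDecomposition V n k)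

section Manifold

variable {M : Type*} [TopologicalSpace M] [ChartedSpace E3 M]

/-- `V` is a domain with smooth boundary: near each point of its frontier, it is the sublevel set
`f ≤ 0` of a smooth function with nonzero differential at the point. -/
def IsSmoothDomain (V : Set M) : Prop :=
  ∀ x ∈ frontier V, ∃ (U : Set M) (f : M → ℝ), IsOpen U ∧ x ∈ U ∧
    ContMDiffOn (𝓡 3) 𝓘(ℝ, ℝ) ∞ f U ∧ mfderiv (𝓡 3) 𝓘(ℝ, ℝ) f x ≠ 0 ∧
    ∀ y ∈ U, y ∈ V ↔ f y ≤ 0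

/-- `M = V ∪ W` is a (smooth) Heegaard splitting of genus `g`: two handlebodies of genus `g`
with smooth boundary which meet exactly in their common boundary surface. -/
structure IsHeegaardSplitting (V W : Set M) (g : ℕ) : Prop where
  left_handlebody : IsHandlebody V g
  right_handlebody : IsHandlebody W g
  left_smooth : IsSmoothDomain V
  right_smooth : IsSmoothDomain W
  union_eq : V ∪ W = Set.univ
  inter_eq_left : V ∩ W = frontier V
  inter_eq_right : V ∩ W = frontier W

/-- With respect to the set of charts `A`, the map `f` has positive Jacobian determinant
everywhere. -/
def HasPositiveJacobian (A : Set (OpenPartialHomeomorph M E3)) (f : M → M) : Prop :=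
  ∀ e ∈ A, ∀ e' ∈ A, ∀ x ∈ e.source, f x ∈ e'.source →
    0 < (fderiv ℝ (fun z => e' (f (e.symm z))) (e x)).det

/-- `A` is an oriented atlas of the smooth 3-manifold `M`, i.e. an orientation of `M`. -/
structure IsOrientedAtlas (A : Set (OpenPartialHomeomorph M E3)) : Prop where
  smooth : A ⊆ IsManifold.maximalAtlas (𝓡 3) ∞ M
  cover : ∀ x : M, ∃ e ∈ A, x ∈ e.source
  compatible : HasPositiveJacobian A id

/-- The action `ρ` of the group `G` on the 3-manifold `M` is of type `12(g-1)` and genus `g`: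
`M` is closed, connected and orientable, `ρ` realizes `G` as a finite group of
orientation-preserving diffeomorphisms of `M` of order `12(g-1)`, `g > 1`, and `M` has a
Heegaard splitting of genus `g` both handlebodies of which are preserved by every element
of `G`. -/
structure IsType12 {G : Type*} [Group G] (ρ : G →* Equiv.Perm M) (g : ℕ) : Prop where
  manifold : IsManifold (𝓡 3) ∞ M
  hausdorff : T2Space M
  compact : CompactSpace M
  connected : ConnectedSpace M
  faithful : Function.Injective ρ
  smooth : ∀ γ, ContMDiff (𝓡 3) (𝓡 3) ∞ (ρ γ)
  oriented : ∃ A : Set (OpenPartialHomeomorph M E3), IsOrientedAtlas A ∧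
    ∀ γ, HasPositiveJacobian A (ρ γ)
  one_lt_genus : 1 < g
  card_eq : Nat.card G = 12 * (g - 1)
  splitting : ∃ V W : Set M, IsHeegaardSplitting V W g ∧ ∀ γ, ρ γ '' V = V ∧ ρ γ '' W = W

end Manifold

/-! ### The spherical tetrahedral groups -/

/-- The 3-sphere. -/
abbrev S3 : Type := Metric.sphere (0 : E4) 1

/-- The map between unit spheres induced by a linear isometry. -/
def sphereMap {E F : Type*} [NormedAddCommGroup E] [NormedSpace ℝ E] [NormedAddCommGroup F]
    [NormedSpace ℝ F] (A : E ≃ₗᵢ[ℝ] F) (x : Metric.sphere (0 : E) 1) :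
    Metric.sphere (0 : F) 1 :=
  ⟨A x, by simp⟩

/-- The isometry group `O(4)` acts on the 3-sphere. -/
instance : MulAction (E4 ≃ₗᵢ[ℝ] E4) S3 where
  smul A x := sphereMap A x
  one_smul _ := rfl
  mul_smul _ _ _ := rfl

/-- The vectors `ν 0, …, ν 3` are the outward unit normals of the four faces of a spherical
Coxeter tetrahedron `{x ∈ S³ | ⟪ν i, x⟫ ≤ 0 for all i}` whose pairs of opposite edges have
labels `(n, m)`, `(a, b)`, `(c, d)`; an edge with label `l` has dihedral angle `π / l`. -/
structure IsSphericalCoxeterTetrahedron (n m a b c d : ℕ) (ν : Fin 4 → E4) : Prop where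
  linearIndependent : LinearIndependent ℝ ν
  norm_eq : ∀ i, ‖ν i‖ = 1
  angle_n : inner ℝ (ν 0) (ν 2) = -Real.cos (Real.pi / n)
  angle_m : inner ℝ (ν 1) (ν 3) = -Real.cos (Real.pi / m)
  angle_a : inner ℝ (ν 1) (ν 2) = -Real.cos (Real.pi / a)
  angle_b : inner ℝ (ν 0) (ν 3) = -Real.cos (Real.pi / b)
  angle_c : inner ℝ (ν 0) (ν 1) = -Real.cos (Real.pi / c)
  angle_d : inner ℝ (ν 2) (ν 3) = -Real.cos (Real.pi / d)

/-- The Coxeter group generated by the reflections in the four faces. -/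
def coxeterGroup (ν : Fin 4 → E4) : Subgroup (E4 ≃ₗᵢ[ℝ] E4) :=
  Subgroup.closure (Set.range fun i => (ℝ ∙ ν i)ᗮ.reflection)

/-- The determinant `O(4) → ℝˣ`. -/
def isometryDet : (E4 ≃ₗᵢ[ℝ] E4) →* ℝˣ :=
  LinearEquiv.det.comp
    { toFun := fun A => A.toLinearEquiv, map_one' := rfl, map_mul' := fun _ _ => rfl }

/-- The tetrahedral group: the orientation-preserving subgroup of the Coxeter group. -/
def tetrahedralGroup (ν : Fin 4 → E4) : Subgroup (E4 ≃ₗᵢ[ℝ] E4) :=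
  coxeterGroup ν ⊓ isometryDet.ker

/-- The quotient of the 3-sphere by a subgroup of a group of isometries. -/
abbrev SphereQuotient {T : Subgroup (E4 ≃ₗᵢ[ℝ] E4)} (K : Subgroup T) : Type :=
  MulAction.orbitRel.Quotient K S3

/-- The quotient projection. -/
def sphereProj {T : Subgroup (E4 ≃ₗᵢ[ℝ] E4)} (K : Subgroup T) (x : S3) : SphereQuotient K :=
  Quotient.mk _ x

/-! ### The Poincaré homology sphere -/

instance : Fact (Module.finrank ℝ (Quaternion ℝ) = 3 + 1) := ⟨Quaternion.finrank_eq_four⟩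

/-- The group of unit quaternions, as the unit sphere of the quaternions. -/
abbrev UnitQuaternion : Type := Metric.sphere (0 : Quaternion ℝ) 1

/-- The binary icosahedral group (of order 120), generated by the unit quaternions
`(1 + i + j + k) / 2` and `(φ + φ⁻¹ i + j) / 2`, where `φ` is the golden ratio. -/
def binaryIcosahedralGroup : Subgroup UnitQuaternion :=
  Subgroup.closure {q | (q : Quaternion ℝ) = ⟨1 / 2, 1 / 2, 1 / 2, 1 / 2⟩ ∨
    (q : Quaternion ℝ) = ⟨Real.goldenRatio / 2, Real.goldenRatio⁻¹ / 2, 1 / 2, 0⟩}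

/-- The map `p` from the unit quaternions presents the smooth manifold `M` as the spherical
Poincaré homology 3-sphere, the quotient of the 3-sphere by left multiplication with the binary
icosahedral group: `p` is a surjective local diffeomorphism whose fibres are the orbits. -/
structure IsPoincareSphere {M : Type*} [TopologicalSpace M] [ChartedSpace E3 M]
    (p : UnitQuaternion → M) : Prop where
  localDiffeo : IsLocalDiffeomorph (𝓡 3) (𝓡 3) ∞ p
  surjective : Function.Surjective p
  fibres : ∀ x y, p x = p y ↔ ∃ b ∈ binaryIcosahedralGroup, y = b * x

end PoincareSphere

end

/-!
The Coxeter diagram of the tetrahedron is `H₄`. A spherical tetrahedron is determined up to isometry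
by its Gram matrix, so the normals of its faces may be taken to be four unit icosians, i.e. elements
of the binary icosahedral group `I ⊂ S³` of order 120 (`Icosian.exists_isometry_root`). The
reflection in the hyperplane orthogonal to a unit quaternion `s` is `x ↦ -s x̄ s`; hence the
orientation-preserving subgroup `T` consists of rotations `x ↦ a x b⁻¹` with `a, b ∈ I`. All of these
occur, since suitable powers of Coxeter elements are one-sided multiplications
(`Icosian.mem_tetrahedralGroup_iff`).

So `T` is a quotient of `I × I`. As `A₅` is simple and has no centre, every surjection `T → A₅` is
trivial on one of the two factors (`forall_eq_one_or_forall_eq_one`), and as `I` has twice the order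
of `A₅`, it is injective modulo `±1` on the other one. Hence its kernel consists of the left
multiplications by `I`, possibly after exchanging the factors by quaternionic conjugation
(`exists_isIcosahedralModel`). It acts freely, and its quotient is the Poincaré homology sphere
`I \ S³`. Surjections exist because `I` acts on the five cosets of the binary tetrahedral group
(`Icosian.exists_hom_alternatingGroup`). The action of `A₅ = T / K` on the quotient is the one by
right multiplications with `I`.

The smooth structure of the quotient is given by central projections of small caps to tangent spaces.
Left and right multiplications become projective transformations with positive Jacobian determinant
in these charts (`det_fderiv_proj_pos`); so the charts form an oriented atlas, whose orientation is
preserved by the action.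

The Heegaard surface is a level surface of the function `height` on the 3-sphere, a sum of bump
functions around the 120 elements of `I`, which are the vertices of the 600-cell. It is invariant
under `I` from both sides. Vertices, edges, triangles and cells of the 600-cell form 1, 6, 10 and 5
orbits under left multiplication by `I`. The superlevel set is a neighbourhood of the 1-skeleton: in
the quotient, it is a ball with 6 handles (`upperSystem`). The sublevel set is a neighbourhood of the
dual 1-skeleton: in the quotient, it consists of 5 balls and 10 handles (`lowerSystem`). Both have
genus 6, as `6 = 1 - 1 + 6 = 1 - 5 + 10`. The bump functions have their support in caps which are
slightly too small to contain the centres of the adjacent triangles; hence at most two of them are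
positive at the same point, and two of them only close to the midpoint of an edge.
That the balls and handles are really topological balls and solid cylinders follows from radial
monotonicity of the height: they are star-shaped, slice by slice in the case of the handles, with
respect to vertices, edges, centres of cells, and the arcs which join the centres of adjacent cells
(`exists_radial_homeomorph`, `exists_ball_chart`, `exists_handle_chart`). The same monotonicity shows
that the level is a regular value (`exists_curve`).
-/

noncomputable section

open scoped Quaternion goldenRatio InnerProductSpace

namespace PoincareSphere

/-! ### The icosians -/

/-- Golden integers `a + bφ`, encoded as pairs `(a, b)`. -/
abbrev GoldenInt : Type := ℤ × ℤ

/-- Product of golden integers, from `φ² = φ + 1`. -/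
def GoldenInt.mul (x y : GoldenInt) : GoldenInt :=
  (x.1 * y.1 + x.2 * y.2, x.1 * y.2 + x.2 * y.1 + x.2 * y.2)

/-- The real number `a + bφ`. -/
def GoldenInt.toReal (x : GoldenInt) : ℝ := x.1 + x.2 * φ

/-- The icosian `(x₀ + x₁ i + x₂ j + x₃ k) / 2` with golden integers `xₙ`, encoded by the
quadruple `(x₀, x₁, x₂, x₃)`. -/
abbrev Icosian : Type := GoldenInt × GoldenInt × GoldenInt × GoldenInt

namespace Icosian

/-- The quaternion with given doubled coordinates. -/
def toH (x : Icosian) : ℍ[ℝ] :=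
  ⟨x.1.toReal / 2, x.2.1.toReal / 2, x.2.2.1.toReal / 2, x.2.2.2.toReal / 2⟩

/-- The quaternion product of the coordinate vectors; it encodes twice the product of two
icosians. -/
def rawMul (x y : Icosian) : Icosian :=
  (x.1.mul y.1 - x.2.1.mul y.2.1 - x.2.2.1.mul y.2.2.1 - x.2.2.2.mul y.2.2.2,
   x.1.mul y.2.1 + x.2.1.mul y.1 + x.2.2.1.mul y.2.2.2 - x.2.2.2.mul y.2.2.1,
   x.1.mul y.2.2.1 - x.2.1.mul y.2.2.2 + x.2.2.1.mul y.1 + x.2.2.2.mul y.2.1,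
   x.1.mul y.2.2.2 + x.2.1.mul y.2.2.1 - x.2.2.1.mul y.2.1 + x.2.2.2.mul y.1)

/-- Half of a golden integer, rounded down. -/
def half (x : GoldenInt) : GoldenInt := (x.1 / 2, x.2 / 2)

/-- The product of two icosians. It is only meaningful if no rounding occurs. -/
def mul (x y : Icosian) : Icosian :=
  let z := rawMul x y
  (half z.1, half z.2.1, half z.2.2.1, half z.2.2.2)

/-- No rounding occurs in the product of `x` and `y`. -/
def Exact (x y : Icosian) : Prop := mul x y + mul x y = rawMul x y

instance (x y : Icosian) : Decidable (Exact x y) := inferInstanceAs (Decidable (_ = _))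

def one : Icosian := ((2, 0), (0, 0), (0, 0), (0, 0))
def negOne : Icosian := ((-2, 0), (0, 0), (0, 0), (0, 0))
def unitI : Icosian := ((0, 0), (2, 0), (0, 0), (0, 0))
def unitJ : Icosian := ((0, 0), (0, 0), (2, 0), (0, 0))

/-- The generator `(1 + i + j + k) / 2`. -/
def hur : Icosian := ((1, 0), (1, 0), (1, 0), (1, 0))

/-- The generator `(φ + φ⁻¹ i + j) / 2`. -/
def zeta : Icosian := ((0, 1), (-1, 1), (1, 0), (0, 0))

/-- Quaternionic conjugation. -/
def conj (x : Icosian) : Icosian := (x.1, -x.2.1, -x.2.2.1, -x.2.2.2)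

/-- The products `x gⁿ` for `x` in the list `l` and `n < m`. -/
def cosets (g : Icosian) (m : ℕ) (l : List Icosian) : List Icosian :=
  match m with
  | 0 => []
  | m + 1 => l ++ cosets g m (l.map (mul · g))

/-- The 24 Hurwitz units. -/
def hurwitz : List Icosian := cosets hur 3 (cosets unitJ 2 (cosets unitI 4 [one]))

/-- The 120 unit icosians `τ ζⁿ`, with a Hurwitz unit `τ` and `n < 5`. -/
def all : List Icosian := cosets zeta 5 hurwitz

theorem toReal_add (x y : GoldenInt) : (x + y).toReal = x.toReal + y.toReal := by
  simp [GoldenInt.toReal]; ring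

theorem toReal_sub (x y : GoldenInt) : (x - y).toReal = x.toReal - y.toReal := by
  simp [GoldenInt.toReal]; ring

theorem toReal_neg (x : GoldenInt) : (-x).toReal = -x.toReal := by
  simp [GoldenInt.toReal]; ring

theorem toReal_mul (x y : GoldenInt) : (x.mul y).toReal = x.toReal * y.toReal := by
  simp only [GoldenInt.toReal, GoldenInt.mul]
  push_cast
  linear_combination (-(x.2 : ℝ) * y.2) * Real.goldenRatio_sq

theorem toH_mul {x y : Icosian} (h : Exact x y) : toH (mul x y) = toH x * toH y := by
  have e : ∀ a b : GoldenInt, a + a = b → a.toReal = b.toReal / 2 := by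
    rintro a b rfl
    rw [toReal_add]; ring
  have h0 := e _ _ (congrArg Prod.fst h)
  have h1 := e _ _ (congrArg (fun z : Icosian => z.2.1) h)
  have h2 := e _ _ (congrArg (fun z : Icosian => z.2.2.1) h)
  have h3 := e _ _ (congrArg (fun z : Icosian => z.2.2.2) h)
  simp only [rawMul, toReal_add, toReal_sub, toReal_mul] at h0 h1 h2 h3
  apply Quaternion.ext
  · rw [Quaternion.re_mul]; simp only [toH]; linear_combination h0 / 2
  · rw [Quaternion.imI_mul]; simp only [toH]; linear_combination h1 / 2
  · rw [Quaternion.imJ_mul]; simp only [toH]; linear_combination h2 / 2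
  · rw [Quaternion.imK_mul]; simp only [toH]; linear_combination h3 / 2

theorem toH_one : toH one = 1 := by
  ext <;> simp [toH, one, GoldenInt.toReal]

theorem toH_conj (x : Icosian) : toH (conj x) = star (toH x) := by
  apply Quaternion.ext
  · rw [Quaternion.re_star]; rfl
  · rw [Quaternion.imI_star]; simp only [toH, conj, toReal_neg, neg_div]
  · rw [Quaternion.imJ_star]; simp only [toH, conj, toReal_neg, neg_div]
  · rw [Quaternion.imK_star]; simp only [toH, conj, toReal_neg, neg_div]

theorem toH_injective : Function.Injective toH := by
  have e : ∀ a b : GoldenInt, a.toReal / 2 = b.toReal / 2 → a = b := by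
    intro a b h
    have h' : ((a.1 - b.1 : ℤ) : ℝ) + ((a.2 - b.2 : ℤ) : ℝ) * φ = 0 := by
      simp only [GoldenInt.toReal] at h
      push_cast
      linarith
    by_cases hb : a.2 = b.2
    · refine Prod.ext ?_ hb
      simp only [hb, sub_self, Int.cast_zero, zero_mul, add_zero, Int.cast_eq_zero] at h'
      omega
    · refine absurd h' (Real.goldenRatio_irrational.intCast_mul (sub_ne_zero.2 hb)
        |>.intCast_add _ |>.ne_zero)
  intro x y h
  refine Prod.ext (e _ _ (congrArg (fun z : ℍ[ℝ] => z.re) h)) (Prod.ext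
    (e _ _ (congrArg (fun z : ℍ[ℝ] => z.imI) h)) (Prod.ext
    (e _ _ (congrArg (fun z : ℍ[ℝ] => z.imJ) h)) (e _ _ (congrArg (fun z : ℍ[ℝ] => z.imK) h))))

theorem length_all : all.length = 120 := by decide +kernel

theorem all_nodup : all.Nodup := by decide +kernel

/-- The list of unit icosians is stable under right multiplication by the generators of the binary
icosahedral group and their inverses. Together with `isUnitIcosian_of_mem` this identifies the list
with the group generated. -/
theorem mul_gen_mem : ∀ x ∈ all, ∀ g ∈ [hur, zeta, conj hur, conj zeta],
    Exact x g ∧ mul x g ∈ all := by decide +kernel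

/-- The quaternion `q` belongs to the binary icosahedral group. -/
def _root_.PoincareSphere.IsUnitIcosian (q : ℍ[ℝ]) : Prop :=
  ∃ s ∈ binaryIcosahedralGroup, (s : ℍ[ℝ]) = q

theorem _root_.PoincareSphere.IsUnitIcosian.mul {p q : ℍ[ℝ]} (hp : IsUnitIcosian p)
    (hq : IsUnitIcosian q) : IsUnitIcosian (p * q) := by
  obtain ⟨s, hs, rfl⟩ := hp
  obtain ⟨t, ht, rfl⟩ := hq
  exact ⟨s * t, mul_mem hs ht, rfl⟩

theorem _root_.PoincareSphere.IsUnitIcosian.norm {p : ℍ[ℝ]} (hp : IsUnitIcosian p) : ‖p‖ = 1 := by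
  obtain ⟨s, -, rfl⟩ := hp
  exact norm_eq_of_mem_sphere s

theorem toH_hur : toH hur = ⟨1 / 2, 1 / 2, 1 / 2, 1 / 2⟩ := by
  apply Quaternion.ext <;> simp [toH, hur, GoldenInt.toReal]

theorem toH_zeta : toH zeta = ⟨Real.goldenRatio / 2, Real.goldenRatio⁻¹ / 2, 1 / 2, 0⟩ := by
  have : Real.goldenRatio⁻¹ = -1 + Real.goldenRatio := by
    rw [Real.inv_goldenRatio]
    linarith [Real.goldenRatio_add_goldenConj]
  apply Quaternion.ext <;> simp [toH, zeta, GoldenInt.toReal, this]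

/-- The generators are unit quaternions because their product with their conjugates is `1`. -/
theorem norm_gen : ∀ g ∈ [hur, zeta], ‖toH g‖ = 1 := by
  intro g hg
  have h1 : mul g (conj g) = one ∧ Exact g (conj g) := by revert g; decide +kernel
  have h2 := toH_mul h1.2
  rw [h1.1, toH_one, toH_conj] at h2
  have := congrArg norm h2
  rw [norm_mul, norm_star, norm_one] at this
  nlinarith [norm_nonneg (toH g)]

theorem isUnitIcosian_gen : ∀ g ∈ [hur, zeta], IsUnitIcosian (toH g) := by
  intro g hg
  refine ⟨⟨toH g, mem_sphere_zero_iff_norm.2 (norm_gen g hg)⟩, Subgroup.subset_closure ?_, rfl⟩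
  simp only [List.mem_cons, List.not_mem_nil, or_false] at hg
  rcases hg with rfl | rfl
  · exact Or.inl toH_hur
  · exact Or.inr toH_zeta

theorem isUnitIcosian_one : IsUnitIcosian (toH one) := by
  rw [toH_one]
  exact ⟨1, one_mem _, rfl⟩

/-- If the elements of `l` and the quaternion `g` belong to the binary icosahedral group, then so do
the elements of the list `cosets g m l`. -/
theorem isUnitIcosian_cosets {g : Icosian} (hg : IsUnitIcosian (toH g)) (m : ℕ) :
    ∀ l : List Icosian, (∀ x ∈ l, IsUnitIcosian (toH x)) → (∀ x ∈ cosets g m l, Exact x g) →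
      ∀ x ∈ cosets g m l, IsUnitIcosian (toH x) := by
  induction m with
  | zero => intro l _ _ x hx; simp [cosets] at hx
  | succ m ih =>
    intro l hl he x hx
    simp only [cosets, List.mem_append] at hx he
    rcases hx with hx | hx
    · exact hl x hx
    · refine ih _ ?_ (fun y hy => he y (Or.inr hy)) x hx
      intro y hy
      obtain ⟨z, hz, rfl⟩ := List.mem_map.1 hy
      rw [toH_mul (he z (Or.inl hz))]
      exact (hl z hz).mul hg

theorem isUnitIcosian_mul {x y : Icosian} (hx : IsUnitIcosian (toH x))
    (hy : IsUnitIcosian (toH y)) (h : Exact x y) : IsUnitIcosian (toH (mul x y)) := by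
  rw [toH_mul h]
  exact hx.mul hy

theorem isUnitIcosian_unitI : IsUnitIcosian (toH unitI) := by
  have hh := isUnitIcosian_gen hur (by simp)
  have hz := isUnitIcosian_gen zeta (by simp)
  have h1 := isUnitIcosian_mul hh hh (by decide +kernel)
  have h2 := isUnitIcosian_mul hz hz (by decide +kernel)
  have h3 := isUnitIcosian_mul (isUnitIcosian_mul h1 h2 (by decide +kernel))
    (isUnitIcosian_mul h1 (isUnitIcosian_mul h2 hz (by decide +kernel)) (by decide +kernel))
    (by decide +kernel)
  -- The word `h² ζ² h² ζ³` in the two generators `h` and `ζ`.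
  have e : unitI = mul (mul (mul hur hur) (mul zeta zeta))
    (mul (mul hur hur) (mul (mul zeta zeta) zeta)) := by decide +kernel
  rwa [e]

theorem isUnitIcosian_unitJ : IsUnitIcosian (toH unitJ) := by
  have hh := isUnitIcosian_gen hur (by simp)
  have h1 := isUnitIcosian_mul hh hh (by decide +kernel)
  have h2 := isUnitIcosian_mul h1 h1 (by decide +kernel)
  have h3 := isUnitIcosian_mul (isUnitIcosian_mul hh isUnitIcosian_unitI (by decide +kernel))
    (isUnitIcosian_mul h2 hh (by decide +kernel)) (by decide +kernel)
  -- The word `h i h⁵` in the generator `h` and the unit `i` obtained above.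
  have e : unitJ = mul (mul hur unitI) (mul (mul (mul hur hur) (mul hur hur)) hur) := by
    decide +kernel
  rwa [e]

theorem isUnitIcosian_of_mem {x : Icosian} (hx : x ∈ all) : IsUnitIcosian (toH x) := by
  refine isUnitIcosian_cosets (isUnitIcosian_gen zeta (by simp)) 5 hurwitz ?_
    (by decide +kernel) x hx
  refine isUnitIcosian_cosets (isUnitIcosian_gen hur (by simp)) 3 _ ?_ (by decide +kernel)
  refine isUnitIcosian_cosets isUnitIcosian_unitJ 2 _ ?_ (by decide +kernel)
  refine isUnitIcosian_cosets isUnitIcosian_unitI 4 _ ?_ (by decide +kernel)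
  simpa using isUnitIcosian_one

/-- The binary icosahedral group consists of the 120 unit icosians. -/
theorem _root_.PoincareSphere.isUnitIcosian_iff {q : ℍ[ℝ]} :
    IsUnitIcosian q ↔ ∃ x ∈ all, toH x = q := by
  refine ⟨?_, ?_⟩
  · rintro ⟨s, hs, rfl⟩
    have step : ∀ x ∈ all, ∀ g ∈ [hur, zeta, conj hur, conj zeta], ∃ y ∈ all,
        toH y = toH x * toH g := fun x hx g hg =>
      ⟨mul x g, (mul_gen_mem x hx g hg).2, toH_mul (mul_gen_mem x hx g hg).1⟩
    have inv : ∀ s : UnitQuaternion, ((s⁻¹ : UnitQuaternion) : ℍ[ℝ]) = star (s : ℍ[ℝ]) := by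
      intro s
      rw [Metric.unitSphere.coe_inv, Quaternion.inv_def, Quaternion.normSq_eq_norm_mul_self,
        norm_eq_of_mem_sphere s]
      simp
    have gen : ∀ s : UnitQuaternion, ((s : ℍ[ℝ]) = ⟨1 / 2, 1 / 2, 1 / 2, 1 / 2⟩ ∨
        (s : ℍ[ℝ]) = ⟨Real.goldenRatio / 2, Real.goldenRatio⁻¹ / 2, 1 / 2, 0⟩) →
        ∃ g ∈ [hur, zeta], (s : ℍ[ℝ]) = toH g := by
      rintro s (h | h)
      · exact ⟨hur, by simp, by rw [h, toH_hur]⟩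
      · exact ⟨zeta, by simp, by rw [h, toH_zeta]⟩
    refine Subgroup.closure_induction_right (G := UnitQuaternion) (p := fun s _ => ∃ x ∈ all, toH x = (s : ℍ[ℝ]))
      ⟨one, by decide +kernel, toH_one⟩ ?_ ?_ (show s ∈ Subgroup.closure _ from hs)
    · rintro s _ t ht ⟨x, hx, h⟩
      obtain ⟨g, hg, e⟩ := gen t ht
      obtain ⟨y, hy, h'⟩ := step x hx g (by simp at hg ⊢; tauto)
      exact ⟨y, hy, by rw [h', h, ← e]; rfl⟩
    · rintro s _ t ht ⟨x, hx, h⟩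
      obtain ⟨g, hg, e⟩ := gen t ht
      obtain ⟨y, hy, h'⟩ := step x hx (conj g) (by
        simp only [List.mem_cons, List.not_mem_nil, or_false] at hg
        rcases hg with rfl | rfl <;> simp)
      refine ⟨y, hy, ?_⟩
      rw [h', h, toH_conj, ← e, ← inv]; rfl
  · rintro ⟨x, hx, rfl⟩
    exact isUnitIcosian_of_mem hx

end Icosian

/-! ### Inner products of unit icosians -/

theorem quaternion_inner_eq (a b : ℍ[ℝ]) :
    ⟪a, b⟫_ℝ = a.re * b.re + a.imI * b.imI + a.imJ * b.imJ + a.imK * b.imK := by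
  rw [Quaternion.inner_def, Quaternion.re_mul, Quaternion.re_star, Quaternion.imI_star,
    Quaternion.imJ_star, Quaternion.imK_star]
  ring

theorem quaternion_star_mul_self {a : ℍ[ℝ]} (ha : ‖a‖ = 1) : star a * a = 1 := by
  rw [Quaternion.star_mul_self, Quaternion.normSq_eq_norm_mul_self, ha]; simp

theorem quaternion_self_mul_star {a : ℍ[ℝ]} (ha : ‖a‖ = 1) : a * star a = 1 := by
  rw [Quaternion.self_mul_star, Quaternion.normSq_eq_norm_mul_self, ha]; simp

theorem inner_mul_mul_left {a : ℍ[ℝ]} (ha : ‖a‖ = 1) (x y : ℍ[ℝ]) :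
    ⟪a * x, a * y⟫_ℝ = ⟪x, y⟫_ℝ := by
  have h : ∀ z : ℍ[ℝ], ‖a * z‖ = ‖z‖ := fun z => by rw [norm_mul, ha, one_mul]
  rw [real_inner_eq_norm_add_mul_self_sub_norm_mul_self_sub_norm_mul_self_div_two,
    real_inner_eq_norm_add_mul_self_sub_norm_mul_self_sub_norm_mul_self_div_two, ← mul_add, h, h, h]

theorem inner_mul_mul_right {b : ℍ[ℝ]} (hb : ‖b‖ = 1) (x y : ℍ[ℝ]) :
    ⟪x * b, y * b⟫_ℝ = ⟪x, y⟫_ℝ := by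
  have h : ∀ z : ℍ[ℝ], ‖z * b‖ = ‖z‖ := fun z => by rw [norm_mul, hb, mul_one]
  rw [real_inner_eq_norm_add_mul_self_sub_norm_mul_self_sub_norm_mul_self_div_two,
    real_inner_eq_norm_add_mul_self_sub_norm_mul_self_sub_norm_mul_self_div_two, ← add_mul, h, h, h]

theorem inner_mul_left_eq {a : ℍ[ℝ]} (ha : ‖a‖ = 1) (x y : ℍ[ℝ]) :
    ⟪a * x, y⟫_ℝ = ⟪x, star a * y⟫_ℝ := by
  rw [← inner_mul_mul_left ha x, ← mul_assoc, quaternion_self_mul_star ha, one_mul]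

theorem inner_mul_right_eq {b : ℍ[ℝ]} (hb : ‖b‖ = 1) (x y : ℍ[ℝ]) :
    ⟪x * b, y⟫_ℝ = ⟪x, y * star b⟫_ℝ := by
  rw [← inner_mul_mul_right hb x, mul_assoc, quaternion_star_mul_self hb, mul_one]

theorem inner_one_left (x : ℍ[ℝ]) : ⟪1, x⟫_ℝ = x.re := by
  simp [quaternion_inner_eq]

namespace IsUnitIcosian

theorem one : IsUnitIcosian 1 := ⟨1, one_mem _, rfl⟩

theorem star {q : ℍ[ℝ]} (hq : IsUnitIcosian q) : IsUnitIcosian (star q) := by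
  obtain ⟨s, hs, rfl⟩ := hq
  refine ⟨s⁻¹, inv_mem hs, ?_⟩
  rw [Metric.unitSphere.coe_inv, Quaternion.inv_def, Quaternion.normSq_eq_norm_mul_self,
    norm_eq_of_mem_sphere s]
  simp

theorem pow {q : ℍ[ℝ]} (hq : IsUnitIcosian q) (n : ℕ) : IsUnitIcosian (q ^ n) := by
  obtain ⟨s, hs, rfl⟩ := hq
  exact ⟨s ^ n, pow_mem hs n, rfl⟩

theorem finite : {q : ℍ[ℝ] | IsUnitIcosian q}.Finite := by
  refine (Set.Finite.image Icosian.toH (List.finite_toSet Icosian.all)).subset ?_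
  intro q hq
  exact isUnitIcosian_iff.1 hq

end IsUnitIcosian

namespace Icosian

/-- Representatives of the pairs `{v, v⁻¹}` of vertices of the 600-cell adjacent to `1`. -/
def edgeRep : Fin 6 → Icosian :=
  ![((0, 1), (-1, 1), (1, 0), (0, 0)), ((0, 1), (-1, 1), (-1, 0), (0, 0)),
    ((0, 1), (0, 0), (-1, 1), (1, 0)), ((0, 1), (0, 0), (-1, 1), (-1, 0)),
    ((0, 1), (1, 0), (0, 0), (-1, 1)), ((0, 1), (-1, 0), (0, 0), (-1, 1))]

theorem edgeRep_mem : ∀ j, edgeRep j ∈ all := by decide +kernel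

theorem edgeRep_distinct : ∀ i j, edgeRep i ≠ conj (edgeRep j) ∧
    (edgeRep i = edgeRep j → i = j) := by decide +kernel

/-- A unit icosian is `1`, one of the twelve neighbours of `1` in the 600-cell, or its doubled real
part is one of the remaining values, all of which are at most `1`. -/
theorem re_values : ∀ x ∈ all, x = one ∨ (∃ j, x = edgeRep j ∨ x = conj (edgeRep j)) ∨
    x.1 ∈ ([(1, 0), (-1, 1), (0, 0), (1, -1), (-1, 0), (0, -1), (-2, 0)] : List GoldenInt) := by
  decide +kernel

theorem edgeRep_re : ∀ j, (edgeRep j).1 = (0, 1) := by decide +kernel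

/-- The doubled values of the sum of the first two coordinates of the unit icosians; the largest one
is `1 + φ = φ²`. -/
theorem re_add_imI_values : ∀ x ∈ all, x.1 + x.2.1 ∈
    ([(0, 1), (2, -1), (-1, -1), (0, 0), (-1, 1), (-2, 1), (1, 1), (2, 0), (1, -1), (1, -2),
      (-2, 0), (-1, 0), (1, 0), (-1, 2), (0, -1)] : List GoldenInt) := by
  decide +kernel

end Icosian

theorem goldenRatio_bounds : (1.6180339 : ℝ) < φ ∧ φ < 1.6180340 := by
  have h5 : (2.2360679 : ℝ) < √5 := Real.lt_sqrt_of_sq_lt (by norm_num)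
  have h6 : √5 < 2.2360680 := (Real.sqrt_lt' (by norm_num)).2 (by norm_num)
  unfold Real.goldenRatio
  constructor <;> linarith

namespace IsUnitIcosian

/-- Apart from `1` and its twelve neighbours, all vertices of the 600-cell are at angular distance
at least `π / 3` from `1`. -/
theorem eq_one_or_edgeRep_or_re_le {v : ℍ[ℝ]} (hv : IsUnitIcosian v) :
    v = 1 ∨ (∃ j, v = (Icosian.edgeRep j).toH ∨ v = Star.star (Icosian.edgeRep j).toH) ∨
      v.re ≤ 1 / 2 := by
  obtain ⟨x, hx, rfl⟩ := isUnitIcosian_iff.1 hv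
  rcases Icosian.re_values x hx with rfl | ⟨j, rfl | rfl⟩ | h
  · exact Or.inl Icosian.toH_one
  · exact Or.inr (Or.inl ⟨j, Or.inl rfl⟩)
  · exact Or.inr (Or.inl ⟨j, Or.inr (Icosian.toH_conj _)⟩)
  · refine Or.inr (Or.inr ?_)
    have hb := goldenRatio_bounds
    show x.1.toReal / 2 ≤ 1 / 2
    simp only [List.mem_cons, List.not_mem_nil, or_false] at h
    rcases h with h | h | h | h | h | h | h <;> rw [h] <;> simp only [GoldenInt.toReal] <;>
      push_cast <;> linarith

theorem edgeRep_re (j : Fin 6) : (Icosian.edgeRep j).toH.re = φ / 2 := by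
  show (Icosian.edgeRep j).1.toReal / 2 = _
  rw [Icosian.edgeRep_re]
  simp [GoldenInt.toReal]

theorem re_le {v : ℍ[ℝ]} (hv : IsUnitIcosian v) (h1 : v ≠ 1) : v.re ≤ φ / 2 := by
  have hb := goldenRatio_bounds
  rcases hv.eq_one_or_edgeRep_or_re_le with h | ⟨j, rfl | rfl⟩ | h
  · exact absurd h h1
  · rw [edgeRep_re]
  · rw [Quaternion.re_star, edgeRep_re]
  · linarith

/-- Distinct vertices of the 600-cell are at angular distance at least `π / 5`. -/
theorem inner_le {v w : ℍ[ℝ]} (hv : IsUnitIcosian v) (hw : IsUnitIcosian w) (h : v ≠ w) :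
    ⟪v, w⟫_ℝ ≤ φ / 2 := by
  have e : ⟪v, w⟫_ℝ = (Star.star v * w).re := by
    rw [← inner_mul_mul_left hv.star.norm, quaternion_star_mul_self hv.norm, inner_one_left]
  rw [e]
  refine (hv.star.mul hw).re_le fun h' => h ?_
  have := congrArg (v * ·) h'
  simpa [← mul_assoc, quaternion_self_mul_star hv.norm] using this.symm

/-- A bound for the inner product of a unit icosian with `1 + i`, a multiple of the centre of a cell
of the 600-cell. -/
theorem re_add_imI_le {v : ℍ[ℝ]} (hv : IsUnitIcosian v) : v.re + v.imI ≤ φ ^ 2 / 2 := by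
  obtain ⟨x, hx, rfl⟩ := isUnitIcosian_iff.1 hv
  have h := Icosian.re_add_imI_values x hx
  have hb := goldenRatio_bounds
  have e : x.toH.re + x.toH.imI = (x.1 + x.2.1).toReal / 2 := by
    rw [Icosian.toReal_add, add_div]; rfl
  rw [e, Real.goldenRatio_sq]
  simp only [List.mem_cons, List.not_mem_nil, or_false] at h
  rcases h with h | h | h | h | h | h | h | h | h | h | h | h | h | h | h <;> rw [h] <;>
    simp only [GoldenInt.toReal] <;> push_cast <;> linarith

/-- The sum of three distinct vertices of the 600-cell is longest for the vertices of a
triangle. -/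
theorem norm_add_add_sq_le {u v w : ℍ[ℝ]} (hu : IsUnitIcosian u) (hv : IsUnitIcosian v)
    (hw : IsUnitIcosian w) (huv : u ≠ v) (huw : u ≠ w) (hvw : v ≠ w) :
    ‖u + v + w‖ ^ 2 ≤ 3 + 3 * φ := by
  rw [norm_add_sq_real, norm_add_sq_real, inner_add_left, hu.norm, hv.norm, hw.norm]
  linarith [hu.inner_le hv huv, hu.inner_le hw huw, hv.inner_le hw hvw]

end IsUnitIcosian

/-! ### Star-shaped regions -/

/-- A continuous family of compact regions `{x | g (τ, x) ≤ 0}` which are strictly star-shaped with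
respect to `0` is homeomorphic to a product with the unit ball; the boundaries `g = 0` correspond
to the unit sphere. -/
theorem exists_radial_homeomorph {P E : Type*} [TopologicalSpace P] [NormedAddCommGroup E]
    [NormedSpace ℝ E] (g : P × E → ℝ) (hg : Continuous g) (h0 : ∀ τ, g (τ, 0) < 0)
    (hs : ∀ τ x (s : ℝ), x ≠ 0 → 0 < s → s < 1 → g (τ, x) ≤ 0 → g (τ, s • x) < 0)
    (R : ℝ) (hR : ∀ τ x, g (τ, x) ≤ 0 → ‖x‖ ≤ R) :
    ∃ Φ : P × E → E, Continuous Φ ∧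
      (∀ τ, Set.InjOn (fun x => Φ (τ, x)) (Metric.closedBall 0 1)) ∧
      (∀ τ y, g (τ, y) ≤ 0 ↔ ∃ x ∈ Metric.closedBall (0 : E) 1, Φ (τ, x) = y) ∧
      ∀ τ, ∀ x ∈ Metric.closedBall (0 : E) 1, g (τ, Φ (τ, x)) = 0 ↔ ‖x‖ = 1 := by
  classical
  -- `ρ (τ, x)` is the unique positive scalar `r` for which the ray through `x` meets `g = 0` at
  -- `r • x`.
  have ex : ∀ z : P × E, ∃ r : ℝ, 0 < r ∧ (z.2 ≠ 0 → g (z.1, r • z.2) = 0) := by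
    rintro ⟨τ, x⟩
    by_cases hx : x = 0
    · exact ⟨1, one_pos, fun h => absurd hx h⟩
    have hn : 0 < ‖x‖ := norm_pos_iff.2 hx
    have hR0 : 0 ≤ R := (norm_nonneg _).trans (hR τ 0 (h0 τ).le)
    have hb : 0 < g (τ, ((R + 1) / ‖x‖) • x) := by
      by_contra hcon
      have := hR τ _ (not_lt.1 hcon)
      rw [norm_smul, Real.norm_of_nonneg (by positivity), div_mul_cancel₀ _ hn.ne'] at this
      linarith
    have hc : ContinuousOn (fun r : ℝ => g (τ, r • x)) (Set.Icc 0 ((R + 1) / ‖x‖)) := by fun_prop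
    obtain ⟨r, hr, hr0⟩ := intermediate_value_Ioo (by positivity) hc
      (show (0 : ℝ) ∈ Set.Ioo _ _ from ⟨by simpa using h0 τ, hb⟩)
    exact ⟨r, hr.1, fun _ => hr0⟩
  choose ρ ρpos hρ using ex
  have neg : ∀ τ x (r : ℝ), x ≠ 0 → 0 < r → r < ρ (τ, x) → g (τ, r • x) < 0 := by
    intro τ x r hx hr hlt
    have := hs τ (ρ (τ, x) • x) (r / ρ (τ, x)) (smul_ne_zero (ρpos _).ne' hx)
      (div_pos hr (ρpos _)) ((div_lt_one (ρpos _)).2 hlt) (hρ (τ, x) hx).le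
    rwa [smul_smul, div_mul_cancel₀ _ (ρpos _).ne'] at this
  have pos : ∀ τ x (r : ℝ), x ≠ 0 → ρ (τ, x) < r → 0 < g (τ, r • x) := by
    intro τ x r hx hlt
    have hr := (ρpos (τ, x)).trans hlt
    by_contra hcon
    have := hs τ (r • x) (ρ (τ, x) / r) (smul_ne_zero hr.ne' hx)
      (div_pos (ρpos _) hr) ((div_lt_one hr).2 hlt) (not_lt.1 hcon)
    rw [smul_smul, div_mul_cancel₀ _ hr.ne', hρ (τ, x) hx] at this
    exact lt_irrefl _ this
  have uniq : ∀ τ x (r : ℝ), x ≠ 0 → 0 < r → g (τ, r • x) = 0 → r = ρ (τ, x) := by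
    intro τ x r hx hr h
    rcases lt_trichotomy r (ρ (τ, x)) with hlt | heq | hgt
    · exact absurd h (neg τ x r hx hr hlt).ne
    · exact heq
    · exact absurd h (pos τ x r hx hgt).ne'
  -- The function `ρ` is homogeneous of degree `-1` in `x`.
  have hom : ∀ τ x (t : ℝ), x ≠ 0 → 0 < t → ρ (τ, t • x) = ρ (τ, x) / t := by
    intro τ x t hx ht
    refine (uniq τ (t • x) _ (smul_ne_zero ht.ne' hx) (div_pos (ρpos _) ht) ?_).symm
    rw [smul_smul, div_mul_cancel₀ _ ht.ne', hρ (τ, x) hx]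
  -- Continuity of `ρ`: since `g` is negative before and positive after the root, the inequalities
  -- `a < ρ` and `ρ < b` are open conditions on the sign of `g` at `a • x` and `b • x`.
  have hcont : ∀ τ x, x ≠ 0 → ContinuousAt ρ (τ, x) := by
    intro τ x hx
    have hne : ∀ᶠ z : P × E in nhds (τ, x), z.2 ≠ 0 :=
      continuous_snd.continuousAt.eventually_ne hx
    refine tendsto_order.2 ⟨fun a ha => ?_, fun b hb => ?_⟩
    · by_cases ha0 : 0 < a
      · have : ∀ᶠ z : P × E in nhds (τ, x), g (z.1, a • z.2) < 0 := by
          have hc : Continuous fun z : P × E => g (z.1, a • z.2) := by fun_prop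
          exact (hc.tendsto (τ, x)).eventually_lt_const (neg τ x a hx ha0 ha)
        filter_upwards [this, hne] with z hz hz0
        by_contra hcon
        rcases (not_lt.1 hcon).lt_or_eq with h | h
        · exact absurd hz (pos z.1 z.2 a hz0 h).le.not_gt
        · rw [← h, hρ z hz0] at hz
          exact lt_irrefl _ hz
      · exact Filter.Eventually.of_forall fun z => (not_lt.1 ha0).trans_lt (ρpos z)
    · have : ∀ᶠ z : P × E in nhds (τ, x), 0 < g (z.1, b • z.2) := by
        have hc : Continuous fun z : P × E => g (z.1, b • z.2) := by fun_prop
        exact (hc.tendsto (τ, x)).eventually_const_lt (pos τ x b hx hb)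
      filter_upwards [this, hne] with z hz hz0
      by_contra hcon
      rcases (not_lt.1 hcon).lt_or_eq with h | h
      · exact absurd hz (neg z.1 z.2 b hz0 ((ρpos _).trans hb) h).le.not_gt
      · rw [h, hρ z hz0] at hz
        exact lt_irrefl _ hz
  -- `Φ` maps the unit vector in each direction to the boundary point in this direction, and is
  -- extended linearly along the rays.
  let Φ : P × E → E := fun z => (‖z.2‖ * ρ z) • z.2
  have Φ0 : ∀ τ, Φ (τ, 0) = 0 := fun τ => by simp [Φ]
  have Φne : ∀ τ x, x ≠ 0 → Φ (τ, x) ≠ 0 := fun τ x hx =>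
    smul_ne_zero (mul_pos (norm_pos_iff.2 hx) (ρpos _)).ne' hx
  have Φsm : ∀ τ x (t : ℝ), x ≠ 0 → 0 < t → Φ (τ, t • x) = t • Φ (τ, x) := by
    intro τ x t hx ht
    simp only [Φ]
    rw [hom τ x t hx ht, norm_smul, Real.norm_of_nonneg ht.le, smul_smul, smul_smul]
    congr 1
    field_simp
  refine ⟨Φ, ?_, ?_, ?_, ?_⟩
  -- Continuity at `x = 0` follows from the bound `‖Φ (τ, x)‖ ≤ ‖x‖ R`.
  · refine continuous_iff_continuousAt.2 ?_
    rintro ⟨τ, x⟩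
    by_cases hx : x = 0
    · subst hx
      rw [ContinuousAt, Φ0]
      refine squeeze_zero_norm (a := fun z : P × E => ‖z.2‖ * R) ?_ ?_
      · rintro ⟨σ, y⟩
        by_cases hy : y = 0
        · subst hy
          simp [Φ0]
        · have := hR σ _ (hρ (σ, y) hy).le
          simp only [Φ]
          rw [mul_smul, norm_smul, norm_norm]
          exact mul_le_mul_of_nonneg_left this (norm_nonneg _)
      · have : Continuous fun z : P × E => ‖z.2‖ * R := by fun_prop
        simpa using this.tendsto (τ, 0)
    · have h1 := hcont τ x hx
      exact ((continuous_snd.norm.continuousAt).mul h1).smul continuous_snd.continuousAt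
  · intro τ x _ y _ hxy
    simp only at hxy
    by_cases hx : x = 0
    · by_contra hne
      subst hx
      exact Φne τ y (fun h => hne h.symm) (by rw [← hxy, Φ0])
    · have hy : y ≠ 0 := by
        rintro rfl
        exact Φne τ x hx (by rw [hxy, Φ0])
      set a := ‖x‖ * ρ (τ, x)
      set b := ‖y‖ * ρ (τ, y)
      have ha : 0 < a := mul_pos (norm_pos_iff.2 hx) (ρpos _)
      have hb : 0 < b := mul_pos (norm_pos_iff.2 hy) (ρpos _)
      have e : a • x = b • y := hxy
      have hyx : y = (a / b) • x := by
        rw [div_eq_inv_mul, mul_smul, e, smul_smul, inv_mul_cancel₀ hb.ne', one_smul]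
      have h2 := Φsm τ x (a / b) hx (div_pos ha hb)
      rw [← hyx, ← hxy] at h2
      have h3 : (1 - a / b) • Φ (τ, x) = 0 := by rw [sub_smul, one_smul, ← h2, sub_self]
      rcases smul_eq_zero.1 h3 with h | h
      · rw [hyx, show a / b = 1 by linarith, one_smul]
      · exact absurd h (Φne τ x hx)
  · intro τ y
    constructor
    · intro hy
      by_cases hy0 : y = 0
      · exact ⟨0, by simp, by rw [Φ0, hy0]⟩
      · have hn : 0 < ‖y‖ := norm_pos_iff.2 hy0
        have h1 : 1 ≤ ρ (τ, y) := by
          by_contra hcon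
          have := pos τ y 1 hy0 (not_le.1 hcon)
          rw [one_smul] at this
          linarith
        refine ⟨(‖y‖ * ρ (τ, y))⁻¹ • y, ?_, ?_⟩
        · rw [mem_closedBall_zero_iff, norm_smul, norm_inv, norm_mul, norm_norm,
            Real.norm_of_nonneg (ρpos _).le, mul_inv, mul_right_comm, inv_mul_cancel₀ hn.ne',
            one_mul]
          exact inv_le_one_of_one_le₀ h1
        · have hp : 0 < ‖y‖ * ρ (τ, y) := mul_pos hn (ρpos _)
          rw [Φsm τ y _ hy0 (inv_pos.2 hp)]
          simp only [Φ]
          rw [smul_smul, inv_mul_cancel₀ hp.ne', one_smul]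
    · rintro ⟨x, hx, rfl⟩
      by_cases hx0 : x = 0
      · rw [hx0, Φ0]; exact (h0 τ).le
      · simp only [Φ]
        have hn : 0 < ‖x‖ := norm_pos_iff.2 hx0
        rcases (mem_closedBall_zero_iff.1 hx).lt_or_eq with h | h
        · exact (neg τ x _ hx0 (mul_pos hn (ρpos _)) (by nlinarith [ρpos (τ, x)])).le
        · rw [h, one_mul, hρ (τ, x) hx0]
  · intro τ x hx
    by_cases hx0 : x = 0
    · rw [hx0, Φ0]
      simp [(h0 τ).ne]
    · simp only [Φ]
      have hn : 0 < ‖x‖ := norm_pos_iff.2 hx0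
      rcases (mem_closedBall_zero_iff.1 hx).lt_or_eq with h | h
      · exact iff_of_false (neg τ x _ hx0 (mul_pos hn (ρpos _)) (by nlinarith [ρpos (τ, x)])).ne h.ne
      · exact iff_of_true (by rw [h, one_mul, hρ (τ, x) hx0]) h

/-! ### Central projection to the 3-sphere -/

open Classical in
/-- The central projection of the nonzero quaternions to the unit sphere; the junk value at `0`
is `1`. -/
def nrm (x : ℍ[ℝ]) : UnitQuaternion :=
  if h : x = 0 then 1 else ⟨‖x‖⁻¹ • x, by simp [norm_smul, h]⟩

theorem coe_nrm {x : ℍ[ℝ]} (h : x ≠ 0) : (nrm x : ℍ[ℝ]) = ‖x‖⁻¹ • x := by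
  rw [nrm, dif_neg h]

theorem nrm_smul {x : ℍ[ℝ]} (h : x ≠ 0) {r : ℝ} (hr : 0 < r) : nrm (r • x) = nrm x := by
  apply Subtype.ext
  rw [coe_nrm h, coe_nrm (smul_ne_zero hr.ne' h), norm_smul, Real.norm_of_nonneg hr.le, smul_smul]
  congr 1
  field_simp

theorem nrm_coe (x : UnitQuaternion) : nrm (x : ℍ[ℝ]) = x := by
  apply Subtype.ext
  rw [coe_nrm (ne_zero_of_mem_unit_sphere x), norm_eq_of_mem_sphere x, inv_one, one_smul]

theorem exists_smul_eq_of_nrm {x : ℍ[ℝ]} (h : x ≠ 0) : ∃ r : ℝ, 0 < r ∧ (nrm x : ℍ[ℝ]) = r • x :=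
  ⟨‖x‖⁻¹, inv_pos.2 (norm_pos_iff.2 h), coe_nrm h⟩

theorem continuousAt_nrm {x : ℍ[ℝ]} (h : x ≠ 0) : ContinuousAt nrm x := by
  rw [Topology.IsInducing.subtypeVal.continuousAt_iff]
  have : (fun y : ℍ[ℝ] => ‖y‖⁻¹ • y) =ᶠ[nhds x] (Subtype.val ∘ nrm) := by
    filter_upwards [continuousAt_id.eventually_ne h] with y hy
    exact (coe_nrm hy).symm
  refine ContinuousAt.congr ?_ this
  exact (continuous_norm.continuousAt.inv₀ (norm_ne_zero_iff.2 h)).smul continuousAt_id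

/-- Euclidean coordinates on a subspace of the quaternions. -/
theorem exists_linearIsometry_range (K : Submodule ℝ ℍ[ℝ]) {k : ℕ}
    (hk : Module.finrank ℝ K = k) :
    ∃ ι : EuclideanSpace ℝ (Fin k) →ₗᵢ[ℝ] ℍ[ℝ], ∀ x, x ∈ K ↔ ∃ w, ι w = x := by
  let b := (stdOrthonormalBasis ℝ K).reindex (finCongr hk)
  refine ⟨K.subtypeₗᵢ.comp b.repr.symm.toLinearIsometry, fun x => ⟨fun hx => ?_, ?_⟩⟩
  · exact ⟨b.repr ⟨x, hx⟩, by simp⟩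
  · rintro ⟨w, rfl⟩
    simp

/-- A region of the 3-sphere which is strictly star-shaped with respect to the direction of `c` is
a ball. -/
theorem exists_ball_chart (c : ℍ[ℝ]) (hc : c ≠ 0) (G : UnitQuaternion → ℝ) (hG : Continuous G)
    (h0 : G (nrm c) < 0)
    (h1 : ∀ x : UnitQuaternion, 0 < ⟪(x : ℍ[ℝ]), c⟫_ℝ → x ≠ nrm c → G x ≤ 0 →
      ∀ t : ℝ, 0 < t → G (nrm (x + t • c)) < 0)
    (m : ℝ) (hm : 0 < m) (h2 : ∀ x : UnitQuaternion, 0 < ⟪(x : ℍ[ℝ]), c⟫_ℝ → G x ≤ 0 →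
      m ≤ ⟪(x : ℍ[ℝ]), c⟫_ℝ) :
    ∃ β : E3 → UnitQuaternion, Continuous β ∧ Set.InjOn β (Metric.closedBall 0 1) ∧
      (∀ x : UnitQuaternion, (0 < ⟪(x : ℍ[ℝ]), c⟫_ℝ ∧ G x ≤ 0) ↔ ∃ w ∈ Metric.closedBall 0 1, β w = x) ∧
      ∀ w ∈ Metric.closedBall 0 1, G (β w) = 0 ↔ ‖w‖ = 1 := by
  have hcc : 0 < ⟪c, c⟫_ℝ := by rw [real_inner_self_eq_norm_sq]; positivity
  -- In the affine hyperplane through `c` orthogonal to `c`, the rays from `c` correspond to the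
  -- arcs through `nrm c`, hence the region becomes star-shaped with respect to `c`.
  obtain ⟨ι, hι⟩ := exists_linearIsometry_range (ℝ ∙ c)ᗮ (k := 3)
    (Submodule.finrank_orthogonal_span_singleton (𝕜 := ℝ) (n := 3) hc)
  have orth : ∀ w, ⟪ι w, c⟫_ℝ = 0 := fun w =>
    (real_inner_comm _ _).trans (Submodule.mem_orthogonal_singleton_iff_inner_right.1 ((hι _).2 ⟨w, rfl⟩))
  have inn : ∀ w, ⟪c + ι w, c⟫_ℝ = ⟪c, c⟫_ℝ := fun w => by rw [inner_add_left, orth, add_zero]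
  have ne : ∀ w, c + ι w ≠ 0 := fun w h => by
    have := inn w
    rw [h, inner_zero_left] at this
    exact hcc.ne this
  have hcont : Continuous fun w => nrm (c + ι w) := by
    refine continuous_iff_continuousAt.2 fun w => (continuousAt_nrm (ne w)).comp
      (f := fun w => c + ι w) ?_
    have := ι.continuous
    fun_prop
  have hinj : ∀ w w', nrm (c + ι w) = nrm (c + ι w') → w = w' := by
    intro w w' h
    obtain ⟨r, hr, hr'⟩ := exists_smul_eq_of_nrm (ne w)
    obtain ⟨s, hs, hs'⟩ := exists_smul_eq_of_nrm (ne w')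
    have e : r • (c + ι w) = s • (c + ι w') := by rw [← hr', ← hs', h]
    have e1 := congrArg (fun z => ⟪z, c⟫_ℝ) e
    simp only [inner_smul_left, inn, RCLike.conj_to_real] at e1
    have : r = s := mul_right_cancel₀ hcc.ne' e1
    subst this
    exact ι.injective (add_left_cancel (smul_right_injective _ hr.ne' e))
  have hpos : ∀ w, 0 < ⟪(nrm (c + ι w) : ℍ[ℝ]), c⟫_ℝ := by
    intro w
    obtain ⟨r, hr, hr'⟩ := exists_smul_eq_of_nrm (ne w)
    rw [hr', inner_smul_left, inn]
    exact mul_pos hr hcc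
  have hsurj : ∀ x : UnitQuaternion, 0 < ⟪(x : ℍ[ℝ]), c⟫_ℝ → ∃ w, nrm (c + ι w) = x := by
    intro x hx
    have : (⟪c, c⟫_ℝ / ⟪(x : ℍ[ℝ]), c⟫_ℝ) • (x : ℍ[ℝ]) - c ∈ (ℝ ∙ c)ᗮ := by
      rw [Submodule.mem_orthogonal_singleton_iff_inner_left, inner_sub_left, inner_smul_left]
      simp [hx.ne']
    obtain ⟨w, hw⟩ := (hι _).1 this
    refine ⟨w, ?_⟩
    rw [hw, add_sub_cancel, nrm_smul (ne_zero_of_mem_unit_sphere x) (div_pos hcc hx), nrm_coe]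
  obtain ⟨Φ, Φc, Φi, Φr, Φb⟩ := exists_radial_homeomorph
    (fun z : Unit × E3 => G (nrm (c + ι z.2))) (hG.comp (hcont.comp continuous_snd))
    (fun _ => by simpa using h0)
    (by
      -- The point `c + ι (s • w)` is a positive multiple of `x + t • c` for the point `x` below
      -- `c + ι w`.
      intro _ w s hw hs hs1 hle
      have h := h1 _ (hpos w) (fun h => hw (hinj w 0 (by simpa using h))) hle
      obtain ⟨r, hr, hr'⟩ := exists_smul_eq_of_nrm (ne w)
      have h3 := h (r * ((1 - s) / s)) (mul_pos hr (div_pos (by linarith) hs))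
      have e : c + ι (s • w) = (s / r) • ((nrm (c + ι w) : ℍ[ℝ]) + (r * ((1 - s) / s)) • c) := by
        rw [hr', map_smul]
        match_scalars
        · field_simp
          ring
        · field_simp
      rw [e, nrm_smul _ (div_pos hs hr)]
      · exact h3
      · intro h0
        rw [h0, smul_zero] at e
        exact ne _ e)
    (⟪c, c⟫_ℝ / m) (by
      intro _ w hle
      have h3 := h2 _ (hpos w) hle
      rw [coe_nrm (ne w), inner_smul_left, inn] at h3
      have hn : 0 < ‖c + ι w‖ := norm_pos_iff.2 (ne w)
      have h4 : ‖w‖ ≤ ‖c + ι w‖ := by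
        have : ‖c + ι w‖ * ‖c + ι w‖ = ‖c‖ * ‖c‖ + ‖ι w‖ * ‖ι w‖ :=
          norm_add_sq_eq_norm_sq_add_norm_sq_real ((real_inner_comm _ _).trans (orth w))
        rw [ι.norm_map] at this
        nlinarith [norm_nonneg w, mul_self_nonneg ‖c‖]
      rw [le_div_iff₀ hm]
      simp only [RCLike.conj_to_real] at h3
      rw [← div_eq_inv_mul, le_div_iff₀ hn] at h3
      nlinarith)
  refine ⟨fun w => nrm (c + ι (Φ ((), w))), ?_, ?_, ?_, ?_⟩
  · exact hcont.comp (Φc.comp (Continuous.prodMk_right ()))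
  · intro w hw w' hw' h
    exact Φi () hw hw' (hinj _ _ h)
  · intro x
    constructor
    · rintro ⟨hx, hGx⟩
      obtain ⟨w, rfl⟩ := hsurj x hx
      obtain ⟨w', hw', rfl⟩ := (Φr () w).1 hGx
      exact ⟨w', hw', rfl⟩
    · rintro ⟨w, hw, rfl⟩
      exact ⟨hpos _, (Φr () _).2 ⟨w, hw, rfl⟩⟩
  · intro w hw
    exact Φb () w hw

/-- The orthogonal projection of `x` to the plane spanned by the orthogonal vectors `p`, `n`. -/
def planeProj (p n x : ℍ[ℝ]) : ℍ[ℝ] := (⟪x, p⟫_ℝ / ⟪p, p⟫_ℝ) • p + (⟪x, n⟫_ℝ / ⟪n, n⟫_ℝ) • n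

/-- A region of the 3-sphere bounded by the hyperplanes `⟪x, n⟫ = ± η ⟪x, p⟫`, all of whose slices
by the hyperplanes `⟪x, n⟫ = s ⟪x, p⟫` are strictly star-shaped with respect to the plane of `p`
and `n`, is a solid cylinder. -/
theorem exists_handle_chart (p n : ℍ[ℝ]) (hp : p ≠ 0) (hn : n ≠ 0) (hpn : ⟪p, n⟫_ℝ = 0)
    (η : ℝ) (hη : 0 < η) (G : UnitQuaternion → ℝ) (hG : Continuous G)
    (h0 : ∀ x : UnitQuaternion, 0 < ⟪(x : ℍ[ℝ]), p⟫_ℝ → |⟪(x : ℍ[ℝ]), n⟫_ℝ| ≤ η * ⟪(x : ℍ[ℝ]), p⟫_ℝ →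
      (x : ℍ[ℝ]) = planeProj p n x → G x < 0)
    (h1 : ∀ x : UnitQuaternion, 0 < ⟪(x : ℍ[ℝ]), p⟫_ℝ → |⟪(x : ℍ[ℝ]), n⟫_ℝ| ≤ η * ⟪(x : ℍ[ℝ]), p⟫_ℝ →
      (x : ℍ[ℝ]) ≠ planeProj p n x → G x ≤ 0 → ∀ t : ℝ, 0 < t → G (nrm (x + t • planeProj p n x)) < 0)
    (m : ℝ) (hm : 0 < m)
    (h2 : ∀ x : UnitQuaternion, 0 < ⟪(x : ℍ[ℝ]), p⟫_ℝ → |⟪(x : ℍ[ℝ]), n⟫_ℝ| ≤ η * ⟪(x : ℍ[ℝ]), p⟫_ℝ →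
      G x ≤ 0 → m ≤ ⟪(x : ℍ[ℝ]), p⟫_ℝ) :
    ∃ χ : ℝ × E2 → UnitQuaternion, Continuous χ ∧ Set.InjOn χ cylinder ∧
      (∀ x : UnitQuaternion, (0 < ⟪(x : ℍ[ℝ]), p⟫_ℝ ∧ |⟪(x : ℍ[ℝ]), n⟫_ℝ| ≤ η * ⟪(x : ℍ[ℝ]), p⟫_ℝ ∧ G x ≤ 0) ↔
        ∃ w ∈ cylinder, χ w = x) ∧
      ∀ w ∈ cylinder, ⟪(χ w : ℍ[ℝ]), n⟫_ℝ = w.1 * (η * ⟪(χ w : ℍ[ℝ]), p⟫_ℝ) := by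
  have hpp : 0 < ⟪p, p⟫_ℝ := by rw [real_inner_self_eq_norm_sq]; positivity
  have hnn : 0 < ⟪n, n⟫_ℝ := by rw [real_inner_self_eq_norm_sq]; positivity
  have hnp : ⟪n, p⟫_ℝ = 0 := (real_inner_comm _ _).trans hpn
  have hind : LinearIndependent ℝ ![p, n] := by
    rw [LinearIndependent.pair_iff]
    intro s t h
    have e1 := congrArg (fun z => ⟪z, p⟫_ℝ) h
    have e2 := congrArg (fun z => ⟪z, n⟫_ℝ) h
    simp only [inner_add_left, inner_smul_left, hnp, hpn, inner_zero_left, RCLike.conj_to_real,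
      mul_zero, add_zero, zero_add, mul_eq_zero, hpp.ne', hnn.ne', or_false] at e1 e2
    exact ⟨e1, e2⟩
  have hfr : Module.finrank ℝ (Submodule.span ℝ (Set.range ![p, n]))ᗮ = 2 := by
    have h1 := finrank_span_eq_card hind
    have h2 := Submodule.finrank_add_finrank_orthogonal (Submodule.span ℝ (Set.range ![p, n]))
    rw [h1, Quaternion.finrank_eq_four, Fintype.card_fin] at h2
    omega
  -- The slice by `⟪x, n⟫ = τ η ⟪x, p⟫` is projected to the affine plane through `c τ` orthogonal to
  -- `p` and `n`. There it is star-shaped with respect to `c τ`.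
  obtain ⟨ι, hι⟩ := exists_linearIsometry_range _ hfr
  have mem : ∀ x, x ∈ (Submodule.span ℝ (Set.range ![p, n]))ᗮ ↔ ⟪x, p⟫_ℝ = 0 ∧ ⟪x, n⟫_ℝ = 0 := by
    intro x
    rw [Matrix.range_cons, Matrix.range_cons, Matrix.range_empty, Set.union_empty,
      Submodule.mem_orthogonal']
    refine ⟨fun h => ⟨h _ (Submodule.subset_span (by simp)), h _ (Submodule.subset_span (by simp))⟩,
      fun h u hu => ?_⟩
    induction hu using Submodule.span_induction with
    | mem u hu =>
      rcases hu with rfl | rfl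
      · exact h.1
      · exact h.2
    | zero => simp
    | add u v _ _ h1 h2 => rw [inner_add_right, h1, h2, add_zero]
    | smul r u _ h1 => rw [inner_smul_right, h1, mul_zero]
  have orth : ∀ w, ⟪ι w, p⟫_ℝ = 0 ∧ ⟪ι w, n⟫_ℝ = 0 := fun w => (mem _).1 ((hι _).2 ⟨w, rfl⟩)
  set δ : ℝ := η * ⟪p, p⟫_ℝ / ⟪n, n⟫_ℝ with hδ
  let c : ℝ → ℍ[ℝ] := fun τ => p + (δ * τ) • n
  have cp : ∀ τ, ⟪c τ, p⟫_ℝ = ⟪p, p⟫_ℝ := fun τ => by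
    simp only [c, inner_add_left, inner_smul_left, hnp, mul_zero, add_zero]
  have cn : ∀ τ, ⟪c τ, n⟫_ℝ = η * ⟪p, p⟫_ℝ * τ := fun τ => by
    simp only [c, inner_add_left, inner_smul_left, hpn, zero_add, RCLike.conj_to_real, hδ]
    field_simp
  have innp : ∀ τ w, ⟪c τ + ι w, p⟫_ℝ = ⟪p, p⟫_ℝ := fun τ w => by
    rw [inner_add_left, cp, (orth w).1, add_zero]
  have innn : ∀ τ w, ⟪c τ + ι w, n⟫_ℝ = η * ⟪p, p⟫_ℝ * τ := fun τ w => by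
    rw [inner_add_left, cn, (orth w).2, add_zero]
  have ne : ∀ τ w, c τ + ι w ≠ 0 := fun τ w h => by
    have := innp τ w
    rw [h, inner_zero_left] at this
    exact hpp.ne this
  have hcont : Continuous fun z : ℝ × E2 => nrm (c z.1 + ι z.2) := by
    refine continuous_iff_continuousAt.2 fun z => (continuousAt_nrm (ne z.1 z.2)).comp
      (f := fun z : ℝ × E2 => c z.1 + ι z.2) ?_
    have := ι.continuous
    fun_prop
  have hinn : ∀ τ w, ∃ r : ℝ, 0 < r ∧ (nrm (c τ + ι w) : ℍ[ℝ]) = r • (c τ + ι w) ∧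
      ⟪(nrm (c τ + ι w) : ℍ[ℝ]), p⟫_ℝ = r * ⟪p, p⟫_ℝ ∧
      ⟪(nrm (c τ + ι w) : ℍ[ℝ]), n⟫_ℝ = η * (r * ⟪p, p⟫_ℝ) * τ ∧
      planeProj p n (nrm (c τ + ι w) : ℍ[ℝ]) = r • c τ := by
    intro τ w
    obtain ⟨r, hr, hr'⟩ := exists_smul_eq_of_nrm (ne τ w)
    have e1 : ⟪(nrm (c τ + ι w) : ℍ[ℝ]), p⟫_ℝ = r * ⟪p, p⟫_ℝ := by
      rw [hr', inner_smul_left, innp]; rfl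
    have e2 : ⟪(nrm (c τ + ι w) : ℍ[ℝ]), n⟫_ℝ = η * (r * ⟪p, p⟫_ℝ) * τ := by
      rw [hr', inner_smul_left, innn, RCLike.conj_to_real]; ring
    refine ⟨r, hr, hr', e1, e2, ?_⟩
    rw [planeProj, e1, e2]
    simp only [c, hδ]
    match_scalars <;> field_simp
  have hinj : ∀ τ w τ' w', nrm (c τ + ι w) = nrm (c τ' + ι w') → τ = τ' ∧ w = w' := by
    intro τ w τ' w' h
    obtain ⟨r, hr, e0, e1, e2, -⟩ := hinn τ w
    obtain ⟨s, hs, f0, f1, f2, -⟩ := hinn τ' w'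
    rw [h] at e0 e1 e2
    have hrs : r = s := mul_right_cancel₀ hpp.ne' (e1.symm.trans f1)
    subst hrs
    have hτ : τ = τ' := mul_left_cancel₀ (by positivity) (e2.symm.trans f2)
    subst hτ
    exact ⟨rfl, ι.injective (add_left_cancel (smul_right_injective _ hr.ne' (e0.symm.trans f0)))⟩
  have hpos : ∀ τ w, 0 < ⟪(nrm (c τ + ι w) : ℍ[ℝ]), p⟫_ℝ := by
    intro τ w
    obtain ⟨r, hr, -, e1, -⟩ := hinn τ w
    rw [e1]; positivity
  have habs : ∀ τ w, |⟪(nrm (c τ + ι w) : ℍ[ℝ]), n⟫_ℝ| =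
      η * ⟪(nrm (c τ + ι w) : ℍ[ℝ]), p⟫_ℝ * |τ| := by
    intro τ w
    obtain ⟨r, hr, -, e1, e2, -⟩ := hinn τ w
    rw [e1, e2, abs_mul, abs_of_pos (by positivity : 0 < η * (r * ⟪p, p⟫_ℝ))]
  have hle : ∀ τ w, τ ∈ Set.Icc (-1 : ℝ) 1 → |⟪(nrm (c τ + ι w) : ℍ[ℝ]), n⟫_ℝ| ≤
      η * ⟪(nrm (c τ + ι w) : ℍ[ℝ]), p⟫_ℝ := by
    intro τ w hτ
    rw [habs]
    exact mul_le_of_le_one_right (mul_nonneg hη.le (hpos τ w).le) (abs_le.2 hτ)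
  have hsurj : ∀ x : UnitQuaternion, 0 < ⟪(x : ℍ[ℝ]), p⟫_ℝ →
      |⟪(x : ℍ[ℝ]), n⟫_ℝ| ≤ η * ⟪(x : ℍ[ℝ]), p⟫_ℝ →
      ∃ τ ∈ Set.Icc (-1 : ℝ) 1, ∃ w, nrm (c τ + ι w) = x := by
    intro x hx hxn
    set τ : ℝ := ⟪(x : ℍ[ℝ]), n⟫_ℝ / (η * ⟪(x : ℍ[ℝ]), p⟫_ℝ) with hτ
    have : (⟪p, p⟫_ℝ / ⟪(x : ℍ[ℝ]), p⟫_ℝ) • (x : ℍ[ℝ]) - c τ ∈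
        (Submodule.span ℝ (Set.range ![p, n]))ᗮ := by
      rw [mem]
      constructor
      · rw [inner_sub_left, inner_smul_left, cp, RCLike.conj_to_real]
        field_simp
        ring
      · rw [inner_sub_left, inner_smul_left, cn, RCLike.conj_to_real, hτ]
        field_simp
        ring
    obtain ⟨w, hw⟩ := (hι _).1 this
    refine ⟨τ, ?_, w, ?_⟩
    · rw [Set.mem_Icc, ← abs_le, hτ, abs_div, abs_of_pos (by positivity : 0 < η * ⟪(x : ℍ[ℝ]), p⟫_ℝ)]
      exact (div_le_one (by positivity)).2 hxn
    · rw [hw, add_sub_cancel, nrm_smul (ne_zero_of_mem_unit_sphere x) (div_pos hpp hx), nrm_coe]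
  obtain ⟨Φ, Φc, Φi, Φr, -⟩ := exists_radial_homeomorph
    (fun z : Set.Icc (-1 : ℝ) 1 × E2 => G (nrm (c z.1 + ι z.2)))
    (hG.comp (hcont.comp (by fun_prop : Continuous fun z : Set.Icc (-1 : ℝ) 1 × E2 =>
      ((z.1 : ℝ), z.2))))
    (by
      rintro ⟨τ, hτ⟩
      obtain ⟨r, hr, e0, e1, e2, e3⟩ := hinn τ 0
      refine h0 _ (hpos τ 0) (hle τ 0 hτ) ?_
      rw [e3, e0, map_zero, add_zero])
    (by
      rintro ⟨τ, hτ⟩ w s hw hs hs1 hG0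
      simp only at hG0 ⊢
      obtain ⟨r, hr, e0, e1, e2, e3⟩ := hinn τ w
      have h := h1 _ (hpos τ w) (hle τ w hτ) (by
        rw [e3, e0]
        intro h
        have := smul_right_injective _ hr.ne' h
        simp only [add_eq_left] at this
        exact hw (ι.injective (by simpa using this))) hG0
      have h3 := h ((1 - s) / s) (div_pos (by linarith) hs)
      have e : c τ + ι (s • w) = (s / r) • ((nrm (c τ + ι w) : ℍ[ℝ]) + ((1 - s) / s) •
          planeProj p n (nrm (c τ + ι w) : ℍ[ℝ])) := by
        rw [e3, e0, map_smul]
        generalize c τ = y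
        match_scalars
        · field_simp
          ring
        · field_simp
      rw [e, nrm_smul _ (div_pos hs hr)]
      · exact h3
      · intro h0
        rw [h0, smul_zero] at e
        exact ne _ _ e)
    (⟪p, p⟫_ℝ / m) (by
      rintro ⟨τ, hτ⟩ w hG0
      simp only at hG0
      obtain ⟨r, hr, e0, e1, e2, e3⟩ := hinn τ w
      have h3 := h2 _ (hpos τ w) (hle τ w hτ) hG0
      rw [e1] at h3
      have h4 : ‖w‖ ≤ ‖c τ + ι w‖ := by
        have : ‖c τ + ι w‖ * ‖c τ + ι w‖ = ‖c τ‖ * ‖c τ‖ + ‖ι w‖ * ‖ι w‖ :=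
          norm_add_sq_eq_norm_sq_add_norm_sq_real (by
            simp only [c, inner_add_left, inner_smul_left, RCLike.conj_to_real]
            rw [real_inner_comm, (orth w).1, real_inner_comm, (orth w).2]
            ring)
        rw [ι.norm_map] at this
        nlinarith [norm_nonneg w, mul_self_nonneg ‖c τ‖, norm_nonneg (c τ + ι w)]
      have h5 := congrArg norm e0
      rw [norm_eq_of_mem_sphere, norm_smul, Real.norm_of_nonneg hr.le] at h5
      rw [le_div_iff₀ hm]
      calc ‖w‖ * m ≤ ‖c τ + ι w‖ * (r * ⟪p, p⟫_ℝ) := by gcongr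
        _ = (r * ‖c τ + ι w‖) * ⟪p, p⟫_ℝ := by ring
        _ = ⟪p, p⟫_ℝ := by rw [← h5, one_mul])
  have hI : (-1 : ℝ) ≤ 1 := by norm_num
  -- The parameter is projected to `[-1, 1]` to obtain a map that is continuous everywhere.
  refine ⟨fun z => nrm (c (Set.projIcc (-1 : ℝ) 1 hI z.1) +
    ι (Φ (Set.projIcc (-1 : ℝ) 1 hI z.1, z.2))), ?_, ?_, ?_, ?_⟩
  · have hpr : Continuous (Set.projIcc (-1 : ℝ) 1 hI) := continuous_projIcc
    exact hcont.comp (by fun_prop : Continuous fun z : ℝ × E2 =>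
      (((Set.projIcc (-1 : ℝ) 1 hI z.1 : Set.Icc (-1 : ℝ) 1) : ℝ),
        Φ (Set.projIcc (-1 : ℝ) 1 hI z.1, z.2)))
  · rintro ⟨τ, w⟩ ⟨hτ, hw⟩ ⟨τ', w'⟩ ⟨hτ', hw'⟩ h
    simp only at hτ hw hτ' hw' h
    rw [Set.projIcc_of_mem _ hτ, Set.projIcc_of_mem _ hτ'] at h
    obtain ⟨rfl, h⟩ := hinj _ _ _ _ h
    exact Prod.ext rfl (Φi ⟨τ, hτ⟩ hw hw' h)
  · intro x
    constructor
    · rintro ⟨hx, hxn, hGx⟩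
      obtain ⟨τ, hτ, w, rfl⟩ := hsurj x hx hxn
      obtain ⟨w', hw', rfl⟩ := (Φr ⟨τ, hτ⟩ w).1 hGx
      refine ⟨(τ, w'), ⟨hτ, hw'⟩, ?_⟩
      simp only
      rw [Set.projIcc_of_mem _ hτ]
    · rintro ⟨⟨τ, w⟩, ⟨hτ, hw⟩, rfl⟩
      simp only at hτ hw ⊢
      rw [Set.projIcc_of_mem _ hτ]
      exact ⟨hpos _ _, hle _ _ hτ, (Φr ⟨τ, hτ⟩ _).2 ⟨w, hw, rfl⟩⟩
  · rintro ⟨τ, w⟩ ⟨hτ, hw⟩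
    simp only at hτ hw ⊢
    rw [Set.projIcc_of_mem _ hτ]
    obtain ⟨r, hr, -, e1, e2, -⟩ := hinn τ (Φ (⟨τ, hτ⟩, w))
    rw [e1, e2]
    ring

/-! ### The height function -/

/-- The smooth function of the inner product with a vertex of the 600-cell from which the height
function is built. It vanishes up to `0.9352`, which is slightly more than the inner product
`φ / √3` of a vertex with the centre of an adjacent triangle. -/
def bump (s : ℝ) : ℝ := expNegInvGlue (s - 0.9352)

theorem bump_nonneg (s : ℝ) : 0 ≤ bump s := expNegInvGlue.nonneg _

theorem bump_eq_zero {s : ℝ} (h : s ≤ 0.9352) : bump s = 0 :=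
  expNegInvGlue.zero_of_nonpos (by linarith)

theorem bump_pos {s : ℝ} (h : 0.9352 < s) : 0 < bump s :=
  expNegInvGlue.pos_of_pos (by linarith)

theorem lt_of_bump_pos {s : ℝ} (h : 0 < bump s) : 0.9352 < s := by
  by_contra hcon
  rw [bump_eq_zero (not_lt.1 hcon)] at h
  exact lt_irrefl _ h

theorem bump_lt {s t : ℝ} (h : s < t) (ht : 0.9352 < t) : bump s < bump t := by
  by_cases hs : s ≤ 0.9352
  · rw [bump_eq_zero hs]; exact bump_pos ht
  · rw [bump, bump, expNegInvGlue, expNegInvGlue, if_neg (by linarith), if_neg (by linarith)]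
    refine Real.exp_lt_exp.2 (neg_lt_neg ?_)
    exact inv_strictAnti₀ (by linarith) (by linarith)

theorem bump_mono : Monotone bump := by
  intro s t h
  rcases h.lt_or_eq with h | rfl
  · by_cases ht : 0.9352 < t
    · exact (bump_lt h ht).le
    · rw [bump_eq_zero (by linarith)]; exact bump_nonneg _
  · exact le_rfl

theorem contDiff_bump : ContDiff ℝ ∞ bump := by
  unfold bump
  exact expNegInvGlue.contDiff.comp (by fun_prop)

theorem hasDerivAt_bump_pos {s : ℝ} (h : 0.9352 < s) : ∃ d, 0 < d ∧ HasDerivAt bump d s := by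
  have h1 : HasDerivAt (fun s : ℝ => Real.exp (-(s - 0.9352)⁻¹))
      (Real.exp (-(s - 0.9352)⁻¹) * -(-1 / (s - 0.9352) ^ 2)) s := by
    have h2 : HasDerivAt (fun s : ℝ => s - 0.9352) 1 s := (hasDerivAt_id s).sub_const _
    exact ((h2.inv (by linarith)).neg).exp
  refine ⟨_, ?_, h1.congr_of_eventuallyEq ?_⟩
  · have : 0 < s - 0.9352 := by linarith
    rw [neg_div, neg_neg]
    positivity
  · filter_upwards [lt_mem_nhds h] with t ht
    rw [bump, expNegInvGlue, if_neg (by linarith)]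

/-- The finite set of the 120 unit icosians. -/
def unitIcosians : Finset ℍ[ℝ] := IsUnitIcosian.finite.toFinset

theorem mem_unitIcosians {q : ℍ[ℝ]} : q ∈ unitIcosians ↔ IsUnitIcosian q := by
  simp [unitIcosians]

/-- The height function on the 3-sphere, whose level surface at `level` is the Heegaard surface. -/
def height (x : ℍ[ℝ]) : ℝ := ∑ v ∈ unitIcosians, bump ⟪x, v⟫_ℝ

/-- The value of the height function on the Heegaard surface. -/
def level : ℝ := bump 0.936

theorem level_pos : 0 < level := bump_pos (by norm_num)

theorem contDiff_height : ContDiff ℝ ∞ height := by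
  unfold height
  exact ContDiff.sum fun v _ => contDiff_bump.comp (contDiff_id.inner ℝ contDiff_const)

theorem continuous_height : Continuous height := contDiff_height.continuous

/-- The height is invariant under multiplication from both sides by unit icosians, as these permute
the vertices of the 600-cell. -/
theorem height_mul {a b : ℍ[ℝ]} (ha : IsUnitIcosian a) (hb : IsUnitIcosian b) (x : ℍ[ℝ]) :
    height (a * x * b) = height x := by
  refine Finset.sum_nbij' (fun v => star a * v * star b) (fun v => a * v * b) ?_ ?_ ?_ ?_ ?_
  · intro v hv
    exact mem_unitIcosians.2 ((ha.star.mul (mem_unitIcosians.1 hv)).mul hb.star)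
  · intro v hv
    exact mem_unitIcosians.2 ((ha.mul (mem_unitIcosians.1 hv)).mul hb)
  · intro v _
    simp only [← mul_assoc, quaternion_self_mul_star ha.norm, one_mul]
    rw [mul_assoc, quaternion_star_mul_self hb.norm, mul_one]
  · intro v _
    simp only [← mul_assoc, quaternion_star_mul_self ha.norm, one_mul]
    rw [mul_assoc, quaternion_self_mul_star hb.norm, mul_one]
  · intro v _
    rw [inner_mul_right_eq hb.norm, inner_mul_left_eq ha.norm, mul_assoc]

theorem bump_le_height {v : ℍ[ℝ]} (hv : IsUnitIcosian v) (x : ℍ[ℝ]) : bump ⟪x, v⟫_ℝ ≤ height x :=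
  Finset.single_le_sum (f := fun v => bump ⟪x, v⟫_ℝ) (fun _ _ => bump_nonneg _)
    (mem_unitIcosians.2 hv)

theorem bump_add_le_height {v w : ℍ[ℝ]} (hv : IsUnitIcosian v) (hw : IsUnitIcosian w) (h : v ≠ w)
    (x : ℍ[ℝ]) : bump ⟪x, v⟫_ℝ + bump ⟪x, w⟫_ℝ ≤ height x := by
  classical
  rw [← Finset.sum_pair (f := fun v => bump ⟪x, v⟫_ℝ) h]
  refine Finset.sum_le_sum_of_subset_of_nonneg ?_ fun _ _ _ => bump_nonneg _
  intro u hu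
  rcases Finset.mem_insert.1 hu with rfl | hu
  · exact mem_unitIcosians.2 hv
  · rw [Finset.mem_singleton.1 hu]; exact mem_unitIcosians.2 hw

theorem height_eq_single {v x : ℍ[ℝ]} (hv : IsUnitIcosian v)
    (h : ∀ u, IsUnitIcosian u → u ≠ v → ⟪x, u⟫_ℝ ≤ 0.9352) : height x = bump ⟪x, v⟫_ℝ :=
  Finset.sum_eq_single_of_mem v (mem_unitIcosians.2 hv) fun u hu huv =>
    bump_eq_zero (h u (mem_unitIcosians.1 hu) huv)

theorem height_eq_pair {v w x : ℍ[ℝ]} (hv : IsUnitIcosian v) (hw : IsUnitIcosian w) (hvw : v ≠ w)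
    (h : ∀ u, IsUnitIcosian u → u ≠ v → u ≠ w → ⟪x, u⟫_ℝ ≤ 0.9352) :
    height x = bump ⟪x, v⟫_ℝ + bump ⟪x, w⟫_ℝ := by
  classical
  rw [← Finset.sum_pair (f := fun v => bump ⟪x, v⟫_ℝ) hvw]
  refine (Finset.sum_subset ?_ fun u hu hn => ?_).symm
  · intro u hu
    rcases Finset.mem_insert.1 hu with rfl | hu
    · exact mem_unitIcosians.2 hv
    · rw [Finset.mem_singleton.1 hu]; exact mem_unitIcosians.2 hw
  · simp only [Finset.mem_insert, Finset.mem_singleton, not_or] at hn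
    exact bump_eq_zero (h u (mem_unitIcosians.1 hu) hn.1 hn.2)

theorem inner_le_of_height_le {v : ℍ[ℝ]} (hv : IsUnitIcosian v) {x : ℍ[ℝ]} (h : height x ≤ level) :
    ⟪x, v⟫_ℝ ≤ 0.936 := by
  by_contra hcon
  have := bump_lt (not_le.1 hcon) (by linarith)
  exact absurd ((bump_le_height hv x).trans h) (not_le.2 this)

/-- The sum of the inner products of a unit vector with three distinct vertices of the 600-cell is
largest at the centre of a triangle, where it is `√(3 + 3 φ) ≈ 2.8025`. -/
theorem inner_add_add_lt {u v w : ℍ[ℝ]} (hu : IsUnitIcosian u) (hv : IsUnitIcosian v)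
    (hw : IsUnitIcosian w) (huv : u ≠ v) (huw : u ≠ w) (hvw : v ≠ w) (x : UnitQuaternion) :
    ⟪(x : ℍ[ℝ]), u⟫_ℝ + ⟪(x : ℍ[ℝ]), v⟫_ℝ + ⟪(x : ℍ[ℝ]), w⟫_ℝ < 2.8026 := by
  rw [← inner_add_right, ← inner_add_right]
  have h1 := real_inner_le_norm (x : ℍ[ℝ]) (u + v + w)
  rw [norm_eq_of_mem_sphere, one_mul] at h1
  have h2 := hu.norm_add_add_sq_le hv hw huv huw hvw
  have h3 := goldenRatio_bounds
  nlinarith [norm_nonneg (u + v + w)]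

theorem coe_nrm_inner {y : ℍ[ℝ]} (hy : y ≠ 0) (v : ℍ[ℝ]) :
    ⟪(nrm y : ℍ[ℝ]), v⟫_ℝ = ⟪y, v⟫_ℝ / ‖y‖ := by
  rw [coe_nrm hy, inner_smul_left, RCLike.conj_to_real, div_eq_inv_mul]

/-- If `x` is sufficiently close to `c`, then the height decreases from `x` towards `c`: indeed the
inner product of the moving point with any vertex `v` decreases, unless it is so small that `v` does
not contribute to the height. -/
theorem height_nrm_add_smul_lt (c : ℍ[ℝ]) (A : ℝ) (hA : 0 < A)
    (hc : ∀ v, IsUnitIcosian v → ⟪c, v⟫_ℝ ≤ A) (x : UnitQuaternion)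
    (hx : A < 0.9352 * ⟪(x : ℍ[ℝ]), c⟫_ℝ) (hle : height x ≤ level) {t : ℝ} (ht : 0 < t) :
    height (nrm (x + t • c)) < level := by
  set X := ⟪(x : ℍ[ℝ]), c⟫_ℝ with hX
  have hX0 : 0 < X := by linarith
  set y := (x : ℍ[ℝ]) + t • c with hy
  have hxx : ⟪(x : ℍ[ℝ]), (x : ℍ[ℝ])⟫_ℝ = 1 := by
    rw [real_inner_self_eq_norm_sq, norm_eq_of_mem_sphere, one_pow]
  have hn : 1 + t * X ≤ ‖y‖ := by
    have := real_inner_le_norm (x : ℍ[ℝ]) y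
    rwa [hy, inner_add_right, inner_smul_right, hxx, norm_eq_of_mem_sphere x, one_mul] at this
  have hn0 : 0 < ‖y‖ := by nlinarith
  have hy0 : y ≠ 0 := norm_pos_iff.1 hn0
  have key : ∀ v, IsUnitIcosian v → bump ⟪(nrm y : ℍ[ℝ]), v⟫_ℝ = 0 ∨
      bump ⟪(nrm y : ℍ[ℝ]), v⟫_ℝ < bump ⟪(x : ℍ[ℝ]), v⟫_ℝ := by
    intro v hv
    have h1 := hc v hv
    have e : ⟪y, v⟫_ℝ = ⟪(x : ℍ[ℝ]), v⟫_ℝ + t * ⟪c, v⟫_ℝ := by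
      rw [hy, inner_add_left, inner_smul_left, RCLike.conj_to_real]
    rw [coe_nrm_inner hy0, e]
    -- A vertex with inner product at most `0.9352` stays so, as `⟪c, v⟫ ≤ A < 0.9352 ⟪x, c⟫`; for
    -- the other vertices, `⟪c, v⟫ < ⟪x, v⟫ ⟪x, c⟫` makes the inner product decrease.
    rcases le_or_gt ⟪(x : ℍ[ℝ]), v⟫_ℝ 0.9352 with h | h
    · refine Or.inl (bump_eq_zero ?_)
      rw [div_le_iff₀ hn0]
      nlinarith
    · refine Or.inr (bump_lt ?_ h)
      rw [div_lt_iff₀ hn0]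
      have : t * ⟪c, v⟫_ℝ < t * (⟪(x : ℍ[ℝ]), v⟫_ℝ * X) := by
        refine mul_lt_mul_of_pos_left ?_ ht
        nlinarith
      nlinarith
  by_cases h0 : ∀ v, IsUnitIcosian v → bump ⟪(nrm y : ℍ[ℝ]), v⟫_ℝ = 0
  · have : height (nrm y) = 0 := Finset.sum_eq_zero fun v hv => h0 v (mem_unitIcosians.1 hv)
    rw [this]; exact level_pos
  · push Not at h0
    obtain ⟨v, hv, hv0⟩ := h0
    refine lt_of_lt_of_le (Finset.sum_lt_sum (fun u hu => ?_) ⟨v, mem_unitIcosians.2 hv, ?_⟩) hle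
    · rcases key u (mem_unitIcosians.1 hu) with h | h
      · rw [h]; exact bump_nonneg _
      · exact h.le
    · exact (key v hv).resolve_left hv0

/-! ### The handlebody around the 1-skeleton of the 600-cell -/

/-- The part of the upper handlebody around the vertex `v` of the 600-cell. -/
def vertexBall (v : ℍ[ℝ]) : Set UnitQuaternion :=
  {x | 0.936 ≤ ⟪(x : ℍ[ℝ]), v⟫_ℝ ∧
    ∀ w, IsUnitIcosian w → w ≠ v → ⟪(x : ℍ[ℝ]), w⟫_ℝ ≤ 1999 / 2001 * ⟪(x : ℍ[ℝ]), v⟫_ℝ}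

/-- The part of the upper handlebody around the midpoint of the edge `{v, w}` of the 600-cell. -/
def edgeHandle (v w : ℍ[ℝ]) : Set UnitQuaternion :=
  {x | 0 < ⟪(x : ℍ[ℝ]), v + w⟫_ℝ ∧ |⟪(x : ℍ[ℝ]), v - w⟫_ℝ| ≤ 1 / 2000 * ⟪(x : ℍ[ℝ]), v + w⟫_ℝ ∧
    level ≤ bump ⟪(x : ℍ[ℝ]), v⟫_ℝ + bump ⟪(x : ℍ[ℝ]), w⟫_ℝ}

/-- The part around the vertex `1` is a ball, whose boundary contains the places where the edge
handles are attached. -/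
theorem exists_vertexBall_chart : ∃ β : E3 → UnitQuaternion, Continuous β ∧
    Set.InjOn β (Metric.closedBall 0 1) ∧ β '' Metric.closedBall 0 1 = vertexBall 1 ∧
    ∀ w, IsUnitIcosian w → w ≠ 1 → ∀ x ∈ vertexBall 1,
      ⟪(x : ℍ[ℝ]), w⟫_ℝ = 1999 / 2001 * ⟪(x : ℍ[ℝ]), 1⟫_ℝ → x ∈ β '' Metric.sphere 0 1 := by
  classical
  have hne : (unitIcosians.erase 1).Nonempty := by
    refine ⟨(Icosian.edgeRep 0).toH, Finset.mem_erase.2 ⟨fun h => ?_, ?_⟩⟩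
    · have := IsUnitIcosian.edgeRep_re 0
      rw [h, Quaternion.re_one] at this
      linarith [goldenRatio_bounds.2]
    · exact mem_unitIcosians.2 (isUnitIcosian_iff.2 ⟨_, Icosian.edgeRep_mem 0, rfl⟩)
  -- The maximum of the functions whose nonpositivity defines the region.
  let G : UnitQuaternion → ℝ := fun x => max (0.936 - ⟪(x : ℍ[ℝ]), 1⟫_ℝ)
    ((unitIcosians.erase 1).sup' hne fun v =>
      ⟪(x : ℍ[ℝ]), v⟫_ℝ - 1999 / 2001 * ⟪(x : ℍ[ℝ]), 1⟫_ℝ)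
  have hG : Continuous G := by
    refine Continuous.max (by fun_prop) (Continuous.finset_sup'_apply hne fun v _ => by fun_prop)
  have hGle : ∀ x, G x ≤ 0 ↔ x ∈ vertexBall 1 := by
    intro x
    simp only [G, max_le_iff, Finset.sup'_le_iff, Finset.mem_erase, mem_unitIcosians, vertexBall,
      Set.mem_ofPred_eq, sub_nonpos]
    exact and_congr_right fun _ => forall_congr' fun v => by tauto
  have hGlt : ∀ x : UnitQuaternion, 0.936 < ⟪(x : ℍ[ℝ]), 1⟫_ℝ → (∀ w, IsUnitIcosian w → w ≠ 1 →
      ⟪(x : ℍ[ℝ]), w⟫_ℝ < 1999 / 2001 * ⟪(x : ℍ[ℝ]), 1⟫_ℝ) → G x < 0 := by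
    intro x h1 h2
    simp only [G, max_lt_iff, Finset.sup'_lt_iff, Finset.mem_erase, mem_unitIcosians, sub_neg]
    exact ⟨h1, fun v hv => h2 v hv.2 hv.1⟩
  have hre : ∀ w, IsUnitIcosian w → w ≠ 1 → ⟪1, w⟫_ℝ < 1999 / 2001 := by
    intro w hw h
    have := hw.re_le h
    rw [inner_one_left]
    linarith [goldenRatio_bounds.2]
  have h11 : ⟪(1 : ℍ[ℝ]), 1⟫_ℝ = 1 := by rw [inner_one_left, Quaternion.re_one]
  have hnrm1 : (nrm 1 : ℍ[ℝ]) = 1 := by rw [coe_nrm one_ne_zero]; simp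
  obtain ⟨β, hβc, hβi, hβr, hβb⟩ := exists_ball_chart 1 one_ne_zero G hG
    (hGlt _ (by rw [hnrm1, h11]; norm_num) fun w hw h => by
      rw [hnrm1, h11, mul_one]; exact hre w hw h)
    (by
      -- Moving towards `1` makes all inequalities strict: the homogeneous ones hold strictly at
      -- `1`, and `(⟪x, 1⟫ + t) / (1 + t)` exceeds `0.936`.
      intro x hx _ hle t ht
      obtain ⟨h1, h2⟩ := (hGle x).1 hle
      have hX : ⟪(x : ℍ[ℝ]) + t • (1 : ℍ[ℝ]), 1⟫_ℝ = ⟪(x : ℍ[ℝ]), 1⟫_ℝ + t := by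
        rw [inner_add_left, inner_smul_left, h11, RCLike.conj_to_real, mul_one]
      have hy : (x : ℍ[ℝ]) + t • (1 : ℍ[ℝ]) ≠ 0 := by
        intro h
        rw [h, inner_zero_left] at hX
        linarith
      have hn : 0 < ‖(x : ℍ[ℝ]) + t • (1 : ℍ[ℝ])‖ := norm_pos_iff.2 hy
      have hn' : ‖(x : ℍ[ℝ]) + t • (1 : ℍ[ℝ])‖ ≤ 1 + t := by
        refine (norm_add_le _ _).trans ?_
        rw [norm_eq_of_mem_sphere, norm_smul, norm_one, mul_one, Real.norm_of_nonneg ht.le]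
      refine hGlt _ ?_ fun w hw hw1 => ?_
      · rw [coe_nrm_inner hy, lt_div_iff₀ hn, hX]
        nlinarith
      · rw [coe_nrm_inner hy, coe_nrm_inner hy, ← mul_div_assoc, div_lt_div_iff_of_pos_right hn, hX,
          inner_add_left, inner_smul_left, RCLike.conj_to_real]
        have := h2 w hw hw1
        have := mul_lt_mul_of_pos_left (hre w hw hw1) ht
        linarith)
    0.936 (by norm_num) (fun x _ hle => ((hGle x).1 hle).1)
  have himg : β '' Metric.closedBall 0 1 = vertexBall 1 := by
    ext x
    rw [← hGle, Set.mem_image, ← hβr]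
    refine and_iff_right_of_imp fun h => ?_
    have := ((hGle x).1 h).1
    linarith
  refine ⟨β, hβc, hβi, himg, ?_⟩
  intro w hw hw1 x hx he
  obtain ⟨z, hz, rfl⟩ := himg ▸ hx
  refine ⟨z, ?_, rfl⟩
  rw [mem_sphere_zero_iff_norm, ← hβb z hz]
  refine le_antisymm ((hGle _).2 hx) ?_
  refine le_max_of_le_right ?_
  exact (sub_eq_zero.2 he).ge.trans (Finset.le_sup' (fun v =>
    ⟪(β z : ℍ[ℝ]), v⟫_ℝ - 1999 / 2001 * ⟪(β z : ℍ[ℝ]), 1⟫_ℝ)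
    (Finset.mem_erase.2 ⟨hw1, mem_unitIcosians.2 hw⟩))

/-- The projection to the plane does not change the inner products with `p` and `n`. -/
theorem planeProj_inner {p n : ℍ[ℝ]} (hp : p ≠ 0) (hn : n ≠ 0) (hpn : ⟪p, n⟫_ℝ = 0) (x : ℍ[ℝ]) :
    ⟪planeProj p n x, p⟫_ℝ = ⟪x, p⟫_ℝ ∧ ⟪planeProj p n x, n⟫_ℝ = ⟪x, n⟫_ℝ := by
  have hpp : ⟪p, p⟫_ℝ ≠ 0 := inner_self_ne_zero.2 hp
  have hnn : ⟪n, n⟫_ℝ ≠ 0 := inner_self_ne_zero.2 hn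
  have hnp : ⟪n, p⟫_ℝ = 0 := (real_inner_comm _ _).trans hpn
  simp only [planeProj, inner_add_left, inner_smul_left, RCLike.conj_to_real, hpn, hnp, mul_zero,
    add_zero, zero_add, div_mul_cancel₀ _ hpp, div_mul_cancel₀ _ hnn, and_self]

theorem norm_planeProj_sq {p n : ℍ[ℝ]} (hp : p ≠ 0) (hn : n ≠ 0) (hpn : ⟪p, n⟫_ℝ = 0) (x : ℍ[ℝ]) :
    ‖planeProj p n x‖ ^ 2 = ⟪x, p⟫_ℝ ^ 2 / ⟪p, p⟫_ℝ + ⟪x, n⟫_ℝ ^ 2 / ⟪n, n⟫_ℝ := by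
  obtain ⟨h1, h2⟩ := planeProj_inner hp hn hpn x
  rw [← real_inner_self_eq_norm_sq]
  nth_rewrite 2 [planeProj]
  rw [inner_add_right, inner_smul_right, inner_smul_right, h1, h2]
  ring

theorem norm_planeProj_lt {p n : ℍ[ℝ]} (hp : p ≠ 0) (hn : n ≠ 0) (hpn : ⟪p, n⟫_ℝ = 0)
    {x : ℍ[ℝ]} (hx : x ≠ planeProj p n x) : ‖planeProj p n x‖ < ‖x‖ := by
  obtain ⟨h1, h2⟩ := planeProj_inner hp hn hpn x
  have h3 : ⟪planeProj p n x, x - planeProj p n x⟫_ℝ = 0 := by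
    nth_rewrite 1 [planeProj]
    rw [inner_add_left, inner_smul_left, inner_smul_left, inner_sub_right, inner_sub_right,
      ← real_inner_comm p x, ← real_inner_comm p (planeProj p n x), h1, ← real_inner_comm n x,
      ← real_inner_comm n (planeProj p n x), h2]
    simp
  have h4 := norm_add_sq_eq_norm_sq_add_norm_sq_real h3
  rw [add_sub_cancel] at h4
  have h5 : 0 < ‖x - planeProj p n x‖ := norm_pos_iff.2 (sub_ne_zero.2 hx)
  nlinarith [norm_nonneg x, norm_nonneg (planeProj p n x)]

section Edge

variable {v w : ℍ[ℝ]}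

/-- The ends of a handle around the edge from `v` to `w` lie in the hyperplanes where the ratio of
the inner products with `v` and `w` is `1999 / 2001 = (1 - 1 / 2000) / (1 + 1 / 2000)`. -/
theorem edgeHandle_inner_pos {x : ℍ[ℝ]} (h1 : 0 < ⟪x, v + w⟫_ℝ)
    (h2 : |⟪x, v - w⟫_ℝ| ≤ 1 / 2000 * ⟪x, v + w⟫_ℝ) :
    1999 / 2001 * ⟪x, w⟫_ℝ ≤ ⟪x, v⟫_ℝ ∧ 1999 / 2001 * ⟪x, v⟫_ℝ ≤ ⟪x, w⟫_ℝ ∧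
      0 < ⟪x, v⟫_ℝ ∧ 0 < ⟪x, w⟫_ℝ := by
  rw [inner_add_right] at h1 h2
  rw [inner_sub_right, abs_le] at h2
  refine ⟨?_, ?_, ?_, ?_⟩ <;> linarith [h2.1, h2.2]

/-- The part around the midpoint of an edge of the 600-cell is a solid cylinder, as its slices are
star-shaped with respect to the edge. -/
theorem exists_edgeHandle_chart (hv : ‖v‖ = 1) (hw : ‖w‖ = 1) (hvw : ⟪v, w⟫_ℝ = φ / 2) :
    ∃ χ : ℝ × E2 → UnitQuaternion, Continuous χ ∧ Set.InjOn χ cylinder ∧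
      χ '' cylinder = edgeHandle v w ∧
      ∀ z ∈ cylinder, ⟪(χ z : ℍ[ℝ]), v - w⟫_ℝ =
        z.1 * (1 / 2000 * ⟪(χ z : ℍ[ℝ]), v + w⟫_ℝ) := by
  have hφ := goldenRatio_bounds
  have hwv : ⟪w, v⟫_ℝ = φ / 2 := (real_inner_comm _ _).trans hvw
  have hvv : ⟪v, v⟫_ℝ = 1 := by rw [real_inner_self_eq_norm_sq, hv, one_pow]
  have hww : ⟪w, w⟫_ℝ = 1 := by rw [real_inner_self_eq_norm_sq, hw, one_pow]
  have hpp : ⟪v + w, v + w⟫_ℝ = 2 + φ := by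
    simp only [inner_add_left, inner_add_right, hvv, hww, hvw, hwv]; ring
  have hnn : ⟪v - w, v - w⟫_ℝ = 2 - φ := by
    simp only [inner_sub_left, inner_sub_right, hvv, hww, hvw, hwv]; ring
  have hpn : ⟪v + w, v - w⟫_ℝ = 0 := by
    simp only [inner_sub_right, inner_add_left, hvv, hww, hvw, hwv]; ring
  have hp : v + w ≠ 0 := fun h => by
    rw [h, inner_zero_left] at hpp; linarith
  have hn : v - w ≠ 0 := fun h => by
    rw [h, inner_zero_left] at hnn; linarith
  have hnorm : ∀ x : UnitQuaternion, ‖(x : ℍ[ℝ])‖ = 1 := fun x => norm_eq_of_mem_sphere x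
  obtain ⟨χ, hχc, hχi, hχr, hχb⟩ := exists_handle_chart (v + w) (v - w) hp hn hpn (1 / 2000)
    (by norm_num) (fun x => level - (bump ⟪(x : ℍ[ℝ]), v⟫_ℝ + bump ⟪(x : ℍ[ℝ]), w⟫_ℝ))
    (by have := contDiff_bump.continuous; fun_prop)
    (by
      intro x h1 h2 h3
      -- On the edge itself, `⟪x, v + w⟫` is close to `√(2 + φ) ≈ 1.902`, so that both inner
      -- products exceed `0.949`.
      have h4 := norm_planeProj_sq hp hn hpn x
      rw [← h3, hnorm, hpp, hnn] at h4
      obtain ⟨h5, h6⟩ := abs_le.1 h2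
      set P := ⟪(x : ℍ[ℝ]), v + w⟫_ℝ with hP
      set N := ⟪(x : ℍ[ℝ]), v - w⟫_ℝ with hN
      have hPvw : P = ⟪(x : ℍ[ℝ]), v⟫_ℝ + ⟪(x : ℍ[ℝ]), w⟫_ℝ := inner_add_right _ _ _
      have hNvw : N = ⟪(x : ℍ[ℝ]), v⟫_ℝ - ⟪(x : ℍ[ℝ]), w⟫_ℝ := inner_sub_right _ _ _
      have h7 : 1.9 < P := by
        by_contra hcon
        have h8 : P ^ 2 ≤ 1.9 ^ 2 := by nlinarith
        have h9 : N ^ 2 ≤ (1 / 2000 * 1.9) ^ 2 := by nlinarith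
        have h10 : P ^ 2 / (2 + φ) ≤ 0.998 := by
          rw [div_le_iff₀ (by linarith)]; nlinarith
        have h11 : N ^ 2 / (2 - φ) ≤ 0.001 := by
          rw [div_le_iff₀ (by linarith)]; nlinarith
        linarith
      have h8 : level < bump ⟪(x : ℍ[ℝ]), v⟫_ℝ := bump_lt (by linarith) (by linarith)
      linarith [bump_nonneg ⟪(x : ℍ[ℝ]), w⟫_ℝ])
    (by
      intro x h1 h2 h3 h4 t ht
      obtain ⟨-, -, h5, h6⟩ := edgeHandle_inner_pos h1 h2
      obtain ⟨h7, h8⟩ := planeProj_inner hp hn hpn x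
      have h9 := norm_planeProj_lt hp hn hpn h3
      rw [hnorm] at h9
      set a := planeProj (v + w) (v - w) (x : ℍ[ℝ])
      rw [inner_add_right, inner_add_right] at h7
      rw [inner_sub_right, inner_sub_right] at h8
      have hav : ⟪a, v⟫_ℝ = ⟪(x : ℍ[ℝ]), v⟫_ℝ := by linarith
      have haw : ⟪a, w⟫_ℝ = ⟪(x : ℍ[ℝ]), w⟫_ℝ := by linarith
      -- The inner products of `x + t • a` with `v` and `w` are `1 + t` times those of `x`, while
      -- its norm is less than `1 + t`; so both inner products increase.
      have hlt : ‖(x : ℍ[ℝ]) + t • a‖ < 1 + t := by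
        refine (norm_add_le _ _).trans_lt ?_
        rw [hnorm, norm_smul, Real.norm_of_nonneg ht.le]
        nlinarith
      have hy : (x : ℍ[ℝ]) + t • a ≠ 0 := by
        intro h
        have : ⟪(x : ℍ[ℝ]) + t • a, v⟫_ℝ = (1 + t) * ⟪(x : ℍ[ℝ]), v⟫_ℝ := by
          rw [inner_add_left, inner_smul_left, hav, RCLike.conj_to_real]; ring
        rw [h, inner_zero_left] at this
        exact (mul_pos (by linarith : 0 < 1 + t) h5).ne this
      have hy0 := norm_pos_iff.2 hy
      have inc : ∀ u, ⟪a, u⟫_ℝ = ⟪(x : ℍ[ℝ]), u⟫_ℝ → 0 < ⟪(x : ℍ[ℝ]), u⟫_ℝ →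
          ⟪(x : ℍ[ℝ]), u⟫_ℝ < ⟪(nrm ((x : ℍ[ℝ]) + t • a) : ℍ[ℝ]), u⟫_ℝ := by
        intro u hu hu0
        rw [coe_nrm_inner hy, lt_div_iff₀ hy0, inner_add_left, inner_smul_left, hu,
          RCLike.conj_to_real]
        nlinarith
      have iv := inc v hav h5
      have iw := inc w haw h6
      have hpos := level_pos
      rcases (bump_nonneg ⟪(x : ℍ[ℝ]), v⟫_ℝ).lt_or_eq with h | h
      · have := bump_lt iv ((lt_of_bump_pos h).trans iv)
        have := bump_mono iw.le
        linarith
      · have h' : 0 < bump ⟪(x : ℍ[ℝ]), w⟫_ℝ := by linarith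
        have := bump_lt iw ((lt_of_bump_pos h').trans iw)
        have := bump_mono iv.le
        linarith)
    0.9352 (by norm_num)
    (by
      intro x h1 h2 h4
      obtain ⟨-, -, h5, h6⟩ := edgeHandle_inner_pos h1 h2
      rw [inner_add_right]
      have hpos := level_pos
      rcases (bump_nonneg ⟪(x : ℍ[ℝ]), v⟫_ℝ).lt_or_eq with h | h
      · linarith [lt_of_bump_pos h]
      · have h' : 0 < bump ⟪(x : ℍ[ℝ]), w⟫_ℝ := by linarith
        linarith [lt_of_bump_pos h'])
  have himg : χ '' cylinder = edgeHandle v w := by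
    ext x
    rw [Set.mem_image, ← hχr]
    simp only [edgeHandle, Set.mem_ofPred_eq, sub_nonpos]
  exact ⟨χ, hχc, hχi, himg, hχb⟩

end Edge

/-- The vertex balls and edge handles cover the upper handlebody. -/
theorem exists_mem_vertexBall_or_edgeHandle (x : UnitQuaternion) (h : level ≤ height x) :
    ∃ v, IsUnitIcosian v ∧ (x ∈ vertexBall v ∨
      ∃ w, IsUnitIcosian w ∧ v ≠ w ∧ 1 / 2 < ⟪v, w⟫_ℝ ∧ x ∈ edgeHandle v w) := by
  obtain ⟨v, hv, hmax⟩ := Finset.exists_max_image unitIcosians (fun v => ⟪(x : ℍ[ℝ]), v⟫_ℝ)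
    ⟨1, mem_unitIcosians.2 .one⟩
  rw [mem_unitIcosians] at hv
  have hmax' : ∀ u, IsUnitIcosian u → ⟪(x : ℍ[ℝ]), u⟫_ℝ ≤ ⟪(x : ℍ[ℝ]), v⟫_ℝ := fun u hu =>
    hmax u (mem_unitIcosians.2 hu)
  have hv0 : 0.9352 < ⟪(x : ℍ[ℝ]), v⟫_ℝ := by
    by_contra hcon
    have : height x = 0 := Finset.sum_eq_zero fun u hu =>
      bump_eq_zero ((hmax u hu).trans (not_lt.1 hcon))
    linarith [level_pos]
  refine ⟨v, hv, ?_⟩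
  by_cases hw : ∃ w, IsUnitIcosian w ∧ w ≠ v ∧ 1999 / 2001 * ⟪(x : ℍ[ℝ]), v⟫_ℝ < ⟪(x : ℍ[ℝ]), w⟫_ℝ
  · obtain ⟨w, hw, hwv, hlt⟩ := hw
    have hle := hmax' w hw
    have hothers : ∀ u, IsUnitIcosian u → u ≠ v → u ≠ w → ⟪(x : ℍ[ℝ]), u⟫_ℝ ≤ 0.9352 := by
      intro u hu huv huw
      by_contra hcon
      -- A third vertex with inner product above `0.9352` is excluded, since
      -- `2 * 0.9352 + 0.9342 > 2.8026`.
      have := inner_add_add_lt hv hw hu hwv.symm huv.symm huw.symm x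
      linarith
    refine Or.inr ⟨w, hw, hwv.symm, ?_, ?_, ?_, ?_⟩
    · have h1 := real_inner_le_norm (x : ℍ[ℝ]) (v + w)
      rw [norm_eq_of_mem_sphere, one_mul, inner_add_right] at h1
      have h2 := norm_add_sq_real v w
      rw [hv.norm, hw.norm] at h2
      have h3 : (1.86 : ℝ) < ‖v + w‖ := by linarith
      nlinarith
    · rw [inner_add_right]; linarith
    · rw [inner_add_right, inner_sub_right, abs_of_nonneg (by linarith)]; linarith
    · rwa [← height_eq_pair hv hw hwv.symm hothers]
  · push Not at hw
    refine Or.inl ⟨?_, hw⟩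
    -- If no other vertex comes near, only `v` contributes to the height.
    by_contra hcon
    have h1 := height_eq_single (x := (x : ℍ[ℝ])) hv fun u hu huv =>
      (hw u hu huv).trans (by linarith)
    have h2 : bump ⟪(x : ℍ[ℝ]), v⟫_ℝ < level := bump_lt (not_le.1 hcon) (by norm_num)
    linarith

/-! ### The cells of the 600-cell -/

namespace Icosian

/-- The direction `1 + i` of the centre of a cell of the 600-cell. -/
def cell : Icosian := ((2, 0), (2, 0), (0, 0), (0, 0))

/-- The products `(1 + i) ζʲ`. -/
def cellRep : Fin 5 → Icosian :=
  ![cell, ((1, 0), (-1, 2), (1, 0), (1, 0)), ((-2, 1), (0, 1), (0, 1), (0, 1)),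
    ((0, -1), (2, -1), (0, 1), (0, 1)), ((1, -2), (-1, 0), (1, 0), (1, 0))]

/-- The four cells adjacent to the cell with centre `1 + i`. -/
def cellNbr : Fin 4 → Icosian :=
  ![((-1, 2), (0, 1), (-1, 1), (0, 0)), ((0, 1), (-1, 2), (0, 0), (-1, 1)),
    ((-1, 2), (0, 1), (1, -1), (0, 0)), ((0, 1), (-1, 2), (0, 0), (1, -1))]

/-- The unit icosians `a` such that `a (1 + i) ζᵏ⁺¹` is the `k`-th adjacent cell. -/
def cellCoeff : Fin 4 → Icosian :=
  ![((0, 1), (-1, 0), (0, 0), (1, -1)), ((1, 0), (1, -1), (0, 0), (0, -1)),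
    ((-1, 0), (1, -1), (0, 0), (0, -1)), ((0, -1), (-1, 0), (0, 0), (1, -1))]

/-- The vertices of the cell with centre `1 + i`, opposite to the adjacent cells. -/
def cellVertex : Fin 4 → Icosian :=
  ![((1, 0), (0, 1), (1, -1), (0, 0)), ((0, 1), (1, 0), (0, 0), (1, -1)),
    ((1, 0), (0, 1), (-1, 1), (0, 0)), ((0, 1), (1, 0), (0, 0), (-1, 1))]

theorem cellRep_succ : ∀ j : Fin 4, Exact (cellRep j.castSucc) zeta ∧
    cellRep j.succ = mul (cellRep j.castSucc) zeta := by decide +kernel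

theorem cellVertex_mem : ∀ k, cellVertex k ∈ all := by decide +kernel

theorem cellCoeff_mem : ∀ k, cellCoeff k ∈ all := by decide +kernel

theorem cellCoeff_mul : ∀ k, Exact (cellCoeff k) (cellRep k.succ) ∧
    mul (cellCoeff k) (cellRep k.succ) = cellNbr k := by decide +kernel

theorem cellCoeff_mul_rev : ∀ k, Exact (cellCoeff k) (cellCoeff k.rev) ∧
    mul (cellCoeff k) (cellCoeff k.rev) = negOne := by decide +kernel

theorem cellNbr_ne_cell : ∀ k, cellNbr k ≠ cell := by decide +kernel

theorem cellNbr_injective : ∀ k l, cellNbr k = cellNbr l → k = l := by decide +kernel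

/-- Relative to the cell with centre `1 + i`, the translates of the five cell representatives are
this cell, its four neighbours, and cells at a larger distance; for the latter, the possible values
of twice the inner product of the centres are listed. -/
theorem cell_table : ∀ x ∈ all, ∀ j, Exact x (cellRep j) ∧
    ((mul x (cellRep j) = cell ∧ j = 0) ∨ (∃ k, mul x (cellRep j) = cellNbr k) ∨
      (mul x (cellRep j)).1 + (mul x (cellRep j)).2.1 ∈
        ([(2, 1), (0, 2), (-2, 2), (2, -2), (0, -2), (2, 0), (0, 0), (-2, 0), (-1, 2), (2, -1),
          (0, -1), (-3, 0), (-3, 1), (1, -2), (-1, -1), (1, -1), (-4, 0), (-2, -1), (0, 1), (-2, 1),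
          (1, 0), (1, -3), (-1, 0), (3, -1), (-1, 1), (3, 0), (1, 1), (-2, 3), (2, -3)] :
          List GoldenInt)) := by
  decide +kernel

theorem toH_negOne : toH negOne = -1 := by
  apply Quaternion.ext <;> simp [toH, negOne, GoldenInt.toReal]

theorem zeta_pow_five : toH zeta ^ 5 = -1 := by
  have h : mul (mul (mul (mul zeta zeta) zeta) zeta) zeta = negOne ∧ Exact zeta zeta ∧
      Exact (mul zeta zeta) zeta ∧ Exact (mul (mul zeta zeta) zeta) zeta ∧
      Exact (mul (mul (mul zeta zeta) zeta) zeta) zeta := by decide +kernel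
  rw [← toH_negOne, ← h.1, toH_mul h.2.2.2.2, toH_mul h.2.2.2.1, toH_mul h.2.2.1, toH_mul h.2.1]
  simp only [pow_succ, pow_zero, one_mul]

theorem toH_cellRep (j : Fin 5) : toH (cellRep j) = toH cell * toH zeta ^ (j : ℕ) := by
  induction j using Fin.induction with
  | zero => rw [Fin.val_zero, pow_zero, mul_one]; rfl
  | succ j ih =>
    rw [(cellRep_succ j).2, toH_mul (cellRep_succ j).1, ih, mul_assoc, ← pow_succ]
    rfl

end Icosian

/-- The unit icosian `ζ` of order 10 whose powers represent the cosets of the binary tetrahedral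
group. -/
def zetaH : ℍ[ℝ] := Icosian.zeta.toH

/-- The direction of the centre of a cell of the 600-cell, of length `√2`. -/
def cellCenter : ℍ[ℝ] := Icosian.cell.toH

theorem isUnitIcosian_zetaH : IsUnitIcosian zetaH := Icosian.isUnitIcosian_gen _ (by simp)

theorem zetaH_pow_five : zetaH ^ 5 = -1 := Icosian.zeta_pow_five

theorem zetaH_pow_ten : zetaH ^ 10 = 1 := by
  rw [show 10 = 5 * 2 by norm_num, pow_mul, zetaH_pow_five]; simp

theorem isUnitIcosian_neg_one : IsUnitIcosian (-1) := by
  rw [← zetaH_pow_five]; exact isUnitIcosian_zetaH.pow 5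

theorem IsUnitIcosian.neg {a : ℍ[ℝ]} (ha : IsUnitIcosian a) : IsUnitIcosian (-a) := by
  rw [← neg_one_mul]; exact isUnitIcosian_neg_one.mul ha

theorem zetaH_pow_eq (n : ℕ) : zetaH ^ n = zetaH ^ (n % 5) ∨ zetaH ^ n = -zetaH ^ (n % 5) := by
  have h : zetaH ^ n = (-1) ^ (n / 5) * zetaH ^ (n % 5) := by
    conv_lhs => rw [← Nat.div_add_mod n 5, pow_add, pow_mul, zetaH_pow_five]
  rcases neg_one_pow_eq_or ℍ[ℝ] (n / 5) with e | e
  · exact Or.inl (by rw [h, e, one_mul])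
  · exact Or.inr (by rw [h, e, neg_one_mul])

theorem cellCenter_eq : cellCenter = ⟨1, 1, 0, 0⟩ := by
  apply Quaternion.ext <;> simp [cellCenter, Icosian.toH, Icosian.cell, GoldenInt.toReal]

theorem cellCenter_inner (y : ℍ[ℝ]) : ⟪cellCenter, y⟫_ℝ = y.re + y.imI := by
  rw [quaternion_inner_eq, cellCenter_eq]; simp

theorem cellCenter_ne_zero : cellCenter ≠ 0 := by
  intro h
  have := congrArg (fun z : ℍ[ℝ] => z.re) (cellCenter_eq.symm.trans h)
  simp at this

/-- The vector `γ` is the centre of a cell of the 600-cell, scaled to length `√2`. -/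
def IsCell (γ : ℍ[ℝ]) : Prop := ∃ a, IsUnitIcosian a ∧ ∃ n : ℕ, γ = a * cellCenter * zetaH ^ n

/-- The `k`-th cell adjacent to the cell with centre `cellCenter`. -/
def cellNeighbor (k : Fin 4) : ℍ[ℝ] := (Icosian.cellNbr k).toH

theorem cellNeighbor_eq (k : Fin 4) :
    cellNeighbor k = (Icosian.cellCoeff k).toH * cellCenter * zetaH ^ ((k : ℕ) + 1) := by
  rw [cellNeighbor, ← (Icosian.cellCoeff_mul k).2, Icosian.toH_mul (Icosian.cellCoeff_mul k).1,
    Icosian.toH_cellRep, mul_assoc]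
  rfl

theorem isUnitIcosian_cellCoeff (k : Fin 4) : IsUnitIcosian (Icosian.cellCoeff k).toH :=
  Icosian.isUnitIcosian_of_mem (Icosian.cellCoeff_mem k)

/-- Every cell is a translate of one of five. -/
theorem IsCell.exists_fin {γ : ℍ[ℝ]} (h : IsCell γ) :
    ∃ a, IsUnitIcosian a ∧ ∃ j : Fin 5, γ = a * (cellCenter * zetaH ^ (j : ℕ)) := by
  obtain ⟨a, ha, n, rfl⟩ := h
  rcases zetaH_pow_eq n with e | e
  · exact ⟨a, ha, ⟨n % 5, Nat.mod_lt _ (by norm_num)⟩, by rw [e, mul_assoc]⟩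
  · exact ⟨-a, ha.neg, ⟨n % 5, Nat.mod_lt _ (by norm_num)⟩, by rw [e]; simp [mul_assoc]⟩

theorem isCell_cellCenter : IsCell cellCenter := ⟨1, .one, 0, by simp⟩

theorem isCell_cellNeighbor (k : Fin 4) : IsCell (cellNeighbor k) :=
  ⟨_, isUnitIcosian_cellCoeff k, _, cellNeighbor_eq k⟩

namespace IsCell

variable {γ γ' η : ℍ[ℝ]}

theorem mul_left (h : IsCell γ) {a : ℍ[ℝ]} (ha : IsUnitIcosian a) : IsCell (a * γ) := by
  obtain ⟨b, hb, n, rfl⟩ := h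
  exact ⟨a * b, ha.mul hb, n, by simp only [mul_assoc]⟩

theorem mul_zetaH_pow (h : IsCell γ) (m : ℕ) : IsCell (γ * zetaH ^ m) := by
  obtain ⟨b, hb, n, rfl⟩ := h
  exact ⟨b, hb, n + m, by rw [pow_add]; simp only [mul_assoc]⟩

theorem ne_zero (h : IsCell γ) : γ ≠ 0 := by
  obtain ⟨b, hb, n, rfl⟩ := h
  have h1 : b ≠ 0 := norm_ne_zero_iff.1 (by rw [hb.norm]; norm_num)
  have h2 : zetaH ≠ 0 := norm_ne_zero_iff.1 (by rw [isUnitIcosian_zetaH.norm]; norm_num)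
  exact mul_ne_zero (mul_ne_zero h1 cellCenter_ne_zero) (pow_ne_zero _ h2)

/-- Any cell can be moved to `cellCenter` by a symmetry of the set of cells. -/
theorem exists_move (h : IsCell γ) : ∃ a b, IsUnitIcosian a ∧ IsUnitIcosian b ∧
    a * γ * b = cellCenter ∧ (∀ η, IsCell η → IsCell (a * η * b)) ∧
    ∀ η, IsCell η → IsCell (star a * η * star b) := by
  obtain ⟨a, ha, n, rfl⟩ := h
  have e : zetaH ^ n * zetaH ^ (9 * n) = 1 := by
    rw [← pow_add, show n + 9 * n = 10 * n by ring, pow_mul, zetaH_pow_ten, one_pow]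
  have hb := isUnitIcosian_zetaH.pow (9 * n)
  have e' : star (zetaH ^ (9 * n)) = zetaH ^ n := by
    rw [← one_mul (star _), ← e, mul_assoc, quaternion_self_mul_star hb.norm, mul_one]
  refine ⟨star a, zetaH ^ (9 * n), ha.star, hb, ?_, fun η hη =>
    (hη.mul_left ha.star).mul_zetaH_pow _, fun η hη => ?_⟩
  · rw [← mul_assoc, ← mul_assoc, quaternion_star_mul_self ha.norm, one_mul, mul_assoc, e, mul_one]
  · rw [e', star_star]; exact (hη.mul_left ha).mul_zetaH_pow _

/-- Cells other than `cellCenter` and its neighbours are farther away: `1.81` is slightly more than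
the largest value `(2 + φ) / 2` of their inner products. -/
theorem cases (h : IsCell γ) : γ = cellCenter ∨ (∃ k, γ = cellNeighbor k) ∨
    ⟪cellCenter, γ⟫_ℝ ≤ 1.81 := by
  obtain ⟨a, ha, j, rfl⟩ := h.exists_fin
  obtain ⟨x, hx, rfl⟩ := isUnitIcosian_iff.1 ha
  obtain ⟨he, ht⟩ := Icosian.cell_table x hx j
  have e : x.toH * (cellCenter * zetaH ^ (j : ℕ)) = (Icosian.mul x (Icosian.cellRep j)).toH := by
    rw [Icosian.toH_mul he, Icosian.toH_cellRep]; rfl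
  rw [e]
  rcases ht with ⟨h, -⟩ | ⟨k, h⟩ | h
  · exact Or.inl (by rw [h]; rfl)
  · exact Or.inr (Or.inl ⟨k, by rw [h]; rfl⟩)
  · refine Or.inr (Or.inr ?_)
    have hb := goldenRatio_bounds
    generalize Icosian.mul x (Icosian.cellRep j) = y at h
    have e : y.toH.re + y.toH.imI = (y.1 + y.2.1).toReal / 2 := by
      rw [Icosian.toReal_add, add_div]; rfl
    rw [cellCenter_inner, e]
    simp only [List.mem_cons, List.not_mem_nil, or_false] at h
    rcases h with h | h | h | h | h | h | h | h | h | h | h | h | h | h | h | h | h | h | h | h |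
      h | h | h | h | h | h | h | h | h <;> rw [h] <;>
      simp only [GoldenInt.toReal] <;> push_cast <;> linarith

/-- The five cells `cellCenter * zetaH ^ j` lie in different orbits of the left multiplications with
unit icosians. -/
theorem five_dvd {a : ℍ[ℝ]} (ha : IsUnitIcosian a) {n : ℕ}
    (h : a * cellCenter * zetaH ^ n = cellCenter) : 5 ∣ n := by
  have key : ∀ a, IsUnitIcosian a → ∀ j : Fin 5,
      a * (cellCenter * zetaH ^ (j : ℕ)) = cellCenter → j = 0 := by
    intro a ha j h
    obtain ⟨x, hx, rfl⟩ := isUnitIcosian_iff.1 ha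
    obtain ⟨he, ht⟩ := Icosian.cell_table x hx j
    have e : x.toH * (cellCenter * zetaH ^ (j : ℕ)) = (Icosian.mul x (Icosian.cellRep j)).toH := by
      rw [Icosian.toH_mul he, Icosian.toH_cellRep]; rfl
    rw [e] at h
    rw [Icosian.toH_injective (h : _ = Icosian.cell.toH)] at ht
    rcases ht with h | ⟨k, h⟩ | h
    · exact h.2
    · exact absurd h.symm (Icosian.cellNbr_ne_cell k)
    · exact absurd h (by decide)
  refine Nat.dvd_of_mod_eq_zero ?_
  rcases zetaH_pow_eq n with e | e
  · exact congrArg Fin.val (key a ha ⟨n % 5, Nat.mod_lt _ (by norm_num)⟩ (by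
      show a * (cellCenter * zetaH ^ (n % 5)) = _
      rw [← mul_assoc, ← e, h]))
  · exact congrArg Fin.val (key (-a) ha.neg ⟨n % 5, Nat.mod_lt _ (by norm_num)⟩ (by
      show -a * (cellCenter * zetaH ^ (n % 5)) = _
      rw [neg_mul, ← mul_assoc, ← mul_neg, ← e, h]))

/-- The orbit of a cell under left multiplications with unit icosians is determined by the exponent
of `zetaH` modulo `5`. -/
theorem mod_five_eq {a b : ℍ[ℝ]} (ha : IsUnitIcosian a) (hb : IsUnitIcosian b) {m n : ℕ}
    (h : a * cellCenter * zetaH ^ m = b * cellCenter * zetaH ^ n) : m % 5 = n % 5 := by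
  have h1 : star b * a * cellCenter * zetaH ^ (m + 9 * n) = cellCenter := by
    rw [pow_add, ← mul_assoc, mul_assoc (star b), mul_assoc (star b), h]
    simp only [← mul_assoc]
    rw [quaternion_star_mul_self hb.norm, one_mul, mul_assoc, ← pow_add,
      show n + 9 * n = 10 * n by ring, pow_mul, zetaH_pow_ten, one_pow, mul_one]
  have := five_dvd (hb.star.mul ha) h1
  omega

theorem coeff_eq {a b : ℍ[ℝ]} {n : ℕ}
    (h : a * cellCenter * zetaH ^ n = b * cellCenter * zetaH ^ n) : a = b := by
  have h2 : zetaH ≠ 0 := norm_ne_zero_iff.1 (by rw [isUnitIcosian_zetaH.norm]; norm_num)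
  exact mul_right_cancel₀ cellCenter_ne_zero (mul_right_cancel₀ (pow_ne_zero n h2) h)

theorem inner_self (h : IsCell γ) : ⟪γ, γ⟫_ℝ = 2 := by
  obtain ⟨a, b, ha, hb, e, -⟩ := h.exists_move
  rw [← inner_mul_mul_left ha.norm, ← inner_mul_mul_right hb.norm, e, cellCenter_inner,
    cellCenter_eq]
  norm_num

theorem norm_sq (h : IsCell γ) : ‖γ‖ ^ 2 = 2 := by rw [← real_inner_self_eq_norm_sq, h.inner_self]

theorem inner_vertex_le (h : IsCell γ) {v : ℍ[ℝ]} (hv : IsUnitIcosian v) :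
    ⟪γ, v⟫_ℝ ≤ φ ^ 2 / 2 := by
  obtain ⟨a, b, ha, hb, e, -⟩ := h.exists_move
  rw [← inner_mul_mul_left ha.norm, ← inner_mul_mul_right hb.norm, e, cellCenter_inner]
  exact ((ha.mul hv).mul hb).re_add_imI_le

theorem cellNeighbor_inner (k : Fin 4) : ⟪cellCenter, cellNeighbor k⟫_ℝ = (3 * φ - 1) / 2 := by
  rw [cellCenter_inner]
  fin_cases k <;> simp [cellNeighbor, Icosian.cellNbr, Icosian.toH, GoldenInt.toReal] <;> ring

/-- Distinct cells are at least as far apart as adjacent ones. -/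
theorem inner_le (h : IsCell γ) (h' : IsCell γ') (hne : γ ≠ γ') :
    ⟪γ, γ'⟫_ℝ ≤ (3 * φ - 1) / 2 := by
  obtain ⟨a, b, ha, hb, e, hab, -⟩ := h.exists_move
  have h1 := inner_mul_mul_left ha.norm γ γ'
  rw [← inner_mul_mul_right hb.norm, e] at h1
  rw [← h1]
  rcases (hab _ h').cases with h2 | ⟨k, h2⟩ | h2
  · refine absurd (mul_left_cancel₀ ?_ (mul_right_cancel₀ ?_ (e.trans h2.symm))) hne
    · exact norm_ne_zero_iff.1 (by rw [ha.norm]; norm_num)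
    · exact norm_ne_zero_iff.1 (by rw [hb.norm]; norm_num)
  · rw [h2, cellNeighbor_inner]
  · linarith [goldenRatio_bounds.1]

/-- The sum of the inner products of a unit vector with three distinct cells is at most
`√(3 + 9 φ) ≈ 4.1907`. This excludes that a point close to the common triangle of two cells is
nearly as close to a third cell. -/
theorem inner_add_add_lt (h : IsCell γ) (h' : IsCell γ') (hη : IsCell η) (h1 : γ ≠ γ')
    (h2 : γ ≠ η) (h3 : γ' ≠ η) (x : UnitQuaternion) :
    ⟪(x : ℍ[ℝ]), γ⟫_ℝ + ⟪(x : ℍ[ℝ]), γ'⟫_ℝ + ⟪(x : ℍ[ℝ]), η⟫_ℝ < 4.191 := by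
  have e : ‖γ + γ' + η‖ ^ 2 ≤ 3 + 9 * φ := by
    rw [norm_add_sq_real, norm_add_sq_real, inner_add_left, h.norm_sq, h'.norm_sq, hη.norm_sq]
    linarith [h.inner_le h' h1, h.inner_le hη h2, h'.inner_le hη h3]
  rw [← inner_add_right, ← inner_add_right]
  have h1 := real_inner_le_norm (x : ℍ[ℝ]) (γ + γ' + η)
  rw [norm_eq_of_mem_sphere, one_mul] at h1
  have h3 := goldenRatio_bounds
  nlinarith [norm_nonneg (γ + γ' + η)]

/-- Cells which are closer than adjacent cells to coinciding are adjacent. -/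
theorem exists_cellNeighbor (h' : IsCell γ') (hne : γ' ≠ cellCenter)
    (hin : 1.81 < ⟪cellCenter, γ'⟫_ℝ) : ∃ k, γ' = cellNeighbor k := by
  rcases h'.cases with h2 | h2 | h2
  · exact absurd h2 hne
  · exact h2
  · linarith

end IsCell

/-- On the cube `[0, u]⁴`, for a prescribed sum of the variables between `2 u` and `3 u`, the sum of
squares is largest when two variables are `u` and a third one takes up the rest. -/
theorem sum_sq_le_of_le {u a b c d : ℝ} (ha : 0 ≤ a) (hb : 0 ≤ b) (hc : 0 ≤ c) (hd : 0 ≤ d)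
    (ha' : a ≤ u) (hb' : b ≤ u) (hc' : c ≤ u) (hd' : d ≤ u) :
    a ^ 2 + b ^ 2 + c ^ 2 + d ^ 2 ≤ 2 * u ^ 2 + (a + b + c + d - 2 * u) ^ 2 := by
  rcases le_total (a + b) u with h1 | h1 <;> rcases le_total (c + d) u with h2 | h2
  · nlinarith [mul_nonneg (sub_nonneg.2 h1) (sub_nonneg.2 h2),
      mul_nonneg (sub_nonneg.2 ha') (sub_nonneg.2 hb'), mul_nonneg (sub_nonneg.2 hc') (sub_nonneg.2 hd')]
  · nlinarith [mul_nonneg (sub_nonneg.2 h1) (sub_nonneg.2 h2), mul_nonneg ha hb, mul_nonneg hc hd,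
      mul_nonneg (sub_nonneg.2 ha') (sub_nonneg.2 hb'), mul_nonneg (sub_nonneg.2 hc') (sub_nonneg.2 hd'),
      mul_nonneg (add_nonneg ha hb) (sub_nonneg.2 h2), mul_nonneg (add_nonneg hc hd) (sub_nonneg.2 h1)]
  · nlinarith [mul_nonneg (sub_nonneg.2 h1) (sub_nonneg.2 h2), mul_nonneg ha hb, mul_nonneg hc hd,
      mul_nonneg (sub_nonneg.2 ha') (sub_nonneg.2 hb'), mul_nonneg (sub_nonneg.2 hc') (sub_nonneg.2 hd'),
      mul_nonneg (add_nonneg ha hb) (sub_nonneg.2 h2), mul_nonneg (add_nonneg hc hd) (sub_nonneg.2 h1)]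
  · nlinarith [mul_nonneg (sub_nonneg.2 h1) (sub_nonneg.2 h2), mul_nonneg ha hb, mul_nonneg hc hd,
      mul_nonneg (sub_nonneg.2 ha') (sub_nonneg.2 hb'), mul_nonneg (sub_nonneg.2 hc') (sub_nonneg.2 hd')]

/-- The coordinates of `x` with respect to the vertices of a cell, multiplied by `(2 - φ) / 2`, are
its inner products with the differences of the cell and its neighbours, which are the normals of the
facets. The three formulas express `⟪x, x⟫`, `⟪x, cellCenter⟫` and the inner products with the
vertices in these coordinates. -/
theorem cell_coordinates (x : ℍ[ℝ]) :
    (2 - φ) / 2 * ⟪x, x⟫_ℝ =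
      ∑ k, ⟪x, cellCenter - cellNeighbor k⟫_ℝ * ⟪x, (Icosian.cellVertex k).toH⟫_ℝ ∧
    (2 - φ) / 2 * ⟪x, cellCenter⟫_ℝ = φ ^ 2 / 2 * ∑ k, ⟪x, cellCenter - cellNeighbor k⟫_ℝ ∧
    ∀ k, (2 - φ) / 2 * ⟪x, (Icosian.cellVertex k).toH⟫_ℝ =
      φ / 2 * ∑ k, ⟪x, cellCenter - cellNeighbor k⟫_ℝ +
        (2 - φ) / 2 * ⟪x, cellCenter - cellNeighbor k⟫_ℝ := by
  have hφ := Real.goldenRatio_sq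
  simp only [quaternion_inner_eq, Fin.sum_univ_four, Fin.forall_fin_succ, cellNeighbor, cellCenter,
    Quaternion.re_sub, Quaternion.imI_sub, Quaternion.imJ_sub, Quaternion.imK_sub]
  simp [Icosian.toH, Icosian.cell, Icosian.cellNbr, Icosian.cellVertex, GoldenInt.toReal]
  generalize φ = p at *
  generalize x.re = a
  generalize x.imI = b
  generalize x.imJ = c
  generalize x.imK = d
  refine ⟨?_, ?_, ?_, ?_, ?_, ?_⟩ <;> grind

/-! ### The handlebody around the dual 1-skeleton of the 600-cell -/

/-- Where the height is small, a point is close to the centre of the cell that contains it: its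
inner product with `cellCenter` is close to the maximal value `√2`. -/
theorem le_inner_cellCenter {x : UnitQuaternion} (hle : height x ≤ level)
    (hmax : ∀ k, ⟪(x : ℍ[ℝ]), cellNeighbor k⟫_ℝ ≤ ⟪(x : ℍ[ℝ]), cellCenter⟫_ℝ) :
    1.4009 ≤ ⟪(x : ℍ[ℝ]), cellCenter⟫_ℝ := by
  obtain ⟨h1, h2, h3⟩ := cell_coordinates x
  have hs : ∀ k, ⟪(x : ℍ[ℝ]), (Icosian.cellVertex k).toH⟫_ℝ ≤ 0.936 := fun k =>
    inner_le_of_height_le (Icosian.isUnitIcosian_of_mem (Icosian.cellVertex_mem k)) hle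
  have hd : ∀ k, 0 ≤ ⟪(x : ℍ[ℝ]), cellCenter - cellNeighbor k⟫_ℝ := fun k => by
    rw [inner_sub_right]; linarith [hmax k]
  rw [real_inner_self_eq_norm_sq, norm_eq_of_mem_sphere] at h1
  generalize hX : ⟪(x : ℍ[ℝ]), cellCenter⟫_ℝ = X at *
  generalize hdd : (fun k => ⟪(x : ℍ[ℝ]), cellCenter - cellNeighbor k⟫_ℝ) = d at *
  have hdd' : ∀ k, ⟪(x : ℍ[ℝ]), cellCenter - cellNeighbor k⟫_ℝ = d k := fun k => congrFun hdd k
  generalize hss : (fun k => ⟪(x : ℍ[ℝ]), (Icosian.cellVertex k).toH⟫_ℝ) = s at *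
  have hss' : ∀ k, ⟪(x : ℍ[ℝ]), (Icosian.cellVertex k).toH⟫_ℝ = s k := fun k => congrFun hss k
  simp only [hdd', hss'] at h1 h2 h3 hs hd
  clear hdd hss hdd' hss' hX hmax hle x
  have hφ := goldenRatio_bounds
  have hφ2 := Real.goldenRatio_sq
  rw [hφ2] at h2
  by_contra hcon
  rw [not_le] at hcon
  -- `κ = φ / 2` is the inner product of any two vertices of the cell, and `d k / (1 - κ)` are the
  -- coordinates of the point with respect to the vertices
  set κ := φ / 2 with hκ
  have hκ1 : 0.80901695 < κ := by linarith
  have hκ2 : κ < 0.809017 := by linarith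
  have hκ3 : κ ^ 2 = κ / 2 + 1 / 4 := by rw [hκ]; linarith
  have hk : (2 - φ) / 2 = 1 - κ := by rw [hκ]; ring
  have hA : (φ + 1) / 2 = κ + 1 / 2 := by rw [hκ]; ring
  rw [hk] at h1 h2 h3
  rw [hA] at h2
  clear_value κ
  have hk0 : 0 < 1 - κ := by linarith
  -- `S` is the sum of the coordinates of the point with respect to the vertices of the cell
  obtain ⟨S, hS⟩ : ∃ S, ∑ k, d k = (1 - κ) * S := ⟨(∑ k, d k) / (1 - κ), by field_simp⟩
  rw [hS] at h2
  have h3' : ∀ k, s k = κ * S + d k := fun k => by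
    have := h3 k
    rw [hS] at this
    refine mul_left_cancel₀ hk0.ne' ?_
    linarith
  have hXS : X = (κ + 1 / 2) * S := by
    refine mul_left_cancel₀ hk0.ne' ?_
    linarith
  -- The assumption `X < 1.4009` bounds `S` from above, and `⟪x, x⟫ = 1` with `⟪x, v⟫ ≤ 0.936`
  -- bounds it from below by `1 / 0.936`.
  have hS1 : S < 1.0702 := by nlinarith
  have hS2 : 1.068 < S := by
    have : ∑ k, d k * s k ≤ ∑ k, d k * 0.936 :=
      Finset.sum_le_sum fun k _ => mul_le_mul_of_nonneg_left (hs k) (hd k)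
    rw [← h1, ← Finset.sum_mul, hS] at this
    nlinarith
  -- No coordinate is large, as the inner products with the vertices are at most `0.936`.
  have hu : ∀ k, d k ≤ 0.936 - κ * S := fun k => by linarith [hs k, h3' k]
  have hq := sum_sq_le_of_le (hd 0) (hd 1) (hd 2) (hd 3) (hu 0) (hu 1) (hu 2) (hu 3)
  simp only [Fin.sum_univ_four, h3'] at h1 hS
  rw [hS] at hq
  -- `⟪x, x⟫ = 1` becomes a quadratic inequality in `S`, which fails between the two bounds.
  have hfin : (1 - κ) - κ * S * ((1 - κ) * S) ≤
      2 * (0.936 - κ * S) ^ 2 + ((1 - κ) * S - 2 * (0.936 - κ * S)) ^ 2 := by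
    refine le_trans (le_of_eq ?_) hq
    rw [← hS]
    linear_combination h1
  have hf : 0 ≤ κ * (4 * S ^ 2 - 7.488 * S + 1) + 1.5 * S ^ 2 - 3.744 * S + 4.256576 := by
    linear_combination hfin + 2 * S ^ 2 * hκ3
  have hSS : S ^ 2 ≤ 2.1382 * S - 1.068 * 1.0702 := by
    nlinarith [mul_nonneg (sub_nonneg.2 hS2.le) (sub_nonneg.2 hS1.le)]
  have hneg : 4 * S ^ 2 - 7.488 * S + 1 < 0 := by linarith
  have hκS := mul_le_mul_of_nonpos_right hκ1.le hneg.le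
  linarith

/-- The preceding estimate for all cells, by symmetry. -/
theorem IsCell.le_inner {γ : ℍ[ℝ]} (hγ : IsCell γ) {x : UnitQuaternion} (hle : height x ≤ level)
    (hmax : ∀ η, IsCell η → ⟪(x : ℍ[ℝ]), η⟫_ℝ ≤ ⟪(x : ℍ[ℝ]), γ⟫_ℝ) :
    1.4009 ≤ ⟪(x : ℍ[ℝ]), γ⟫_ℝ := by
  obtain ⟨a, b, ha, hb, e, -, hback⟩ := hγ.exists_move
  have hinn : ∀ η, ⟪a * x * b, η⟫_ℝ = ⟪(x : ℍ[ℝ]), star a * η * star b⟫_ℝ := fun η => by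
    rw [inner_mul_right_eq hb.norm, inner_mul_left_eq ha.norm, mul_assoc]
  have hcan : star a * cellCenter * star b = γ := by
    rw [← e]
    simp only [← mul_assoc, quaternion_star_mul_self ha.norm, one_mul]
    rw [mul_assoc, quaternion_self_mul_star hb.norm, mul_one]
  have hy : ‖a * (x : ℍ[ℝ]) * b‖ = 1 := by
    rw [norm_mul, norm_mul, ha.norm, hb.norm, norm_eq_of_mem_sphere, one_mul, one_mul]
  have := le_inner_cellCenter (x := ⟨a * x * b, mem_sphere_zero_iff_norm.2 hy⟩)
    ((height_mul ha hb x).trans_le hle) fun k => by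
      show ⟪a * x * b, _⟫_ℝ ≤ ⟪a * x * b, _⟫_ℝ
      rw [hinn, hinn, hcan]
      exact hmax _ (hback _ (isCell_cellNeighbor k))
  change _ ≤ ⟪a * x * b, _⟫_ℝ at this
  rwa [hinn, hcan] at this

/-- The part of the lower handlebody around the centre of the cell `γ`. -/
def cellBall (γ : ℍ[ℝ]) : Set UnitQuaternion :=
  {x | 0 < ⟪(x : ℍ[ℝ]), γ⟫_ℝ ∧ height x ≤ level ∧
    ∀ η, IsCell η → η ≠ γ → ⟪(x : ℍ[ℝ]), η⟫_ℝ ≤ 1999 / 2001 * ⟪(x : ℍ[ℝ]), γ⟫_ℝ}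

/-- The part of the lower handlebody around the centre of the common triangle of the adjacent
cells `γ` and `γ'`. The bound `2.8` is slightly less than `‖γ + γ'‖`. -/
def cellHandle (γ γ' : ℍ[ℝ]) : Set UnitQuaternion :=
  {x | 2.8 ≤ ⟪(x : ℍ[ℝ]), γ + γ'⟫_ℝ ∧
    |⟪(x : ℍ[ℝ]), γ - γ'⟫_ℝ| ≤ 1 / 2000 * ⟪(x : ℍ[ℝ]), γ + γ'⟫_ℝ ∧ height x ≤ level}

theorem IsCell.finite : {γ : ℍ[ℝ] | IsCell γ}.Finite := by
  refine ((IsUnitIcosian.finite.prod (Set.finite_univ (α := Fin 5))).image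
    fun z : ℍ[ℝ] × Fin 5 => z.1 * (cellCenter * zetaH ^ (z.2 : ℕ))).subset ?_
  intro γ hγ
  obtain ⟨a, ha, j, rfl⟩ := IsCell.exists_fin hγ
  exact ⟨(a, j), ⟨ha, Set.mem_univ _⟩, rfl⟩

theorem height_eq_zero {x : ℍ[ℝ]} (h : ∀ v, IsUnitIcosian v → ⟪x, v⟫_ℝ ≤ 0.9352) :
    height x = 0 :=
  Finset.sum_eq_zero fun v hv => bump_eq_zero (h v (mem_unitIcosians.1 hv))

theorem IsCell.neg {γ : ℍ[ℝ]} (hγ : IsCell γ) : IsCell (-γ) := by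
  rw [← neg_one_mul]; exact hγ.mul_left isUnitIcosian_neg_one

theorem IsCell.ne_neg {γ : ℍ[ℝ]} (hγ : IsCell γ) : -γ ≠ γ := by
  intro h
  have h1 := hγ.inner_self
  have h2 : ⟪-γ, γ⟫_ℝ = 2 := by rw [h, h1]
  rw [inner_neg_left] at h2
  linarith

/-- The part of the lower handlebody around the centre of a cell is a ball, whose boundary contains
the places where the handles are attached. -/
theorem IsCell.exists_ball_chart {γ : ℍ[ℝ]} (hγ : IsCell γ) :
    ∃ β : E3 → UnitQuaternion, Continuous β ∧ Set.InjOn β (Metric.closedBall 0 1) ∧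
    β '' Metric.closedBall 0 1 = cellBall γ ∧
    ∀ η, IsCell η → η ≠ γ → ∀ x ∈ cellBall γ,
      ⟪(x : ℍ[ℝ]), η⟫_ℝ = 1999 / 2001 * ⟪(x : ℍ[ℝ]), γ⟫_ℝ → x ∈ β '' Metric.sphere 0 1 := by
  classical
  have hφ := goldenRatio_bounds
  have hφ2 := Real.goldenRatio_sq
  let F := IsCell.finite.toFinset.erase γ
  have hF : ∀ η, η ∈ F ↔ η ≠ γ ∧ IsCell η := fun η => by simp [F]
  have hne : F.Nonempty := ⟨-γ, (hF _).2 ⟨hγ.ne_neg, hγ.neg⟩⟩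
  let G : UnitQuaternion → ℝ := fun x => max (height x - level)
    (F.sup' hne fun v => ⟪(x : ℍ[ℝ]), v⟫_ℝ - 1999 / 2001 * ⟪(x : ℍ[ℝ]), γ⟫_ℝ)
  have hG : Continuous G := by
    have := continuous_height
    refine Continuous.max (by fun_prop) (Continuous.finset_sup'_apply hne fun v _ => by fun_prop)
  have hGle : ∀ x, G x ≤ 0 ↔ height x ≤ level ∧ ∀ η, IsCell η → η ≠ γ →
      ⟪(x : ℍ[ℝ]), η⟫_ℝ ≤ 1999 / 2001 * ⟪(x : ℍ[ℝ]), γ⟫_ℝ := by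
    intro x
    simp only [G, max_le_iff, Finset.sup'_le_iff, hF, sub_nonpos]
    exact and_congr_right fun _ => forall_congr' fun v => by tauto
  have hGlt : ∀ x : UnitQuaternion, height x < level → (∀ η, IsCell η → η ≠ γ →
      ⟪(x : ℍ[ℝ]), η⟫_ℝ < 1999 / 2001 * ⟪(x : ℍ[ℝ]), γ⟫_ℝ) → G x < 0 := by
    intro x h1 h2
    simp only [G, max_lt_iff, Finset.sup'_lt_iff, hF, sub_neg]
    exact ⟨h1, fun v hv => h2 v hv.2 hv.1⟩
  -- As `φ² / 2 < 0.9352 * 1.4009`, this bound allows the application of `height_nrm_add_smul_lt`.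
  have hlarge : ∀ x : UnitQuaternion, 0 < ⟪(x : ℍ[ℝ]), γ⟫_ℝ → G x ≤ 0 →
      1.4009 ≤ ⟪(x : ℍ[ℝ]), γ⟫_ℝ := by
    intro x h1 h2
    obtain ⟨h3, h4⟩ := (hGle x).1 h2
    refine hγ.le_inner h3 fun η hη => ?_
    rcases eq_or_ne η γ with rfl | h5
    · exact le_rfl
    · linarith [h4 η hη h5]
  have hsmall : ∀ η, IsCell η → η ≠ γ → ⟪γ, η⟫_ℝ < 1999 / 2001 * ⟪γ, γ⟫_ℝ := by
    intro η hη h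
    have := hγ.inner_le hη h.symm
    rw [hγ.inner_self]
    linarith
  have hnorm : 1.41 < ‖γ‖ := by
    have := hγ.norm_sq
    nlinarith [norm_nonneg γ]
  obtain ⟨β, hβc, hβi, hβr, hβb⟩ := PoincareSphere.exists_ball_chart γ hγ.ne_zero G hG
    (by
      -- At the centre all inner products with vertices are at most `φ² / (2 √2) ≈ 0.926`, so the
      -- height is zero.
      refine hGlt _ ?_ fun η hη h => ?_
      · rw [height_eq_zero fun v hv => ?_]
        · exact level_pos
        · rw [coe_nrm_inner hγ.ne_zero, div_le_iff₀ (by linarith)]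
          have := hγ.inner_vertex_le hv
          linarith
      · rw [coe_nrm_inner hγ.ne_zero, coe_nrm_inner hγ.ne_zero, ← mul_div_assoc,
          div_lt_div_iff_of_pos_right (by linarith)]
        exact hsmall η hη h)
    (by
      intro x hx _ hle t ht
      obtain ⟨h1, h2⟩ := (hGle x).1 hle
      have h3 := hlarge x hx hle
      have hX : ⟪(x : ℍ[ℝ]) + t • γ, γ⟫_ℝ = ⟪(x : ℍ[ℝ]), γ⟫_ℝ + t * 2 := by
        rw [inner_add_left, inner_smul_left, hγ.inner_self, RCLike.conj_to_real]
      have hy : (x : ℍ[ℝ]) + t • γ ≠ 0 := by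
        intro h
        rw [h, inner_zero_left] at hX
        linarith
      have hn : 0 < ‖(x : ℍ[ℝ]) + t • γ‖ := norm_pos_iff.2 hy
      refine hGlt _ ?_ fun η hη h => ?_
      · exact height_nrm_add_smul_lt γ (φ ^ 2 / 2) (by positivity)
          (fun v hv => hγ.inner_vertex_le hv) x (by linarith) h1 ht
      · rw [coe_nrm_inner hy, coe_nrm_inner hy, ← mul_div_assoc, div_lt_div_iff_of_pos_right hn,
          inner_add_left, inner_add_left, inner_smul_left, inner_smul_left, RCLike.conj_to_real]
        have := h2 η hη h
        have := mul_lt_mul_of_pos_left (hsmall η hη h) ht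
        linarith)
    1.4009 (by norm_num) hlarge
  have himg : β '' Metric.closedBall 0 1 = cellBall γ := by
    ext x
    rw [Set.mem_image, ← hβr, hGle]
    rfl
  refine ⟨β, hβc, hβi, himg, ?_⟩
  intro η hη hne' x hx he
  obtain ⟨z, hz, rfl⟩ := himg ▸ hx
  refine ⟨z, ?_, rfl⟩
  rw [mem_sphere_zero_iff_norm, ← hβb z hz]
  refine le_antisymm ((hGle _).2 hx.2) (le_max_of_le_right ?_)
  exact (sub_eq_zero.2 he).ge.trans (Finset.le_sup' (fun v =>
    ⟪(β z : ℍ[ℝ]), v⟫_ℝ - 1999 / 2001 * ⟪(β z : ℍ[ℝ]), γ⟫_ℝ) ((hF η).2 ⟨hne', hη⟩))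

set_option maxHeartbeats 400000 in
/-- The part of the lower handlebody around the centre of the common triangle of two adjacent cells
is a solid cylinder, as its slices are star-shaped with respect to the axis that joins the centres
of the cells. -/
theorem exists_cellHandle_chart {γ γ' : ℍ[ℝ]} (hγ : IsCell γ) (hγ' : IsCell γ')
    (hin : ⟪γ, γ'⟫_ℝ = (3 * φ - 1) / 2) :
    ∃ χ : ℝ × E2 → UnitQuaternion, Continuous χ ∧ Set.InjOn χ cylinder ∧
      χ '' cylinder = cellHandle γ γ' ∧
      ∀ z ∈ cylinder, ⟪(χ z : ℍ[ℝ]), γ - γ'⟫_ℝ =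
        z.1 * (1 / 2000 * ⟪(χ z : ℍ[ℝ]), γ + γ'⟫_ℝ) := by
  have hφ := goldenRatio_bounds
  have hφ2 := Real.goldenRatio_sq
  have hin' : ⟪γ', γ⟫_ℝ = (3 * φ - 1) / 2 := (real_inner_comm _ _).trans hin
  have h11 := hγ.inner_self
  have h22 := hγ'.inner_self
  have hpp : ⟪γ + γ', γ + γ'⟫_ℝ = 3 + 3 * φ := by
    simp only [inner_add_left, inner_add_right, h11, h22, hin, hin']; ring
  have hnn : ⟪γ - γ', γ - γ'⟫_ℝ = 5 - 3 * φ := by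
    simp only [inner_sub_left, inner_sub_right, h11, h22, hin, hin']; ring
  have hpn : ⟪γ + γ', γ - γ'⟫_ℝ = 0 := by
    simp only [inner_sub_right, inner_add_left, h11, h22, hin, hin']; ring
  have hp : γ + γ' ≠ 0 := fun h => by
    rw [h, inner_zero_left] at hpp; linarith
  have hn : γ - γ' ≠ 0 := fun h => by
    rw [h, inner_zero_left] at hnn; linarith
  have hnorm : ∀ x : UnitQuaternion, ‖(x : ℍ[ℝ])‖ = 1 := fun x => norm_eq_of_mem_sphere x
  -- the axis of the handle is close to the centre of the triangle
  have haxis : ∀ x : UnitQuaternion, 0 < ⟪(x : ℍ[ℝ]), γ + γ'⟫_ℝ →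
      |⟪(x : ℍ[ℝ]), γ - γ'⟫_ℝ| ≤ 1 / 2000 * ⟪(x : ℍ[ℝ]), γ + γ'⟫_ℝ → ∀ v, IsUnitIcosian v →
      ⟪planeProj (γ + γ') (γ - γ') (x : ℍ[ℝ]), v⟫_ℝ ≤
        ⟪(x : ℍ[ℝ]), γ + γ'⟫_ℝ / (3 + 3 * φ) * φ ^ 2 := by
    intro x h1 h2 v hv
    have h3 := hγ.inner_vertex_le hv
    have h4 := hγ'.inner_vertex_le hv
    rw [planeProj, hpp, hnn, inner_add_left, inner_smul_left, inner_smul_left, inner_add_left,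
      inner_sub_left, RCLike.conj_to_real, RCLike.conj_to_real]
    set a := ⟪(x : ℍ[ℝ]), γ + γ'⟫_ℝ / (3 + 3 * φ) with ha
    set b := ⟪(x : ℍ[ℝ]), γ - γ'⟫_ℝ / (5 - 3 * φ) with hb
    have hab : |b| ≤ a := by
      rw [hb, ha, abs_div, abs_of_pos (show 0 < 5 - 3 * φ by linarith),
        div_le_div_iff₀ (by linarith) (by linarith)]
      nlinarith
    obtain ⟨h5, h6⟩ := abs_le.1 hab
    nlinarith [mul_nonneg (show 0 ≤ a + b by linarith) (sub_nonneg.2 h3),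
      mul_nonneg (show 0 ≤ a - b by linarith) (sub_nonneg.2 h4)]
  have hcP : ∀ x : UnitQuaternion, ⟪(x : ℍ[ℝ]), γ + γ'⟫_ℝ ^ 2 / (3 + 3 * φ) ≤
      ‖planeProj (γ + γ') (γ - γ') (x : ℍ[ℝ])‖ ^ 2 := by
    intro x
    rw [norm_planeProj_sq hp hn hpn, hpp, hnn]
    have : 0 ≤ ⟪(x : ℍ[ℝ]), γ - γ'⟫_ℝ ^ 2 / (5 - 3 * φ) :=
      div_nonneg (sq_nonneg _) (by linarith)
    linarith
  let G : UnitQuaternion → ℝ := fun x => max (height x - level) (2.8 - ⟪(x : ℍ[ℝ]), γ + γ'⟫_ℝ)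
  have hG : Continuous G := by
    have := continuous_height
    exact Continuous.max (by fun_prop) (by fun_prop)
  have hGle : ∀ x, G x ≤ 0 ↔ height x ≤ level ∧ 2.8 ≤ ⟪(x : ℍ[ℝ]), γ + γ'⟫_ℝ := by
    intro x
    simp only [G, max_le_iff, sub_nonpos]
  obtain ⟨χ, hχc, hχi, hχr, hχb⟩ := exists_handle_chart (γ + γ') (γ - γ') hp hn hpn (1 / 2000)
    (by norm_num) G hG
    (by
      intro x h1 h2 h3
      have h4 := norm_planeProj_sq hp hn hpn x
      rw [← h3, hnorm, hpp, hnn] at h4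
      have h5 := haxis x h1 h2
      rw [← h3] at h5
      set P := ⟪(x : ℍ[ℝ]), γ + γ'⟫_ℝ with hP
      set N := ⟪(x : ℍ[ℝ]), γ - γ'⟫_ℝ with hN
      obtain ⟨h6, h7⟩ := abs_le.1 h2
      -- `⟪x, γ + γ'⟫` is at most `‖γ + γ'‖ = √(3 + 3 φ) ≈ 2.8025`; so on the axis the inner
      -- products with the vertices are below `0.9352`.
      have hPlt : P < 2.803 := by
        have h8 := real_inner_le_norm (x : ℍ[ℝ]) (γ + γ')
        rw [hnorm, one_mul] at h8
        have h9 : ‖γ + γ'‖ ^ 2 = 3 + 3 * φ := by rw [← real_inner_self_eq_norm_sq, hpp]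
        nlinarith [norm_nonneg (γ + γ')]
      refine max_lt ?_ ?_
      · rw [height_eq_zero fun v hv => ?_]
        · linarith [level_pos]
        · refine (h5 v hv).trans ?_
          rw [div_mul_eq_mul_div, div_le_iff₀ (by linarith)]
          nlinarith
      · by_contra hcon
        have h8 : P ^ 2 ≤ 2.8 ^ 2 := by nlinarith
        have h9 : N ^ 2 ≤ (1 / 2000 * 2.8) ^ 2 := by nlinarith
        have h10 : P ^ 2 / (3 + 3 * φ) ≤ 0.9985 := by
          rw [div_le_iff₀ (by linarith)]; nlinarith
        have h11 : N ^ 2 / (5 - 3 * φ) ≤ 0.0001 := by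
          rw [div_le_iff₀ (by linarith)]; nlinarith
        linarith)
    (by
      intro x h1 h2 h3 h4 t ht
      obtain ⟨h5, h6⟩ := (hGle x).1 h4
      obtain ⟨h7, h8⟩ := planeProj_inner hp hn hpn (x : ℍ[ℝ])
      have h9 := norm_planeProj_lt hp hn hpn h3
      rw [hnorm] at h9
      have h10 := haxis x h1 h2
      have h11 := hcP x
      have h12 : ⟪(x : ℍ[ℝ]), planeProj (γ + γ') (γ - γ') (x : ℍ[ℝ])⟫_ℝ =
          ‖planeProj (γ + γ') (γ - γ') (x : ℍ[ℝ])‖ ^ 2 := by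
        rw [norm_planeProj_sq hp hn hpn, planeProj, inner_add_right, inner_smul_right,
          inner_smul_right]
        ring
      set a := planeProj (γ + γ') (γ - γ') (x : ℍ[ℝ])
      -- The inner product of `x + t • a` with `γ + γ'` is `1 + t` times that of `x`, while its norm
      -- is less than `1 + t`.
      have hlt : ‖(x : ℍ[ℝ]) + t • a‖ < 1 + t := by
        refine (norm_add_le _ _).trans_lt ?_
        rw [hnorm, norm_smul, Real.norm_of_nonneg ht.le]
        nlinarith
      have hX : ⟪(x : ℍ[ℝ]) + t • a, γ + γ'⟫_ℝ = (1 + t) * ⟪(x : ℍ[ℝ]), γ + γ'⟫_ℝ := by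
        rw [inner_add_left, inner_smul_left, h7, RCLike.conj_to_real]; ring
      have hy : (x : ℍ[ℝ]) + t • a ≠ 0 := by
        intro h
        rw [h, inner_zero_left] at hX
        exact (mul_pos (by linarith : 0 < 1 + t) h1).ne hX
      have hy0 := norm_pos_iff.2 hy
      refine max_lt (sub_neg.2 ?_) (sub_neg.2 ?_)
      · refine height_nrm_add_smul_lt a _ ?_ h10 x ?_ h5 ht
        · have : 0 < 3 + 3 * φ := by linarith
          positivity
        · rw [h12]
          refine lt_of_lt_of_le ?_ (mul_le_mul_of_nonneg_left h11 (by norm_num))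
          -- Dividing by the factor `⟪x, γ + γ'⟫ / (3 + 3 φ)` leaves `φ² < 0.9352 * ⟪x, γ + γ'⟫`,
          -- which holds as `⟪x, γ + γ'⟫ ≥ 2.8`.
          have hr : 0 < ⟪(x : ℍ[ℝ]), γ + γ'⟫_ℝ / (3 + 3 * φ) := div_pos h1 (by linarith)
          rw [pow_two ⟪(x : ℍ[ℝ]), γ + γ'⟫_ℝ, mul_div_assoc, ← mul_assoc, mul_comm]
          exact mul_lt_mul_of_pos_right (by linarith) hr
      · rw [coe_nrm_inner hy, lt_div_iff₀ hy0, hX, mul_comm (1 + t)]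
        exact (mul_lt_mul_of_pos_left hlt (by norm_num)).trans_le
          (mul_le_mul_of_nonneg_right h6 (by linarith)))
    2.8 (by norm_num) (fun x _ _ h => ((hGle x).1 h).2)
  have himg : χ '' cylinder = cellHandle γ γ' := by
    ext x
    rw [Set.mem_image, ← hχr, hGle]
    constructor
    · rintro ⟨-, h1, h2, h3⟩
      exact ⟨h3, h1, h2⟩
    · rintro ⟨h1, h2, h3⟩
      exact ⟨by linarith, h2, h3, h1⟩
  exact ⟨χ, hχc, hχi, himg, hχb⟩

/-! ### Handle decompositions of the quotient -/

/-- A decomposition of the subset `V` of the 3-sphere into balls around certain nodes and handles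
around edges between these nodes, which is invariant under left multiplication by the binary
icosahedral group. The balls around the nodes `node i`, and the handles around the edges
from `source j` to `target j`, represent the orbits.

A handle around the edge from `γ` to `γ'` is bounded by the two hyperplanes
`⟪x, γ - γ'⟫ = ± 1 / 2000 * ⟪x, γ + γ'⟫`. As `1999 / 2001 = (1 - 1 / 2000) / (1 + 1 / 2000)`, the
equation of the one on the side of `γ` is also `⟪x, γ'⟫ = 1999 / 2001 * ⟪x, γ⟫`, and the ball around
`γ` lies on the other side of it. -/
structure HandleSystem (V : Set UnitQuaternion) (ι κ : Type) where
  /-- The set of all nodes. -/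
  IsNode : ℍ[ℝ] → Prop
  ball : ℍ[ℝ] → Set UnitQuaternion
  handle : ℍ[ℝ] → ℍ[ℝ] → Set UnitQuaternion
  node : ι → ℍ[ℝ]
  source : κ → ℍ[ℝ]
  target : κ → ℍ[ℝ]
  isNode_node : ∀ i, IsNode (node i)
  isNode_source : ∀ j, IsNode (source j)
  isNode_target : ∀ j, IsNode (target j)
  source_ne_target : ∀ j, source j ≠ target j
  isNode_mul : ∀ a ∈ binaryIcosahedralGroup, ∀ γ, IsNode γ → IsNode (a * γ)
  exists_node : ∀ γ, IsNode γ → ∃ a ∈ binaryIcosahedralGroup, ∃ i, γ = a * node i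
  node_unique : ∀ a ∈ binaryIcosahedralGroup, ∀ i i', (a : ℍ[ℝ]) * node i = node i' →
    a = 1 ∧ i = i'
  edge_unique : ∀ a ∈ binaryIcosahedralGroup, ∀ j j',
    ((a : ℍ[ℝ]) * source j = source j' ∧ (a : ℍ[ℝ]) * target j = target j' ∨
      (a : ℍ[ℝ]) * source j = target j' ∧ (a : ℍ[ℝ]) * target j = source j') → a = 1 ∧ j = j'
  ball_mul : ∀ a ∈ binaryIcosahedralGroup, ∀ γ, ∀ x ∈ ball γ, a * x ∈ ball (a * γ)
  handle_mul : ∀ a ∈ binaryIcosahedralGroup, ∀ γ γ', ∀ x ∈ handle γ γ',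
    a * x ∈ handle (a * γ) (a * γ')
  /-- The balls are topological balls. Their boundary spheres contain the places where they are
  close to a second node. -/
  ball_chart : ∀ i, ∃ β : E3 → UnitQuaternion, Continuous β ∧
    Set.InjOn β (Metric.closedBall 0 1) ∧ β '' Metric.closedBall 0 1 = ball (node i) ∧
    ∀ η, IsNode η → η ≠ node i → ∀ x ∈ ball (node i),
      ⟪(x : ℍ[ℝ]), η⟫_ℝ = 1999 / 2001 * ⟪(x : ℍ[ℝ]), node i⟫_ℝ → x ∈ β '' Metric.sphere 0 1
  /-- The handles are solid cylinders, and the ratio of the inner products with the difference and the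
  sum of the two nodes is constant on their slices. -/
  handle_chart : ∀ j, ∃ χ : ℝ × E2 → UnitQuaternion, Continuous χ ∧ Set.InjOn χ cylinder ∧
    χ '' cylinder = handle (source j) (target j) ∧
    ∀ z ∈ cylinder, ⟪(χ z : ℍ[ℝ]), source j - target j⟫_ℝ =
      z.1 * (1 / 2000 * ⟪(χ z : ℍ[ℝ]), source j + target j⟫_ℝ)
  ball_pos : ∀ γ, ∀ x ∈ ball γ, 0 < ⟪(x : ℍ[ℝ]), γ⟫_ℝ
  ball_le : ∀ γ, ∀ x ∈ ball γ, ∀ η, IsNode η → η ≠ γ →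
    ⟪(x : ℍ[ℝ]), η⟫_ℝ ≤ 1999 / 2001 * ⟪(x : ℍ[ℝ]), γ⟫_ℝ
  handle_pos : ∀ γ γ', ∀ x ∈ handle γ γ', 0 < ⟪(x : ℍ[ℝ]), γ + γ'⟫_ℝ ∧
    |⟪(x : ℍ[ℝ]), γ - γ'⟫_ℝ| ≤ 1 / 2000 * ⟪(x : ℍ[ℝ]), γ + γ'⟫_ℝ
  /-- In a handle, no third node is as close as the two ends of the edge. -/
  handle_lt : ∀ γ γ', IsNode γ → IsNode γ' → γ ≠ γ' → ∀ x ∈ handle γ γ', ∀ η, IsNode η →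
    η ≠ γ → η ≠ γ' → ⟪(x : ℍ[ℝ]), η⟫_ℝ < 1999 / 2001 * ⟪(x : ℍ[ℝ]), γ⟫_ℝ ∧
      ⟪(x : ℍ[ℝ]), η⟫_ℝ < 1999 / 2001 * ⟪(x : ℍ[ℝ]), γ'⟫_ℝ
  /-- The ends of a handle lie in the balls around the ends of the edge. -/
  handle_end : ∀ γ γ', IsNode γ → IsNode γ' → γ ≠ γ' → ∀ x ∈ handle γ γ',
    (⟪(x : ℍ[ℝ]), γ'⟫_ℝ = 1999 / 2001 * ⟪(x : ℍ[ℝ]), γ⟫_ℝ → x ∈ ball γ) ∧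
    (⟪(x : ℍ[ℝ]), γ⟫_ℝ = 1999 / 2001 * ⟪(x : ℍ[ℝ]), γ'⟫_ℝ → x ∈ ball γ')
  mem_iff : ∀ x, x ∈ V ↔ (∃ γ, IsNode γ ∧ x ∈ ball γ) ∨
    ∃ a ∈ binaryIcosahedralGroup, ∃ j, x ∈ handle (a * source j) (a * target j)

namespace HandleSystem

variable {V : Set UnitQuaternion} {ι κ : Type} (D : HandleSystem V ι κ)

include D

theorem ball_unique {γ η : ℍ[ℝ]} (hγ : D.IsNode γ) (hη : D.IsNode η) {x : UnitQuaternion}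
    (h : x ∈ D.ball γ) (h' : x ∈ D.ball η) : γ = η := by
  by_contra hne
  have h1 := D.ball_le γ x h η hη (Ne.symm hne)
  have h2 := D.ball_le η x h' γ hγ hne
  linarith [D.ball_pos γ x h, D.ball_pos η x h']

theorem handle_unique {a : UnitQuaternion} (ha : a ∈ binaryIcosahedralGroup) {j j' : κ}
    {x : UnitQuaternion} (h : x ∈ D.handle (a * D.source j) (a * D.target j))
    (h' : x ∈ D.handle (D.source j') (D.target j')) : a = 1 ∧ j = j' := by
  have hs := D.isNode_mul a ha _ (D.isNode_source j)
  have ht := D.isNode_mul a ha _ (D.isNode_target j)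
  have hst : (a : ℍ[ℝ]) * D.source j ≠ a * D.target j := fun h =>
    D.source_ne_target j (mul_left_cancel₀ (ne_zero_of_mem_unit_sphere a) h)
  have hlt := D.handle_lt _ _ hs ht hst x h
  have hlt' := D.handle_lt _ _ (D.isNode_source j') (D.isNode_target j')
    (D.source_ne_target j') x h'
  have hs' := D.isNode_source j'
  have ht' := D.isNode_target j'
  have hst' := D.source_ne_target j'
  obtain ⟨-, -, hp1, hp2⟩ := edgeHandle_inner_pos (D.handle_pos _ _ x h).1 (D.handle_pos _ _ x h).2
  obtain ⟨-, -, hp3, hp4⟩ :=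
    edgeHandle_inner_pos (D.handle_pos _ _ x h').1 (D.handle_pos _ _ x h').2
  apply D.edge_unique a ha
  generalize (a : ℍ[ℝ]) * D.source j = s at *
  generalize (a : ℍ[ℝ]) * D.target j = t at *
  generalize D.source j' = s' at *
  generalize D.target j' = t' at *
  -- Each of the edges contains the two nodes which are closest to `x`, so the edges coincide.
  have key : ∀ u ∈ ({s, t} : Set ℍ[ℝ]), u = s' ∨ u = t' := by
    intro u hu
    by_contra hcon
    rw [not_or] at hcon
    have hu' : D.IsNode u := by rcases hu with rfl | rfl <;> assumption
    have h1 := hlt' u hu' hcon.1 hcon.2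
    have h2 : ∃ q, (q = s' ∨ q = t') ∧ q ≠ s ∧ q ≠ t := by
      by_contra hq
      push Not at hq
      have hq1 := hq s' (Or.inl rfl)
      have hq2 := hq t' (Or.inr rfl)
      rcases hu with rfl | rfl
      · exact hst' ((hq1 (Ne.symm hcon.1)).trans (hq2 (Ne.symm hcon.2)).symm)
      · have e1 : s' = s := by by_contra h; exact hcon.1 (hq1 h).symm
        have e2 : t' = s := by by_contra h; exact hcon.2 (hq2 h).symm
        exact hst' (e1.trans e2.symm)
    obtain ⟨q, hq, hqs, hqt⟩ := h2
    have h3 := hlt q (by rcases hq with rfl | rfl <;> assumption) hqs hqt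
    rcases hq with rfl | rfl <;> rcases hu with rfl | rfl <;> linarith [h1.1, h1.2, h3.1, h3.2]
  rcases key s (by simp) with e1 | e1 <;> rcases key t (by simp) with e2 | e2
  · exact absurd (e1.trans e2.symm) hst
  · exact Or.inl ⟨e1, e2⟩
  · exact Or.inr ⟨e1, e2⟩
  · exact absurd (e1.trans e2.symm) hst

/-- A ball and a handle meet only at an end of the handle, and only if the ball belongs to the
corresponding end of the edge. -/
theorem eq_of_mem_ball_of_mem_handle {γ : ℍ[ℝ]} (hγ : D.IsNode γ) {j : κ} {x : UnitQuaternion}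
    (hb : x ∈ D.ball γ) (hh : x ∈ D.handle (D.source j) (D.target j)) :
    (γ = D.source j ∧ ⟪(x : ℍ[ℝ]), D.target j⟫_ℝ = 1999 / 2001 * ⟪(x : ℍ[ℝ]), D.source j⟫_ℝ) ∨
    (γ = D.target j ∧ ⟪(x : ℍ[ℝ]), D.source j⟫_ℝ = 1999 / 2001 * ⟪(x : ℍ[ℝ]), D.target j⟫_ℝ) := by
  have hs := D.isNode_source j
  have ht := D.isNode_target j
  have hst := D.source_ne_target j
  have hlt := D.handle_lt _ _ hs ht hst x hh
  obtain ⟨h1, h2, hp1, hp2⟩ :=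
    edgeHandle_inner_pos (D.handle_pos _ _ x hh).1 (D.handle_pos _ _ x hh).2
  by_cases e1 : γ = D.source j
  · subst e1
    exact Or.inl ⟨rfl, le_antisymm (D.ball_le _ x hb _ ht hst.symm) h2⟩
  by_cases e2 : γ = D.target j
  · subst e2
    exact Or.inr ⟨rfl, le_antisymm (D.ball_le _ x hb _ hs hst) h1⟩
  have h3 := hlt γ hγ e1 e2
  have h4 := D.ball_le _ x hb _ hs (Ne.symm e1)
  linarith [h3.1]

/-- The image of `V` in the quotient of the 3-sphere by the binary icosahedral group has a handle
decomposition with one ball for each orbit of nodes and one handle for each orbit of edges, because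
the group acts freely on the nodes and on the edges. -/
theorem exists_handleDecomposition {M : Type*} [TopologicalSpace M] {p : UnitQuaternion → M}
    (hp : Continuous p)
    (hfib : ∀ x y, p x = p y ↔ ∃ b ∈ binaryIcosahedralGroup, y = b * x) {n k : ℕ}
    (e : Fin n ≃ ι) (f : Fin k ≃ κ) : ∃ E : HandleDecomposition (p '' V) n k,
      (∀ i, E.ball i '' Metric.closedBall 0 1 = p '' D.ball (D.node (e i))) ∧
      ∀ j, E.handle j '' cylinder = p '' D.handle (D.source (f j)) (D.target (f j)) ∧
        (p '' D.ball (D.source (f j)) ∩ E.handle j '' cylinder).Nonempty ∧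
        (p '' D.ball (D.target (f j)) ∩ E.handle j '' cylinder).Nonempty := by
  choose β βc βi βr βs using D.ball_chart
  choose χ χc χi χr χs using D.handle_chart
  have inv : ∀ a ∈ binaryIcosahedralGroup, ∀ x, p (a * x) = p x := fun a ha x =>
    ((hfib x (a * x)).2 ⟨a, ha, rfl⟩).symm
  have memβ : ∀ i w, w ∈ Metric.closedBall (0 : E3) 1 → β i w ∈ D.ball (D.node i) := fun i w hw =>
    βr i ▸ Set.mem_image_of_mem _ hw
  have memχ : ∀ j z, z ∈ cylinder → χ j z ∈ D.handle (D.source j) (D.target j) := fun j z hz =>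
    χr j ▸ Set.mem_image_of_mem _ hz
  have cyl : cylinderEnds ⊆ cylinder := by
    rintro ⟨τ, w⟩ ⟨h, hw⟩
    refine ⟨?_, hw⟩
    rcases h with h | h <;> simp only at h <;> rw [h] <;> norm_num
  have inn : ∀ (a x : UnitQuaternion) (v : ℍ[ℝ]), ⟪((a * x : UnitQuaternion) : ℍ[ℝ]), a * v⟫_ℝ =
      ⟪(x : ℍ[ℝ]), v⟫_ℝ := fun a x v => inner_mul_mul_left (norm_eq_of_mem_sphere a) _ _
  -- the boundary spheres of the balls are mapped to the boundary spheres of representatives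
  have sph : ∀ γ, D.IsNode γ → ∀ η, D.IsNode η → η ≠ γ → ∀ x ∈ D.ball γ,
      ⟪(x : ℍ[ℝ]), η⟫_ℝ = 1999 / 2001 * ⟪(x : ℍ[ℝ]), γ⟫_ℝ →
      ∃ i, p x ∈ (p ∘ β i) '' Metric.sphere 0 1 := by
    intro γ hγ η hη hne x hx he
    obtain ⟨a, ha, i, rfl⟩ := D.exists_node γ hγ
    have ha' := inv_mem ha
    have e1 : ((a⁻¹ : UnitQuaternion) : ℍ[ℝ]) * (a * D.node i) = D.node i := by
      rw [← mul_assoc, ← Metric.unitSphere.coe_mul, inv_mul_cancel, Metric.unitSphere.coe_one,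
        one_mul]
    have hb := D.ball_mul _ ha' _ x hx
    rw [e1] at hb
    obtain ⟨w, hw, hw'⟩ := βs i (((a⁻¹ : UnitQuaternion) : ℍ[ℝ]) * η) (D.isNode_mul _ ha' _ hη)
      (fun h => hne (mul_left_cancel₀ (ne_zero_of_mem_unit_sphere a⁻¹) (h.trans e1.symm)))
      (a⁻¹ * x) hb (by
        rw [inn, he]
        conv_rhs => rw [← e1, inn])
    exact ⟨i, w, hw, by rw [Function.comp, hw', inv _ ha']⟩
  -- The ends of the cylinder are the places where the ratio of the inner products with the two
  -- nodes is `1999 / 2001`.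
  have hends : ∀ j z, z ∈ cylinder →
      (z.1 = 1 → ⟪(χ j z : ℍ[ℝ]), D.target j⟫_ℝ = 1999 / 2001 * ⟪(χ j z : ℍ[ℝ]), D.source j⟫_ℝ) ∧
      (z.1 = -1 → ⟪(χ j z : ℍ[ℝ]), D.source j⟫_ℝ =
        1999 / 2001 * ⟪(χ j z : ℍ[ℝ]), D.target j⟫_ℝ) := by
    intro j z hz
    have := χs j z hz
    rw [inner_sub_right, inner_add_right] at this
    constructor <;> intro h <;> rw [h] at this <;> linarith
  have hends' : ∀ j z, z ∈ cylinder →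
      (⟪(χ j z : ℍ[ℝ]), D.target j⟫_ℝ = 1999 / 2001 * ⟪(χ j z : ℍ[ℝ]), D.source j⟫_ℝ ∨
        ⟪(χ j z : ℍ[ℝ]), D.source j⟫_ℝ = 1999 / 2001 * ⟪(χ j z : ℍ[ℝ]), D.target j⟫_ℝ) →
      z ∈ cylinderEnds := by
    intro j z hz h
    have h1 := χs j z hz
    have hpos := (D.handle_pos _ _ _ (memχ j z hz)).1
    refine ⟨?_, hz.2⟩
    rw [inner_sub_right] at h1
    rw [inner_add_right] at h1 hpos
    rcases h with h | h
    · right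
      rw [Set.mem_singleton_iff]
      refine mul_right_cancel₀ hpos.ne' ?_
      linarith
    · left
      refine mul_right_cancel₀ hpos.ne' ?_
      linarith
  have hsrc : ∀ j z, z ∈ cylinder → z.1 = 1 → χ j z ∈ D.ball (D.source j) := fun j z hz h =>
    (D.handle_end _ _ (D.isNode_source j) (D.isNode_target j) (D.source_ne_target j) _
      (memχ j z hz)).1 ((hends j z hz).1 h)
  have htgt : ∀ j z, z ∈ cylinder → z.1 = -1 → χ j z ∈ D.ball (D.target j) := fun j z hz h =>
    (D.handle_end _ _ (D.isNode_source j) (D.isNode_target j) (D.source_ne_target j) _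
      (memχ j z hz)).2 ((hends j z hz).2 h)
  refine ⟨{
    ball := fun i => p ∘ β (e i)
    handle := fun j => p ∘ χ (f j)
    ball_continuous := fun i => (hp.comp (βc _)).continuousOn
    handle_continuous := fun j => (hp.comp (χc _)).continuousOn
    ball_injective := ?_
    handle_injective := ?_
    ball_disjoint := ?_
    handle_disjoint := ?_
    ends_attached := ?_
    meets_in_ends := ?_
    union_eq := ?_ }, ?_, ?_⟩
  · intro i w hw w' hw' h
    obtain ⟨a, ha, h⟩ := (hfib _ _).1 h
    have h1 := D.ball_mul a ha _ _ (memβ (e i) w hw)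
    rw [← h] at h1
    have h2 := (D.node_unique a ha (e i) (e i) (D.ball_unique
      (D.isNode_mul a ha _ (D.isNode_node _)) (D.isNode_node _) h1 (memβ (e i) w' hw'))).1
    rw [h2, one_mul] at h
    exact βi _ hw hw' h.symm
  · intro j z hz z' hz' h
    obtain ⟨a, ha, h⟩ := (hfib _ _).1 h
    have h1 := D.handle_mul a ha _ _ _ (memχ (f j) z hz)
    rw [← h] at h1
    rw [(D.handle_unique ha h1 (memχ (f j) z' hz')).1, one_mul] at h
    exact χi _ hz hz' h.symm
  · intro i i' hne
    rw [Set.disjoint_left]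
    rintro _ ⟨w, hw, rfl⟩ ⟨w', hw', h⟩
    obtain ⟨a, ha, h⟩ := (hfib _ _).1 h.symm
    have h1 := D.ball_mul a ha _ _ (memβ (e i) w hw)
    rw [← h] at h1
    exact hne (e.injective (D.node_unique a ha (e i) (e i') (D.ball_unique
      (D.isNode_mul a ha _ (D.isNode_node _)) (D.isNode_node _) h1 (memβ (e i') w' hw'))).2)
  · intro j j' hne
    rw [Set.disjoint_left]
    rintro _ ⟨z, hz, rfl⟩ ⟨z', hz', h⟩
    obtain ⟨a, ha, h⟩ := (hfib _ _).1 h.symm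
    have h1 := D.handle_mul a ha _ _ _ (memχ (f j) z hz)
    rw [← h] at h1
    exact hne (f.injective (D.handle_unique ha h1 (memχ (f j') z' hz')).2)
  · rintro j _ ⟨z, hz, rfl⟩
    have hz' := cyl hz
    have hex : ∃ i, p (χ (f j) z) ∈ (p ∘ β i) '' Metric.sphere 0 1 := by
      rcases hz.1 with h | h
      · exact sph _ (D.isNode_target _) _ (D.isNode_source _) (D.source_ne_target _) _
          (htgt _ z hz' h) ((hends _ z hz').2 h)
      · exact sph _ (D.isNode_source _) _ (D.isNode_target _) (D.source_ne_target _).symm _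
          (hsrc _ z hz' h) ((hends _ z hz').1 h)
    obtain ⟨i, hi⟩ := hex
    refine Set.mem_iUnion.2 ⟨e.symm i, ?_⟩
    rwa [e.apply_symm_apply]
  · rintro i j _ ⟨⟨w, hw, rfl⟩, ⟨z, hz, h⟩⟩
    obtain ⟨a, ha, h'⟩ := (hfib _ _).1 h.symm
    have h1 := D.ball_mul a ha _ _ (memβ (e i) w hw)
    rw [← h'] at h1
    have h2 := D.eq_of_mem_ball_of_mem_handle (D.isNode_mul a ha _ (D.isNode_node _)) h1
      (memχ (f j) z hz)
    refine ⟨?_, ⟨z, hends' _ z hz (h2.imp And.right And.right), h⟩⟩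
    have ha' := inv_mem ha
    have e1 : ∀ v, ((a : UnitQuaternion) : ℍ[ℝ]) * (((a⁻¹ : UnitQuaternion) : ℍ[ℝ]) * v) = v :=
      fun v => by
        rw [← mul_assoc, ← Metric.unitSphere.coe_mul, mul_inv_cancel, Metric.unitSphere.coe_one,
          one_mul]
    have key : ∀ η, D.IsNode η → η ≠ a * D.node (e i) →
        ⟪(χ (f j) z : ℍ[ℝ]), η⟫_ℝ = 1999 / 2001 * ⟪(χ (f j) z : ℍ[ℝ]), a * D.node (e i)⟫_ℝ →
        (p ∘ β (e i)) w ∈ (p ∘ β (e i)) '' Metric.sphere 0 1 := by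
      intro η hη hne he
      obtain ⟨w', hw', he'⟩ := βs (e i) (((a⁻¹ : UnitQuaternion) : ℍ[ℝ]) * η)
        (D.isNode_mul _ ha' _ hη) (fun h => hne (by rw [← h, e1])) (β (e i) w)
        (memβ _ w hw) (by
          rw [h', inn] at he
          rw [← he, ← inn a, e1])
      exact ⟨w', hw', by rw [Function.comp, he', Function.comp]⟩
    rcases h2 with ⟨h2, h3⟩ | ⟨h2, h3⟩
    · exact key _ (D.isNode_target (f j)) (h2 ▸ (D.source_ne_target (f j)).symm) (by rw [h3, h2])
    · exact key _ (D.isNode_source (f j)) (h2 ▸ D.source_ne_target (f j)) (by rw [h3, h2])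
  · ext y
    simp only [Set.mem_union, Set.mem_iUnion]
    constructor
    · rintro (⟨i, w, hw, rfl⟩ | ⟨j, z, hz, rfl⟩)
      · exact ⟨_, (D.mem_iff _).2 (Or.inl ⟨_, D.isNode_node _, memβ _ w hw⟩), rfl⟩
      · refine ⟨_, (D.mem_iff _).2 (Or.inr ⟨1, one_mem _, f j, ?_⟩), rfl⟩
        simpa using memχ _ z hz
    · rintro ⟨x, hx, rfl⟩
      rcases (D.mem_iff x).1 hx with ⟨γ, hγ, h⟩ | ⟨a, ha, j, h⟩
      · left
        obtain ⟨a, ha, i, rfl⟩ := D.exists_node γ hγ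
        have hb := D.ball_mul _ (inv_mem ha) _ x h
        rw [← mul_assoc, ← Metric.unitSphere.coe_mul, inv_mul_cancel, Metric.unitSphere.coe_one,
          one_mul, ← βr] at hb
        obtain ⟨w, hw, hw'⟩ := hb
        refine ⟨e.symm i, w, hw, ?_⟩
        rw [Function.comp, e.apply_symm_apply, hw', inv _ (inv_mem ha)]
      · right
        have hb := D.handle_mul _ (inv_mem ha) _ _ x h
        simp only [← mul_assoc, ← Metric.unitSphere.coe_mul, inv_mul_cancel,
          Metric.unitSphere.coe_one, one_mul, ← χr] at hb
        obtain ⟨z, hz, hz'⟩ := hb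
        refine ⟨f.symm j, z, hz, ?_⟩
        rw [Function.comp, f.apply_symm_apply, hz', inv _ (inv_mem ha)]
  · intro i
    rw [Set.image_comp, βr]
  · intro j
    have h1 : ((1, 0) : ℝ × E2) ∈ cylinder := ⟨by norm_num, by simp⟩
    have h2 : ((-1, 0) : ℝ × E2) ∈ cylinder := ⟨by norm_num, by simp⟩
    exact ⟨by rw [Set.image_comp, χr], ⟨p (χ (f j) (1, 0)), ⟨_, hsrc _ _ h1 rfl, rfl⟩, _, h1, rfl⟩,
      ⟨p (χ (f j) (-1, 0)), ⟨_, htgt _ _ h2 rfl, rfl⟩, _, h2, rfl⟩⟩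

end HandleSystem

/-- A union of balls and handles is connected if the corresponding graph is. -/
theorem HandleDecomposition.isConnected {X : Type*} [TopologicalSpace X] {V : Set X} {n k : ℕ}
    (E : HandleDecomposition V n k) (i₀ : Fin n) (src tgt : Fin k → Fin n)
    (hs : ∀ j, (E.ball (src j) '' Metric.closedBall 0 1 ∩ E.handle j '' cylinder).Nonempty)
    (ht : ∀ j, (E.ball (tgt j) '' Metric.closedBall 0 1 ∩ E.handle j '' cylinder).Nonempty)
    (hconn : ∀ i, Relation.ReflTransGen (fun i i' => ∃ j, src j = i ∧ tgt j = i') i₀ i) :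
    IsConnected V := by
  let P : Fin n ⊕ Fin k → Set X := Sum.elim (fun i => E.ball i '' Metric.closedBall 0 1)
    (fun j => E.handle j '' cylinder)
  have hU : ⋃ z, P z = V := by
    rw [← E.union_eq, Set.iUnion_sum]; rfl
  let R : Fin n ⊕ Fin k → Fin n ⊕ Fin k → Prop := fun z z' => (P z ∩ P z').Nonempty
  have : Std.Symm R := ⟨fun a b (h : (P a ∩ P b).Nonempty) => by
    show (P b ∩ P a).Nonempty
    rwa [Set.inter_comm]⟩
  have hsymm : ∀ z z', Relation.ReflTransGen R z z' → Relation.ReflTransGen R z' z :=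
    fun z z' h => (Relation.ReflTransGen.stdSymm (r := R)).symm _ _ h
  have h1 : ∀ i, Relation.ReflTransGen R (Sum.inl i₀) (Sum.inl i) := by
    intro i
    induction hconn i with
    | refl => exact .refl
    | tail _ h ih =>
      obtain ⟨j, rfl, rfl⟩ := h
      refine (ih.tail (show R (Sum.inl (src j)) (Sum.inr j) from hs j)).tail ?_
      show (P _ ∩ P _).Nonempty
      rw [Set.inter_comm]
      exact ht j
  have h2 : ∀ z, Relation.ReflTransGen R (Sum.inl i₀) z := by
    rintro (i | j)
    · exact h1 i
    · exact (h1 (src j)).tail (hs j)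
  refine ⟨?_, ?_⟩
  · rw [← hU]
    exact ⟨E.ball i₀ 0, Set.mem_iUnion.2 ⟨Sum.inl i₀, 0, by simp, rfl⟩⟩
  · rw [← hU]
    refine IsPreconnected.iUnion_of_reflTransGen ?_ fun z z' => (hsymm _ _ (h2 z)).trans (h2 z')
    rintro (i | j)
    · exact ((convex_closedBall _ _).isPreconnected).image _ (E.ball_continuous i)
    · exact (((convex_Icc _ _).prod (convex_closedBall _ _)).isPreconnected).image _
        (E.handle_continuous j)

theorem HandleSystem.image_ball_mul {V : Set UnitQuaternion} {ι κ : Type} (D : HandleSystem V ι κ)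
    {M : Type*} {p : UnitQuaternion → M}
    (hfib : ∀ x y, p x = p y ↔ ∃ b ∈ binaryIcosahedralGroup, y = b * x) {a : UnitQuaternion}
    (ha : a ∈ binaryIcosahedralGroup) (γ : ℍ[ℝ]) : p '' D.ball (a * γ) = p '' D.ball γ := by
  have inv : ∀ a ∈ binaryIcosahedralGroup, ∀ x, p (a * x) = p x := fun a ha x =>
    ((hfib x (a * x)).2 ⟨a, ha, rfl⟩).symm
  apply subset_antisymm
  · rintro _ ⟨x, hx, rfl⟩
    have := D.ball_mul _ (inv_mem ha) _ x hx
    rw [← mul_assoc, ← Metric.unitSphere.coe_mul, inv_mul_cancel, Metric.unitSphere.coe_one,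
      one_mul] at this
    exact ⟨_, this, inv _ (inv_mem ha) x⟩
  · rintro _ ⟨x, hx, rfl⟩
    exact ⟨_, D.ball_mul a ha _ x hx, inv a ha x⟩

theorem isUnitIcosian_coe {a : UnitQuaternion} : IsUnitIcosian (a : ℍ[ℝ]) ↔
    a ∈ binaryIcosahedralGroup := by
  constructor
  · rintro ⟨s, hs, h⟩
    rwa [← Subtype.ext h]
  · exact fun h => ⟨a, h, rfl⟩

theorem coe_mul_inner (a x : UnitQuaternion) (v : ℍ[ℝ]) :
    ⟪((a * x : UnitQuaternion) : ℍ[ℝ]), a * v⟫_ℝ = ⟪(x : ℍ[ℝ]), v⟫_ℝ :=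
  inner_mul_mul_left (norm_eq_of_mem_sphere a) _ _

theorem coe_mul_inner_left (a x : UnitQuaternion) (v : ℍ[ℝ]) :
    ⟪((a * x : UnitQuaternion) : ℍ[ℝ]), v⟫_ℝ = ⟪(x : ℍ[ℝ]), star (a : ℍ[ℝ]) * v⟫_ℝ :=
  inner_mul_left_eq (norm_eq_of_mem_sphere a) _ _

theorem height_coe_mul {a : UnitQuaternion} (ha : a ∈ binaryIcosahedralGroup)
    (x : UnitQuaternion) : height ((a * x : UnitQuaternion) : ℍ[ℝ]) = height x := by
  have := height_mul (isUnitIcosian_coe.2 ha) .one (x : ℍ[ℝ])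
  rwa [mul_one] at this

theorem mul_star_cancel (a : UnitQuaternion) (v : ℍ[ℝ]) : (a : ℍ[ℝ]) * (star (a : ℍ[ℝ]) * v) = v := by
  rw [← mul_assoc, quaternion_self_mul_star (norm_eq_of_mem_sphere a), one_mul]

theorem edgeHandle_comm (v w : ℍ[ℝ]) : edgeHandle v w = edgeHandle w v := by
  ext x
  simp only [edgeHandle, Set.mem_ofPred_eq]
  rw [add_comm v w, ← neg_sub w v, inner_neg_right, abs_neg, add_comm (bump _)]

/-- On an edge handle the inner product with a third vertex is smaller, since the three inner
products add up to less than `2.8026`. -/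
theorem edgeHandle_lt {v w u : ℍ[ℝ]} (hv : IsUnitIcosian v) (hw : IsUnitIcosian w) (hvw : v ≠ w)
    {x : UnitQuaternion} (hx : x ∈ edgeHandle v w) (hu : IsUnitIcosian u) (huv : u ≠ v)
    (huw : u ≠ w) : ⟪(x : ℍ[ℝ]), u⟫_ℝ < 1999 / 2001 * ⟪(x : ℍ[ℝ]), v⟫_ℝ := by
  obtain ⟨h1, h2, h3⟩ := hx
  obtain ⟨h4, h5, -⟩ := edgeHandle_inner_pos h1 h2
  by_contra hcon
  have h6 := inner_add_add_lt hv hw hu hvw huv.symm huw.symm x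
  have hpos := level_pos
  rcases (bump_nonneg ⟪(x : ℍ[ℝ]), v⟫_ℝ).lt_or_eq with h | h
  · linarith [lt_of_bump_pos h]
  · have h' : 0 < bump ⟪(x : ℍ[ℝ]), w⟫_ℝ := by linarith
    linarith [lt_of_bump_pos h']

/-- At its end an edge handle lies in the vertex ball: if the inner product with the closer vertex
were less than `0.936`, then the other vertex would not contribute to the height, which would be
below the level. -/
theorem edgeHandle_end {v w : ℍ[ℝ]} (hv : IsUnitIcosian v) (hw : IsUnitIcosian w) (hvw : v ≠ w)
    {x : UnitQuaternion} (hx : x ∈ edgeHandle v w)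
    (he : ⟪(x : ℍ[ℝ]), w⟫_ℝ = 1999 / 2001 * ⟪(x : ℍ[ℝ]), v⟫_ℝ) : x ∈ vertexBall v := by
  refine ⟨?_, fun u hu huv => ?_⟩
  · by_contra hcon
    have h1 : bump ⟪(x : ℍ[ℝ]), w⟫_ℝ = 0 := bump_eq_zero (by linarith)
    have h2 : bump ⟪(x : ℍ[ℝ]), v⟫_ℝ < level := bump_lt (not_le.1 hcon) (by norm_num)
    linarith [hx.2.2]
  · rcases eq_or_ne u w with rfl | huw
    · exact he.le
    · exact (edgeHandle_lt hv hw hvw hx hu huv huw).le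

/-- The decomposition of the upper handlebody around the 1-skeleton of the 600-cell. -/
def upperSystem : HandleSystem {x | level ≤ height (x : ℍ[ℝ])} (Fin 1) (Fin 6) where
  IsNode := IsUnitIcosian
  ball := vertexBall
  handle := edgeHandle
  node _ := 1
  source _ := 1
  target j := (Icosian.edgeRep j).toH
  isNode_node _ := .one
  isNode_source _ := .one
  isNode_target j := Icosian.isUnitIcosian_of_mem (Icosian.edgeRep_mem j)
  source_ne_target j h := by
    have h1 := IsUnitIcosian.edgeRep_re j
    rw [← h, Quaternion.re_one] at h1
    linarith [goldenRatio_bounds.2]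
  isNode_mul a ha γ hγ := (isUnitIcosian_coe.2 ha).mul hγ
  exists_node γ hγ := by
    obtain ⟨a, ha, rfl⟩ := hγ
    exact ⟨a, ha, 0, (mul_one _).symm⟩
  node_unique a _ i i' h := ⟨Subtype.ext (by simpa using h), Subsingleton.elim _ _⟩
  edge_unique a ha j j' h := by
    rcases h with ⟨h1, h2⟩ | ⟨h1, h2⟩
    · rw [mul_one] at h1
      refine ⟨Subtype.ext h1, ?_⟩
      rw [h1, one_mul] at h2
      exact (Icosian.edgeRep_distinct j j').2 (Icosian.toH_injective h2)
    · rw [mul_one] at h1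
      rw [h1] at h2
      refine absurd (Icosian.toH_injective ?_) (Icosian.edgeRep_distinct j' j).1
      have hn := (Icosian.isUnitIcosian_of_mem (Icosian.edgeRep_mem j)).norm
      rw [Icosian.toH_conj, ← mul_one (Icosian.edgeRep j').toH, ← quaternion_self_mul_star hn,
        ← mul_assoc, h2, one_mul]
  ball_mul a ha γ x hx := by
    refine ⟨by rw [coe_mul_inner]; exact hx.1, fun w hw hne => ?_⟩
    rw [coe_mul_inner, coe_mul_inner_left]
    exact hx.2 _ ((isUnitIcosian_coe.2 ha).star.mul hw) fun h => hne (by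
      rw [← h, mul_star_cancel])
  handle_mul a _ γ γ' x hx := by
    refine ⟨?_, ?_, ?_⟩
    · rw [← mul_add, coe_mul_inner]; exact hx.1
    · rw [← mul_add, ← mul_sub, coe_mul_inner, coe_mul_inner]; exact hx.2.1
    · rw [coe_mul_inner, coe_mul_inner]; exact hx.2.2
  ball_chart _ := exists_vertexBall_chart
  handle_chart j := by
    have hj := Icosian.isUnitIcosian_of_mem (Icosian.edgeRep_mem j)
    exact exists_edgeHandle_chart norm_one hj.norm
      (by rw [inner_one_left, IsUnitIcosian.edgeRep_re])
  ball_pos γ x hx := by linarith [hx.1]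
  ball_le γ x hx := hx.2
  handle_pos γ γ' x hx := ⟨hx.1, hx.2.1⟩
  handle_lt γ γ' hγ hγ' hne x hx η hη h1 h2 := ⟨edgeHandle_lt hγ hγ' hne hx hη h1 h2,
    edgeHandle_lt hγ' hγ hne.symm (edgeHandle_comm γ γ' ▸ hx) hη h2 h1⟩
  handle_end γ γ' hγ hγ' hne x hx := ⟨edgeHandle_end hγ hγ' hne hx,
    edgeHandle_end hγ' hγ hne.symm (edgeHandle_comm γ γ' ▸ hx)⟩
  -- An edge from `a` to `b` is determined up to translation by the neighbour `a⁻¹ b` of `1`;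
  -- exchanging `a` and `b` inverts it.
  mem_iff x := by
    constructor
    · intro hx
      obtain ⟨v, hv, h | ⟨w, hw, hne, hin, h⟩⟩ := exists_mem_vertexBall_or_edgeHandle x hx
      · exact Or.inl ⟨v, hv, h⟩
      · right
        obtain ⟨a, ha, rfl⟩ := hv
        obtain ⟨b, hb, rfl⟩ := hw
        have ha' := isUnitIcosian_coe.2 ha
        have hre : 1 / 2 < (star (a : ℍ[ℝ]) * b).re := by
          rwa [← inner_one_left, ← inner_mul_mul_left ha'.norm, mul_one, mul_star_cancel]
        rcases (ha'.star.mul (isUnitIcosian_coe.2 hb)).eq_one_or_edgeRep_or_re_le with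
          h1 | ⟨j, h1 | h1⟩ | h1
        · have h2 := congrArg ((a : ℍ[ℝ]) * ·) h1
          simp only [mul_star_cancel, mul_one] at h2
          exact absurd h2.symm hne
        · refine ⟨a, ha, j, ?_⟩
          rwa [← h1, mul_star_cancel, mul_one]
        · refine ⟨b, hb, j, ?_⟩
          have h2 : (Icosian.edgeRep j).toH = star (b : ℍ[ℝ]) * a := by
            rw [← star_star (Icosian.edgeRep j).toH, ← h1, star_mul, star_star]
          rwa [h2, mul_star_cancel, mul_one, edgeHandle_comm]
        · linarith
    · rintro (⟨v, hv, h⟩ | ⟨a, ha, j, h⟩)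
      · exact (bump_mono h.1).trans (bump_le_height hv x)
      · have ha' := isUnitIcosian_coe.2 ha
        have hj := Icosian.isUnitIcosian_of_mem (Icosian.edgeRep_mem j)
        refine h.2.2.trans (bump_add_le_height (ha'.mul .one) (ha'.mul hj) ?_ x)
        intro h'
        have h1 := IsUnitIcosian.edgeRep_re j
        rw [← mul_left_cancel₀ (ne_zero_of_mem_unit_sphere a) h', Quaternion.re_one] at h1
        linarith [goldenRatio_bounds.2]

/-- The superlevel set has one ball and `6` handles in the quotient: the `120` vertices and the
`720` edges of the 600-cell form one orbit and six orbits. -/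
theorem isHandlebody_upper {M : Type*} [TopologicalSpace M] {p : UnitQuaternion → M}
    (hp : Continuous p)
    (hfib : ∀ x y, p x = p y ↔ ∃ b ∈ binaryIcosahedralGroup, y = b * x) :
    IsHandlebody (p '' {x | level ≤ height (x : ℍ[ℝ])}) 6 := by
  obtain ⟨E, h1, h2⟩ := upperSystem.exists_handleDecomposition hp hfib (Equiv.refl _) (Equiv.refl _)
  refine ⟨E.isConnected 0 (fun _ => 0) (fun _ => 0) (fun j => ?_) (fun j => ?_) fun i => ?_,
    1, 6, rfl, ⟨E⟩⟩
  · rw [h1]; exact (h2 j).2.1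
  · rw [h1]; exact (h2 j).2.1
  · rw [Subsingleton.elim i 0]

theorem cellHandle_comm (v w : ℍ[ℝ]) : cellHandle v w = cellHandle w v := by
  ext x
  simp only [cellHandle, Set.mem_ofPred_eq]
  rw [add_comm v w, ← neg_sub w v, inner_neg_right, abs_neg]

theorem cellHandle_lt {γ γ' η : ℍ[ℝ]} (hγ : IsCell γ) (hγ' : IsCell γ') (hne : γ ≠ γ')
    {x : UnitQuaternion} (hx : x ∈ cellHandle γ γ') (hη : IsCell η) (h1 : η ≠ γ)
    (h2 : η ≠ γ') : ⟪(x : ℍ[ℝ]), η⟫_ℝ < 1999 / 2001 * ⟪(x : ℍ[ℝ]), γ⟫_ℝ := by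
  obtain ⟨h3, h4, h5⟩ := hx
  obtain ⟨h6, h7, -⟩ := edgeHandle_inner_pos (by linarith) h4
  rw [inner_add_right] at h3
  by_contra hcon
  -- Otherwise the sum would be at least `2.8 + 0.999 * 1.399 > 4.191`.
  have h6 := hγ.inner_add_add_lt hγ' hη hne h1.symm h2.symm x
  linarith

theorem cellHandle_end {γ γ' : ℍ[ℝ]} (hγ : IsCell γ) (hγ' : IsCell γ') (hne : γ ≠ γ')
    {x : UnitQuaternion} (hx : x ∈ cellHandle γ γ')
    (he : ⟪(x : ℍ[ℝ]), γ'⟫_ℝ = 1999 / 2001 * ⟪(x : ℍ[ℝ]), γ⟫_ℝ) : x ∈ cellBall γ := by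
  refine ⟨?_, hx.2.2, fun u hu huv => ?_⟩
  · exact (edgeHandle_inner_pos (by linarith [hx.1]) hx.2.1).2.2.1
  · rcases eq_or_ne u γ' with rfl | huw
    · exact he.le
    · exact (cellHandle_lt hγ hγ' hne hx hu huv huw).le

theorem zetaH_pow_ne_zero (n : ℕ) : zetaH ^ n ≠ 0 :=
  pow_ne_zero _ (norm_ne_zero_iff.1 (by rw [isUnitIcosian_zetaH.norm]; norm_num))

theorem cellCoeff_mul_rev (k : Fin 4) :
    (Icosian.cellCoeff k).toH * (Icosian.cellCoeff k.rev).toH = -1 := by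
  rw [← Icosian.toH_mul (Icosian.cellCoeff_mul_rev k).1, (Icosian.cellCoeff_mul_rev k).2,
    Icosian.toH_negOne]

/-- The `k`-th neighbour of `cellCenter` has `cellCenter` as its neighbour with the opposite
index. -/
theorem cellCoeff_mul_cellNeighbor_rev (k : Fin 4) (n : ℕ) :
    (Icosian.cellCoeff k).toH * cellNeighbor k.rev * zetaH ^ ((k : ℕ) + 1 + n) =
      cellCenter * zetaH ^ n := by
  have e : ((k.rev : Fin 4) : ℕ) + 1 + ((k : ℕ) + 1 + n) = 5 + n := by
    rw [Fin.val_rev]; omega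
  rw [cellNeighbor_eq, ← mul_assoc, ← mul_assoc, cellCoeff_mul_rev, mul_assoc, ← pow_add, e, pow_add,
    zetaH_pow_five]
  simp

/-- Every pair of adjacent cells is, up to order, a translate of one of ten. -/
theorem exists_edge_rep {γ γ' : ℍ[ℝ]} (hγ : IsCell γ) (hγ' : IsCell γ') (hne : γ ≠ γ')
    (hin : 1.81 < ⟪γ, γ'⟫_ℝ) : ∃ a, IsUnitIcosian a ∧ ∃ (k : Fin 2) (j : Fin 5),
      (γ = a * (cellCenter * zetaH ^ (j : ℕ)) ∧
        γ' = a * (cellNeighbor (k.castLE (by norm_num)) * zetaH ^ (j : ℕ))) ∨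
      (γ' = a * (cellCenter * zetaH ^ (j : ℕ)) ∧
        γ = a * (cellNeighbor (k.castLE (by norm_num)) * zetaH ^ (j : ℕ))) := by
  have red : ∀ a, IsUnitIcosian a → ∀ n : ℕ, ∃ b, IsUnitIcosian b ∧ ∃ j : Fin 5,
      ∀ x, a * (x * zetaH ^ n) = b * (x * zetaH ^ (j : ℕ)) := by
    intro a ha n
    rcases zetaH_pow_eq n with e | e
    · exact ⟨a, ha, ⟨n % 5, Nat.mod_lt _ (by norm_num)⟩, fun x => by rw [e]⟩
    · exact ⟨-a, ha.neg, ⟨n % 5, Nat.mod_lt _ (by norm_num)⟩, fun x => by rw [e]; simp⟩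
  obtain ⟨a, ha, n, rfl⟩ := hγ
  have hz := isUnitIcosian_zetaH.pow (9 * n)
  have e : zetaH ^ n * zetaH ^ (9 * n) = 1 := by
    rw [← pow_add, show n + 9 * n = 10 * n by ring, pow_mul, zetaH_pow_ten, one_pow]
  have e' : zetaH ^ (9 * n) * zetaH ^ n = 1 := by
    rw [← pow_add, show 9 * n + n = 10 * n by ring, pow_mul, zetaH_pow_ten, one_pow]
  have e1 : star a * (a * cellCenter * zetaH ^ n) * zetaH ^ (9 * n) = cellCenter := by
    rw [← mul_assoc, ← mul_assoc, quaternion_star_mul_self ha.norm, one_mul, mul_assoc, e, mul_one]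
  have e2 : a * (star a * γ' * zetaH ^ (9 * n)) * zetaH ^ n = γ' := by
    rw [mul_assoc, mul_assoc (star a * γ'), e', mul_one, ← mul_assoc,
      quaternion_self_mul_star ha.norm, one_mul]
  obtain ⟨k, hk⟩ := ((hγ'.mul_left ha.star).mul_zetaH_pow (9 * n)).exists_cellNeighbor
    (fun h => hne (by rw [← e2, h])) (by
      rw [← e1, inner_mul_mul_right hz.norm, inner_mul_mul_left ha.star.norm]; exact hin)
  rw [hk] at e2
  -- Passing to the other cell of the pair replaces the index `k` by `3 - k`, so that one of the two
  -- indices is at most `1`.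
  have hk2 : ∀ k : Fin 4, (∃ m : Fin 2, m.castLE (by norm_num) = k) ∨
    ∃ m : Fin 2, m.castLE (by norm_num) = k.rev := by decide
  rcases hk2 k with ⟨m, hm⟩ | ⟨m, hm⟩
  · obtain ⟨b, hb, j, hj⟩ := red a ha n
    exact ⟨b, hb, m, j, Or.inl ⟨by rw [mul_assoc, hj], by rw [← e2, hm, mul_assoc, hj]⟩⟩
  · obtain ⟨b, hb, j, hj⟩ := red _ (ha.mul (isUnitIcosian_cellCoeff k)) ((k : ℕ) + 1 + n)
    refine ⟨b, hb, m, j, Or.inr ⟨?_, ?_⟩⟩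
    · rw [← hj, ← e2, cellNeighbor_eq, pow_add _ ((k : ℕ) + 1)]; simp only [mul_assoc]
    · rw [hm, ← hj, mul_assoc, ← cellCoeff_mul_cellNeighbor_rev k n]; simp only [mul_assoc]

/-- The cell balls and cell handles cover the lower handlebody. -/
theorem exists_mem_cellBall_or_cellHandle (x : UnitQuaternion) (h : height x ≤ level) :
    ∃ γ, IsCell γ ∧ (x ∈ cellBall γ ∨
      ∃ γ', IsCell γ' ∧ γ ≠ γ' ∧ 1.81 < ⟪γ, γ'⟫_ℝ ∧ x ∈ cellHandle γ γ') := by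
  obtain ⟨γ, hγ, hmax⟩ := Finset.exists_max_image IsCell.finite.toFinset
    (fun v => ⟪(x : ℍ[ℝ]), v⟫_ℝ) ⟨cellCenter, by simpa using isCell_cellCenter⟩
  replace hγ : IsCell γ := by simpa using hγ
  have hmax' : ∀ η, IsCell η → ⟪(x : ℍ[ℝ]), η⟫_ℝ ≤ ⟪(x : ℍ[ℝ]), γ⟫_ℝ := fun u hu =>
    hmax u (by simpa using hu)
  have hlarge := hγ.le_inner h hmax'
  refine ⟨γ, hγ, ?_⟩
  by_cases hw : ∃ η, IsCell η ∧ η ≠ γ ∧ 1999 / 2001 * ⟪(x : ℍ[ℝ]), γ⟫_ℝ < ⟪(x : ℍ[ℝ]), η⟫_ℝ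
  · obtain ⟨η, hη, hne, hlt⟩ := hw
    have hle := hmax' η hη
    -- `1.4009 + 0.999 * 1.4009 > 2.8`.
    have h28 : 2.8 ≤ ⟪(x : ℍ[ℝ]), γ + η⟫_ℝ := by rw [inner_add_right]; linarith
    refine Or.inr ⟨η, hη, hne.symm, ?_, h28, ?_, h⟩
    · have h1 := real_inner_le_norm (x : ℍ[ℝ]) (γ + η)
      rw [norm_eq_of_mem_sphere, one_mul] at h1
      have h2 := norm_add_sq_real γ η
      rw [hγ.norm_sq, hη.norm_sq] at h2
      nlinarith
    · rw [inner_add_right, inner_sub_right, abs_of_nonneg (by linarith)]; linarith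
  · push Not at hw
    exact Or.inl ⟨by linarith, h, hw⟩

theorem cellNeighbor_mul_inner (k : Fin 4) (n : ℕ) :
    ⟪cellCenter * zetaH ^ n, cellNeighbor k * zetaH ^ n⟫_ℝ = (3 * φ - 1) / 2 := by
  rw [inner_mul_mul_right (isUnitIcosian_zetaH.pow n).norm, IsCell.cellNeighbor_inner]

/-- The decomposition of the lower handlebody around the dual 1-skeleton of the 600-cell. -/
def lowerSystem : HandleSystem {x | height (x : ℍ[ℝ]) ≤ level} (Fin 5) (Fin 2 × Fin 5) where
  IsNode := IsCell
  ball := cellBall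
  handle := cellHandle
  node j := cellCenter * zetaH ^ (j : ℕ)
  source z := cellCenter * zetaH ^ (z.2 : ℕ)
  target z := cellNeighbor (z.1.castLE (by norm_num)) * zetaH ^ (z.2 : ℕ)
  isNode_node j := isCell_cellCenter.mul_zetaH_pow _
  isNode_source z := isCell_cellCenter.mul_zetaH_pow _
  isNode_target z := (isCell_cellNeighbor _).mul_zetaH_pow _
  source_ne_target z h := by
    have h1 := cellNeighbor_mul_inner (z.1.castLE (by norm_num)) z.2
    rw [← h, (isCell_cellCenter.mul_zetaH_pow _).inner_self] at h1
    linarith [goldenRatio_bounds.2]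
  isNode_mul a ha γ hγ := hγ.mul_left (isUnitIcosian_coe.2 ha)
  exists_node γ hγ := by
    obtain ⟨_, ⟨a, ha, rfl⟩, j, rfl⟩ := hγ.exists_fin
    exact ⟨a, ha, j, rfl⟩
  node_unique a ha i i' h := by
    rw [← mul_assoc] at h
    have h' : (a : ℍ[ℝ]) * cellCenter * zetaH ^ (i : ℕ) = 1 * cellCenter * zetaH ^ (i' : ℕ) := by
      rw [h, one_mul]
    have h1 := IsCell.mod_five_eq (isUnitIcosian_coe.2 ha) .one h'
    have h2 : i = i' := by omega
    subst h2
    exact ⟨Subtype.ext (IsCell.coeff_eq h'), rfl⟩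
  edge_unique a ha z z' h := by
    obtain ⟨k, j⟩ := z
    obtain ⟨k', j'⟩ := z'
    have ha' := isUnitIcosian_coe.2 ha
    rcases h with ⟨h1, h2⟩ | ⟨h1, h2⟩
    · have h' : (a : ℍ[ℝ]) * cellCenter * zetaH ^ (j : ℕ) = 1 * cellCenter * zetaH ^ (j' : ℕ) := by
        rw [one_mul, mul_assoc]; exact h1
      have h3 := IsCell.mod_five_eq ha' .one h'
      have h4 : j = j' := by omega
      subst h4
      have h5 := IsCell.coeff_eq h'
      refine ⟨Subtype.ext h5, Prod.ext ?_ rfl⟩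
      simp only [h5, one_mul] at h2
      have h6 := Icosian.cellNbr_injective _ _ (Icosian.toH_injective
        (mul_right_cancel₀ (zetaH_pow_ne_zero _) h2))
      exact Fin.castLE_injective _ h6
    -- The exponents modulo `5` would satisfy `k + k' + 2 ≡ 0` with `k, k' ≤ 1`.
    · exfalso
      simp only [cellNeighbor_eq] at h1 h2
      have h3 := IsCell.mod_five_eq ha' (isUnitIcosian_cellCoeff (k'.castLE (by norm_num)))
        (m := j) (n := k' + 1 + j')
        (by rw [mul_assoc, h1, pow_add _ ((k' : ℕ) + 1)]; simp only [mul_assoc, Fin.val_castLE])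
      have h4 := IsCell.mod_five_eq (ha'.mul (isUnitIcosian_cellCoeff (k.castLE (by norm_num))))
        .one (m := k + 1 + j) (n := j')
        (by rw [one_mul, ← h2, pow_add _ ((k : ℕ) + 1)]; simp only [mul_assoc, Fin.val_castLE])
      omega
  ball_mul a ha γ x hx := by
    refine ⟨by rw [coe_mul_inner]; exact hx.1, (height_coe_mul ha x).trans_le hx.2.1,
      fun w hw hne => ?_⟩
    rw [coe_mul_inner, coe_mul_inner_left]
    exact hx.2.2 _ (hw.mul_left (isUnitIcosian_coe.2 ha).star) fun h => hne (by
      rw [← h, mul_star_cancel])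
  handle_mul a ha γ γ' x hx := by
    refine ⟨?_, ?_, ?_⟩
    · rw [← mul_add, coe_mul_inner]; exact hx.1
    · rw [← mul_add, ← mul_sub, coe_mul_inner, coe_mul_inner]; exact hx.2.1
    · exact (height_coe_mul ha x).trans_le hx.2.2
  ball_chart j := (isCell_cellCenter.mul_zetaH_pow _).exists_ball_chart
  handle_chart z := exists_cellHandle_chart (isCell_cellCenter.mul_zetaH_pow _)
    ((isCell_cellNeighbor _).mul_zetaH_pow _) (cellNeighbor_mul_inner _ _)
  ball_pos γ x hx := hx.1
  ball_le γ x hx := hx.2.2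
  handle_pos γ γ' x hx := ⟨by linarith [hx.1], hx.2.1⟩
  handle_lt γ γ' hγ hγ' hne x hx η hη h1 h2 := ⟨cellHandle_lt hγ hγ' hne hx hη h1 h2,
    cellHandle_lt hγ' hγ hne.symm (cellHandle_comm γ γ' ▸ hx) hη h2 h1⟩
  handle_end γ γ' hγ hγ' hne x hx := ⟨cellHandle_end hγ hγ' hne hx,
    cellHandle_end hγ' hγ hne.symm (cellHandle_comm γ γ' ▸ hx)⟩
  mem_iff x := by
    constructor
    · intro hx
      obtain ⟨γ, hγ, h | ⟨γ', hγ', hne, hin, h⟩⟩ := exists_mem_cellBall_or_cellHandle x hx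
      · exact Or.inl ⟨γ, hγ, h⟩
      · right
        obtain ⟨_, ⟨a, ha, rfl⟩, k, j, ⟨rfl, rfl⟩ | ⟨rfl, rfl⟩⟩ := exists_edge_rep hγ hγ' hne hin
        · exact ⟨a, ha, (k, j), h⟩
        · exact ⟨a, ha, (k, j), cellHandle_comm _ _ ▸ h⟩
    · rintro (⟨v, hv, h⟩ | ⟨a, ha, j, h⟩)
      · exact h.2.1
      · exact h.2.2

/-- The sublevel set has `5` balls and `10` handles in the quotient: the `600` cells and the `1200`
triangles of the 600-cell form five and ten orbits. -/
theorem isHandlebody_lower {M : Type*} [TopologicalSpace M] {p : UnitQuaternion → M}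
    (hp : Continuous p)
    (hfib : ∀ x y, p x = p y ↔ ∃ b ∈ binaryIcosahedralGroup, y = b * x) :
    IsHandlebody (p '' {x | height (x : ℍ[ℝ]) ≤ level}) 6 := by
  let f : Fin 10 ≃ Fin 2 × Fin 5 := (finProdFinEquiv (m := 2) (n := 5)).symm
  obtain ⟨E, h1, h2⟩ := lowerSystem.exists_handleDecomposition hp hfib (Equiv.refl _) f
  -- The `k`-th neighbour of a cell in the `j`-th orbit belongs to the orbit with the number
  -- `j + k + 1` modulo `5`.
  let tgt : Fin 2 × Fin 5 → Fin 5 := fun z => ⟨((z.1 : ℕ) + 1 + z.2) % 5, Nat.mod_lt _ (by norm_num)⟩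
  have ht : ∀ z, p '' cellBall (lowerSystem.target z) =
      p '' cellBall (cellCenter * zetaH ^ (tgt z : ℕ)) := by
    rintro ⟨k, j⟩
    have e : ∃ a ∈ binaryIcosahedralGroup,
        lowerSystem.target (k, j) = a * (cellCenter * zetaH ^ (tgt (k, j) : ℕ)) := by
      obtain ⟨c, hc, hc'⟩ := isUnitIcosian_cellCoeff (k.castLE (by norm_num))
      have e1 : lowerSystem.target (k, j) = c * cellCenter * zetaH ^ ((k : ℕ) + 1 + j) := by
        show cellNeighbor _ * _ = _
        rw [cellNeighbor_eq, hc', pow_add _ ((k : ℕ) + 1), mul_assoc, mul_assoc, mul_assoc]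
        rfl
      rcases zetaH_pow_eq ((k : ℕ) + 1 + j) with h | h
      · exact ⟨c, hc, by rw [e1, h, mul_assoc]⟩
      · obtain ⟨d, hd, hd'⟩ := (isUnitIcosian_coe.2 hc).neg
        exact ⟨d, hd, by rw [e1, h, hd', mul_assoc]; simp [tgt]⟩
    obtain ⟨a, ha, e⟩ := e
    rw [e]
    exact lowerSystem.image_ball_mul hfib ha _
  refine ⟨E.isConnected 0 (fun j => (f j).2) (fun j => tgt (f j)) (fun j => ?_) (fun j => ?_)
    fun i => ?_, 5, 10, rfl, ⟨E⟩⟩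
  · rw [h1]; exact (h2 j).2.1
  · have := (h2 j).2.2
    rw [h1]
    change (p '' cellBall _ ∩ _).Nonempty at this
    rwa [ht] at this
  -- The handles with `k = 0` join consecutive orbits.
  · induction i using Fin.induction with
    | zero => exact .refl
    | succ i ih =>
      refine ih.tail ⟨f.symm (0, i.castSucc), ?_, ?_⟩
      · rw [f.apply_symm_apply]
      · rw [f.apply_symm_apply]
        apply Fin.ext
        simp only [tgt, Fin.val_succ, Fin.val_castSucc, Fin.val_zero]
        omega

/-! ### Central projection -/

/-- The imaginary quaternion with the coordinates `w`. -/
def imag : E3 →L[ℝ] ℍ[ℝ] := LinearMap.toContinuousLinearMap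
  { toFun := fun w => ⟨0, w 0, w 1, w 2⟩
    map_add' := fun x y => by
      apply Quaternion.ext
      · show (0 : ℝ) = 0 + 0
        rw [add_zero]
      all_goals rfl
    map_smul' := fun r x => by
      apply Quaternion.ext
      · show (0 : ℝ) = r * 0
        rw [mul_zero]
      all_goals rfl }

theorem re_imag (w : E3) : (imag w).re = 0 := rfl
theorem imI_imag (w : E3) : (imag w).imI = w 0 := rfl
theorem imJ_imag (w : E3) : (imag w).imJ = w 1 := rfl
theorem imK_imag (w : E3) : (imag w).imK = w 2 := rfl

/-- The coordinates of the imaginary part of a quaternion. -/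
def imPart : ℍ[ℝ] →L[ℝ] E3 := LinearMap.toContinuousLinearMap
  { toFun := fun y => !₂[y.imI, y.imJ, y.imK]
    map_add' := fun x y => by ext i; fin_cases i <;> simp
    map_smul' := fun r x => by ext i; fin_cases i <;> simp }

theorem imPart_zero (y : ℍ[ℝ]) : imPart y 0 = y.imI := rfl
theorem imPart_one (y : ℍ[ℝ]) : imPart y 1 = y.imJ := rfl
theorem imPart_two (y : ℍ[ℝ]) : imPart y 2 = y.imK := rfl

/-- The real part of a quaternion, as a continuous linear map. -/
def rePart : ℍ[ℝ] →L[ℝ] ℝ := LinearMap.toContinuousLinearMap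
  { toFun := fun y => y.re
    map_add' := fun x y => by simp
    map_smul' := fun r x => by simp }

theorem imPart_imag (w : E3) : imPart (imag w) = w := by
  ext i; fin_cases i <;> rfl

theorem one_add_imag_re (w : E3) : (1 + imag w).re = 1 := by
  rw [Quaternion.re_add, re_imag, Quaternion.re_one, add_zero]

theorem imPart_one_add_imag (w : E3) : imPart (1 + imag w) = w := by
  have h : imPart 1 = 0 := by ext i; fin_cases i <;> rfl
  rw [map_add, imPart_imag, h, zero_add]

theorem one_add_imag_ne_zero (w : E3) : 1 + imag w ≠ 0 := fun h => by
  have := one_add_imag_re w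
  rw [h] at this
  simp at this

theorem norm_one_add_imag_sq (w : E3) : ‖1 + imag w‖ ^ 2 = 1 + ‖w‖ ^ 2 := by
  rw [← real_inner_self_eq_norm_sq, quaternion_inner_eq, EuclideanSpace.norm_sq_eq,
    Fin.sum_univ_three]
  simp [re_imag, imI_imag, imJ_imag, imK_imag]
  ring

/-- Central projection of the tangent space at `1` to the 3-sphere. -/
def gnomonic (w : E3) : UnitQuaternion := nrm (1 + imag w)

theorem coe_gnomonic (w : E3) : (gnomonic w : ℍ[ℝ]) = ‖1 + imag w‖⁻¹ • (1 + imag w) :=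
  coe_nrm (one_add_imag_ne_zero w)

theorem gnomonic_re (w : E3) : (gnomonic w : ℍ[ℝ]).re = ‖1 + imag w‖⁻¹ := by
  rw [coe_gnomonic, Quaternion.re_smul, one_add_imag_re, smul_eq_mul, mul_one]

theorem contDiff_gnomonic : ContDiff ℝ ∞ fun w => (gnomonic w : ℍ[ℝ]) := by
  simp only [coe_gnomonic]
  have h : ContDiff ℝ ∞ fun w : E3 => 1 + imag w := contDiff_const.add imag.contDiff
  exact ((h.norm ℝ one_add_imag_ne_zero).inv fun w =>
    norm_ne_zero_iff.2 (one_add_imag_ne_zero w)).smul h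

theorem continuous_gnomonic : Continuous gnomonic :=
  continuous_induced_rng.2 contDiff_gnomonic.continuous

/-- Central projection of a half-space to the tangent space at `1` of the 3-sphere. -/
def proj (y : ℍ[ℝ]) : E3 := y.re⁻¹ • imPart y

theorem proj_smul {r : ℝ} (hr : r ≠ 0) (y : ℍ[ℝ]) : proj (r • y) = proj y := by
  rw [proj, proj, map_smul, smul_smul, Quaternion.re_smul, smul_eq_mul, mul_inv_rev, mul_assoc,
    inv_mul_cancel₀ hr, mul_one]

theorem proj_one_add_imag (w : E3) : proj (1 + imag w) = w := by
  rw [proj, one_add_imag_re, imPart_one_add_imag, inv_one, one_smul]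

theorem proj_gnomonic (w : E3) : proj (gnomonic w) = w := by
  rw [coe_gnomonic, proj_smul (inv_ne_zero (norm_ne_zero_iff.2 (one_add_imag_ne_zero w))),
    proj_one_add_imag]

theorem gnomonic_proj {x : UnitQuaternion} (h : 0 < (x : ℍ[ℝ]).re) : gnomonic (proj x) = x := by
  have e : 1 + imag (proj x) = (x : ℍ[ℝ]).re⁻¹ • (x : ℍ[ℝ]) := by
    rw [proj, map_smul]
    apply Quaternion.ext <;>
      simp [re_imag, imI_imag, imJ_imag, imK_imag, imPart_zero, imPart_one, imPart_two, h.ne']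
  rw [gnomonic, e, nrm_smul (ne_zero_of_mem_unit_sphere x) (inv_pos.2 h), nrm_coe]

theorem contDiffAt_proj {y : ℍ[ℝ]} (h : y.re ≠ 0) : ContDiffAt ℝ ∞ proj y :=
  ContDiffAt.smul (ContDiffAt.inv rePart.contDiff.contDiffAt h) imPart.contDiff.contDiffAt

theorem continuousAt_proj {y : ℍ[ℝ]} (h : y.re ≠ 0) : ContinuousAt proj y :=
  (contDiffAt_proj h).continuousAt

theorem proj_mul_gnomonic_mul (u q : ℍ[ℝ]) (w : E3) :
    proj (u * gnomonic w * q) = proj (u * (1 + imag w) * q) := by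
  rw [coe_gnomonic, mul_smul_comm, smul_mul_assoc,
    proj_smul (inv_ne_zero (norm_ne_zero_iff.2 (one_add_imag_ne_zero w)))]

/-! ### Determinants -/

/-- Unit quaternions have square roots: the one of `u ≠ -1` is the midpoint `(1 + u) / ‖1 + u‖` of
the arc from `1` to `u`. -/
theorem exists_mul_self_eq {u : ℍ[ℝ]} (hu : ‖u‖ = 1) : ∃ v, v * v = u := by
  have h1 : u.re * u.re + u.imI * u.imI + u.imJ * u.imJ + u.imK * u.imK = 1 := by
    rw [← quaternion_inner_eq, real_inner_self_eq_norm_sq, hu, one_pow]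
  by_cases h : u.re = -1
  · refine ⟨imag (EuclideanSpace.single 0 1), ?_⟩
    rw [h] at h1
    have e1 : u.imI = 0 := by nlinarith [sq_nonneg u.imI, sq_nonneg u.imJ, sq_nonneg u.imK]
    have e2 : u.imJ = 0 := by nlinarith [sq_nonneg u.imI, sq_nonneg u.imJ, sq_nonneg u.imK]
    have e3 : u.imK = 0 := by nlinarith [sq_nonneg u.imI, sq_nonneg u.imJ, sq_nonneg u.imK]
    apply Quaternion.ext <;> simp [h, e1, e2, e3, re_imag, imI_imag, imJ_imag, imK_imag]
  · have hpos : 0 < 2 + 2 * u.re := by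
      have : -1 ≤ u.re := by
        nlinarith [sq_nonneg u.imI, sq_nonneg u.imJ, sq_nonneg u.imK, sq_nonneg (u.re - 1)]
      have := lt_of_le_of_ne this (Ne.symm h)
      linarith
    have e : (1 + u) * (1 + u) = (2 + 2 * u.re) • u := by
      apply Quaternion.ext <;> simp <;> first | ring1 | linear_combination -h1
    refine ⟨(√(2 + 2 * u.re))⁻¹ • (1 + u), ?_⟩
    rw [smul_mul_assoc, mul_smul_comm, smul_smul, e, smul_smul, ← mul_inv, Real.mul_self_sqrt hpos.le,
      inv_mul_cancel₀ hpos.ne', one_smul]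

/-- Left multiplication by a unit quaternion has positive determinant, since it is the square of
a linear automorphism. -/
theorem det_mulLeft_pos {u : ℍ[ℝ]} (hu : ‖u‖ = 1) : 0 < LinearMap.det (LinearMap.mulLeft ℝ u) := by
  have hne : LinearMap.det (LinearMap.mulLeft ℝ u) ≠ 0 := by
    intro h
    have h1 : LinearMap.mulLeft ℝ u * LinearMap.mulLeft ℝ (star u) = 1 := by
      rw [Module.End.mul_eq_comp, ← LinearMap.mulLeft_mul, quaternion_self_mul_star hu]
      exact LinearMap.mulLeft_one _ _
    have h2 := congrArg LinearMap.det h1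
    rw [map_mul, h, zero_mul, map_one] at h2
    exact zero_ne_one h2
  obtain ⟨v, rfl⟩ := exists_mul_self_eq hu
  rw [LinearMap.mulLeft_mul, ← Module.End.mul_eq_comp, map_mul] at hne ⊢
  exact (mul_self_nonneg _).lt_of_ne' hne

theorem det_mulRight_pos {u : ℍ[ℝ]} (hu : ‖u‖ = 1) :
    0 < LinearMap.det (LinearMap.mulRight ℝ u) := by
  have hne : LinearMap.det (LinearMap.mulRight ℝ u) ≠ 0 := by
    intro h
    have h1 : LinearMap.mulRight ℝ u * LinearMap.mulRight ℝ (star u) = 1 := by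
      rw [Module.End.mul_eq_comp, ← LinearMap.mulRight_mul, quaternion_star_mul_self hu]
      exact LinearMap.mulRight_one _ _
    have h2 := congrArg LinearMap.det h1
    rw [map_mul, h, zero_mul, map_one] at h2
    exact zero_ne_one h2
  obtain ⟨v, rfl⟩ := exists_mul_self_eq hu
  rw [LinearMap.mulRight_mul, ← Module.End.mul_eq_comp, map_mul] at hne ⊢
  exact (mul_self_nonneg _).lt_of_ne' hne

/-- The Jacobian determinant of a projective transformation. -/
theorem det_projective (c₀ c₁ c₂ c₃ z : Fin 4 → ℝ) (w : Fin 3 → ℝ)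
    (hz : z = c₀ + w 0 • c₁ + w 1 • c₂ + w 2 • c₃) :
    (Matrix.of fun i j : Fin 3 => z 0 * ![c₁, c₂, c₃] j i.succ - ![c₁, c₂, c₃] j 0 * z i.succ).det =
      z 0 ^ 2 * (Matrix.of fun i j : Fin 4 => ![c₀, c₁, c₂, c₃] j i).det := by
  have h : (Matrix.of fun i j : Fin 4 => ![c₀, c₁, c₂, c₃] j i).det =
      (Matrix.of fun i j : Fin 4 => ![z, c₁, c₂, c₃] j i).det := by
    rw [hz]
    simp [Matrix.det_succ_row_zero, Fin.sum_univ_succ, Fin.succAbove]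
    ring
  rw [h]
  clear hz h
  simp [Matrix.det_succ_row_zero, Fin.sum_univ_succ, Fin.succAbove]
  ring

/-- The four real coordinates of a quaternion. -/
def quatCoord (y : ℍ[ℝ]) : Fin 4 → ℝ := ![y.re, y.imI, y.imJ, y.imK]

/-- The basis `1, i, j, k` of the quaternions. -/
def quatBasis : Module.Basis (Fin 4) ℝ ℍ[ℝ] := QuaternionAlgebra.basisOneIJK (-1 : ℝ) 0 (-1)

theorem quatBasis_repr (y : ℍ[ℝ]) (i : Fin 4) : quatBasis.repr y i = quatCoord y i := rfl

theorem quatBasis_apply (j : Fin 4) : quatBasis j =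
    ![(1 : ℍ[ℝ]), imag (EuclideanSpace.single 0 1), imag (EuclideanSpace.single 1 1),
      imag (EuclideanSpace.single 2 1)] j := by
  refine quatBasis.repr.injective (Finsupp.ext fun i => ?_)
  rw [Module.Basis.repr_self, Finsupp.single_apply, quatBasis_repr]
  fin_cases j <;> fin_cases i <;> simp [quatCoord, re_imag, imI_imag, imJ_imag, imK_imag]

/-- The determinant of an endomorphism of the quaternions, in coordinates. -/
theorem det_eq_quatCoord (L : ℍ[ℝ] →ₗ[ℝ] ℍ[ℝ]) : LinearMap.det L =
    (Matrix.of fun i j : Fin 4 => ![quatCoord (L 1),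
      quatCoord (L (imag (EuclideanSpace.single 0 1))),
      quatCoord (L (imag (EuclideanSpace.single 1 1))),
      quatCoord (L (imag (EuclideanSpace.single 2 1)))] j i).det := by
  rw [← LinearMap.det_toMatrix quatBasis]
  congr 1
  ext i j
  rw [LinearMap.toMatrix_apply, quatBasis_apply, quatBasis_repr]
  fin_cases j <;> rfl

/-- In the affine coordinates given by central projection, the rotation `x ↦ u x q` is a projective
transformation. Its Jacobian determinant is that of the rotation, divided by the fourth power of the
denominator, hence positive. -/
theorem det_fderiv_proj_pos {u q : ℍ[ℝ]} (hu : ‖u‖ = 1) (hq : ‖q‖ = 1) {w : E3}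
    (h : 0 < (u * (1 + imag w) * q).re) :
    0 < (fderiv ℝ (fun w => proj (u * (1 + imag w) * q)) w).det := by
  set L : ℍ[ℝ] →ₗ[ℝ] ℍ[ℝ] := LinearMap.mulRight ℝ q * LinearMap.mulLeft ℝ u with hL
  have hLdet : 0 < LinearMap.det L := by
    rw [hL, map_mul]; exact mul_pos (det_mulRight_pos hq) (det_mulLeft_pos hu)
  have hLa : ∀ y, L y = u * y * q := fun y => rfl
  simp only [← hLa] at h ⊢
  set Lc : ℍ[ℝ] →L[ℝ] ℍ[ℝ] := LinearMap.toContinuousLinearMap L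
  set z := L (1 + imag w) with hz
  have hd : HasFDerivAt (fun w => L (1 + imag w)) (Lc ∘L imag) w :=
    Lc.hasFDerivAt.comp w (imag.hasFDerivAt.const_add 1)
  have hD := ((hasFDerivAt_inv h.ne').comp w (rePart.hasFDerivAt.comp w hd)).smul
    (imPart.hasFDerivAt.comp w hd)
  have hD' : HasFDerivAt (fun w => proj (L (1 + imag w))) _ w := hD
  rw [hD'.fderiv]
  show 0 < LinearMap.det _
  rw [← LinearMap.det_toMatrix (EuclideanSpace.basisFun (Fin 3) ℝ).toBasis]
  have hwz : w = w 0 • EuclideanSpace.single 0 (1 : ℝ) + w 1 • EuclideanSpace.single 1 (1 : ℝ) +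
      w 2 • EuclideanSpace.single 2 (1 : ℝ) := by
    ext i; fin_cases i <;> simp
  have hz2 : z = L 1 + w 0 • L (imag (EuclideanSpace.single 0 1)) +
      w 1 • L (imag (EuclideanSpace.single 1 1)) + w 2 • L (imag (EuclideanSpace.single 2 1)) := by
    rw [hz, map_add]
    conv_lhs => rw [hwz]
    simp only [map_add, map_smul, add_assoc]
  -- The derivative of the quotient of two affine functions has the entries of the matrix in
  -- `det_projective`, divided by the square of the denominator.
  have e := det_projective (quatCoord (L 1)) (quatCoord (L (imag (EuclideanSpace.single 0 1))))
      (quatCoord (L (imag (EuclideanSpace.single 1 1))))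
      (quatCoord (L (imag (EuclideanSpace.single 2 1)))) (quatCoord z) w (by
    rw [hz2]
    ext i
    fin_cases i <;> simp [quatCoord])
  rw [← det_eq_quatCoord] at e
  have e2 : ∀ A B : Matrix (Fin 3) (Fin 3) ℝ, (∀ i j, A i j = (z.re⁻¹) ^ 2 * B i j) → 0 < B.det →
      0 < A.det := by
    intro A B hAB hB
    have : A = (z.re⁻¹) ^ 2 • B := by ext i j; rw [hAB]; rfl
    rw [this, Matrix.det_smul]
    positivity
  refine e2 _ _ ?_ (e.symm ▸ mul_pos (pow_pos h 2) hLdet)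
  intro i j
  have hc : ∀ j : Fin 3, ![quatCoord (L (imag (EuclideanSpace.single 0 1))),
      quatCoord (L (imag (EuclideanSpace.single 1 1))),
      quatCoord (L (imag (EuclideanSpace.single 2 1)))] j =
      quatCoord (L (imag (EuclideanSpace.single j 1))) := fun j => by fin_cases j <;> rfl
  have hi : ∀ (y : ℍ[ℝ]) (i : Fin 3), imPart y i = quatCoord y i.succ := fun y i => by
    fin_cases i <;> rfl
  rw [LinearMap.toMatrix_apply, Matrix.of_apply, hc, OrthonormalBasis.coe_toBasis,
    EuclideanSpace.basisFun_apply, OrthonormalBasis.coe_toBasis_repr_apply,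
    EuclideanSpace.basisFun_repr, ← hi, ← hi]
  set y := L (imag (EuclideanSpace.single j 1))
  change z.re⁻¹ * imPart y i + (y.re * -(z.re ^ 2)⁻¹) * imPart z i =
    z.re⁻¹ ^ 2 * (z.re * imPart y i - y.re * imPart z i)
  have h' := h.ne'
  field_simp
  ring

/-! ### The smooth structure on the quotient -/

/-- The map `p` presents the topological space `M` as the quotient of the unit quaternions by left
multiplication with the binary icosahedral group. -/
structure IsIcosahedralQuotient {M : Type*} [TopologicalSpace M] (p : UnitQuaternion → M) :
    Prop where
  continuous : Continuous p
  isOpenMap : IsOpenMap p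
  surjective : Function.Surjective p
  fibres : ∀ x y, p x = p y ↔ ∃ b ∈ binaryIcosahedralGroup, y = b * x

theorem isOpenMap_gnomonic : IsOpenMap gnomonic := by
  intro U hU
  have : gnomonic '' U = {x : UnitQuaternion | 0 < (x : ℍ[ℝ]).re ∧ proj x ∈ U} := by
    ext x
    constructor
    · rintro ⟨w, hw, rfl⟩
      refine ⟨?_, by rwa [proj_gnomonic]⟩
      rw [gnomonic_re]
      exact inv_pos.2 (norm_pos_iff.2 (one_add_imag_ne_zero w))
    · rintro ⟨h1, h2⟩
      exact ⟨_, h2, gnomonic_proj h1⟩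
  rw [this, isOpen_iff_mem_nhds]
  rintro x ⟨h1, h2⟩
  have h3 : ContinuousAt (fun x : UnitQuaternion => (x : ℍ[ℝ]).re) x :=
    (rePart.continuous.comp continuous_subtype_val).continuousAt
  have h4 : ContinuousAt (fun x : UnitQuaternion => proj x) x :=
    (continuousAt_proj h1.ne').comp continuous_subtype_val.continuousAt
  filter_upwards [h3.eventually (lt_mem_nhds h1), h4.eventually (hU.mem_nhds h2)] with y h5 h6
  exact ⟨h5, h6⟩

theorem gnomonic_zero : gnomonic 0 = 1 := by
  rw [gnomonic, map_zero, add_zero]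
  exact nrm_coe 1

theorem gnomonic_re_pos (w : E3) : 0 < (gnomonic w : ℍ[ℝ]).re := by
  rw [gnomonic_re]; exact inv_pos.2 (norm_pos_iff.2 (one_add_imag_ne_zero w))

/-- The ball of radius `1 / 4` in the tangent space is mapped to a cap of angular radius less than
`π / 10`, half of the least distance between points of an orbit of the binary icosahedral group. -/
theorem gnomonic_re_gt {w : E3} (hw : w ∈ Metric.ball (0 : E3) (1 / 4)) :
    0.97 < (gnomonic w : ℍ[ℝ]).re := by
  rw [gnomonic_re]
  rw [mem_ball_zero_iff] at hw
  have h1 := norm_one_add_imag_sq w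
  have h2 : 0 < ‖1 + imag w‖ := norm_pos_iff.2 (one_add_imag_ne_zero w)
  have h3 : ‖1 + imag w‖ < 1.0308 := by nlinarith [norm_nonneg w]
  rw [lt_inv_comm₀ (by norm_num) h2]
  refine h3.trans ?_
  norm_num

namespace IsIcosahedralQuotient

variable {M : Type*} [TopologicalSpace M] {p : UnitQuaternion → M}

theorem map_mul (hp : IsIcosahedralQuotient p) {b : UnitQuaternion}
    (hb : b ∈ binaryIcosahedralGroup) (x : UnitQuaternion) : p (b * x) = p x :=
  ((hp.fibres x (b * x)).2 ⟨b, hb, rfl⟩).symm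

/-- The quotient map is injective on the cap around `x₀`, since an orbit of the binary icosahedral
group has at most one point in it. -/
theorem injOn (hp : IsIcosahedralQuotient p) (x₀ : UnitQuaternion) :
    Set.InjOn (fun w => p (x₀ * gnomonic w)) (Metric.ball (0 : E3) (1 / 4)) := by
  intro w hw w' hw' h
  obtain ⟨b, hb, h⟩ := (hp.fibres _ _).1 h
  have hb1 : b = 1 := by
    by_contra hne
    have hb' := isUnitIcosian_coe.2 hb
    have h1 : ⟪((x₀ * gnomonic w' : UnitQuaternion) : ℍ[ℝ]), x₀⟫_ℝ = (gnomonic w' : ℍ[ℝ]).re := by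
      have := coe_mul_inner x₀ (gnomonic w') 1
      rwa [mul_one, real_inner_comm 1 (gnomonic w' : ℍ[ℝ]), inner_one_left] at this
    have h2 : ⟪((x₀ * gnomonic w' : UnitQuaternion) : ℍ[ℝ]), b * x₀⟫_ℝ =
        (gnomonic w : ℍ[ℝ]).re := by
      have := coe_mul_inner (b * x₀) (gnomonic w) 1
      rwa [mul_one, real_inner_comm 1 (gnomonic w : ℍ[ℝ]), inner_one_left, mul_assoc, ← h] at this
    have h3 : ⟪(x₀ : ℍ[ℝ]), b * x₀⟫_ℝ ≤ φ / 2 := by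
      have := inner_mul_mul_right (norm_eq_of_mem_sphere x₀) 1 (b : ℍ[ℝ])
      rw [one_mul, inner_one_left] at this
      rw [this]
      exact hb'.re_le fun h => hne (Subtype.ext h)
    -- A point of both caps, around `x₀` and `b x₀`, would have inner product more than `1.94` with
    -- `x₀ + b x₀`, a vector of length at most `√(2 + φ) ≈ 1.902`.
    have h4 := real_inner_le_norm ((x₀ * gnomonic w' : UnitQuaternion) : ℍ[ℝ]) (x₀ + b * x₀)
    rw [norm_eq_of_mem_sphere, one_mul, inner_add_right, h1, h2] at h4
    have h5 := norm_add_sq_real (x₀ : ℍ[ℝ]) (b * x₀)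
    rw [norm_mul, norm_eq_of_mem_sphere, norm_eq_of_mem_sphere] at h5
    have h6 := gnomonic_re_gt hw
    have h7 := gnomonic_re_gt hw'
    nlinarith [goldenRatio_bounds.2]
  rw [hb1, one_mul] at h
  rw [← proj_gnomonic w, ← proj_gnomonic w', mul_left_cancel h]

/-- The chart of the quotient around the image of `x₀` that is given by central projection. -/
def chart (hp : IsIcosahedralQuotient p) (x₀ : UnitQuaternion) : OpenPartialHomeomorph M E3 :=
  (OpenPartialHomeomorph.ofContinuousOpen ((hp.injOn x₀).toPartialEquiv _ _)
    ((hp.continuous.comp (continuous_const.mul continuous_gnomonic)).continuousOn)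
    (hp.isOpenMap.comp ((Homeomorph.mulLeft x₀).isOpenMap.comp isOpenMap_gnomonic))
    Metric.isOpen_ball).symm

theorem chart_symm_apply (hp : IsIcosahedralQuotient p) (x₀ : UnitQuaternion) (w : E3) :
    (hp.chart x₀).symm w = p (x₀ * gnomonic w) := rfl

theorem mem_chart_source (hp : IsIcosahedralQuotient p) (x₀ : UnitQuaternion) :
    p x₀ ∈ (hp.chart x₀).source :=
  ⟨0, Metric.mem_ball_self (by norm_num), by simp only [gnomonic_zero, mul_one]⟩

theorem chart_apply (hp : IsIcosahedralQuotient p) (x₀ : UnitQuaternion) {w : E3}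
    (hw : w ∈ Metric.ball (0 : E3) (1 / 4)) : hp.chart x₀ (p (x₀ * gnomonic w)) = w :=
  (hp.chart x₀).right_inv hw

/-- In the charts, the maps induced by right multiplications are projective transformations. -/
theorem chart_comp_eventuallyEq (hp : IsIcosahedralQuotient p) {f : M → M} {q : UnitQuaternion}
    (hf : ∀ x, f (p x) = p (x * q)) (x₀ x₁ : UnitQuaternion) {w₀ : E3}
    (h : f (p (x₀ * gnomonic w₀)) ∈ (hp.chart x₁).source) :
    ∃ u : UnitQuaternion, 0 < ((u : ℍ[ℝ]) * (1 + imag w₀) * q).re ∧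
      (fun w => hp.chart x₁ (f ((hp.chart x₀).symm w))) =ᶠ[nhds w₀]
        fun w => proj ((u : ℍ[ℝ]) * (1 + imag w) * q) := by
  -- The transition map is `w ↦ proj (x₁⁻¹ b⁻¹ x₀ (1 + imag w) q)`, with the element `b` for which
  -- the lifts of the point agree.
  obtain ⟨w₁, hw₁, h⟩ := h
  simp only [hf] at h
  obtain ⟨b, hb, h⟩ := (hp.fibres _ _).1 h
  set u := x₁⁻¹ * b⁻¹ * x₀ with hu
  have hy : ∀ w, b * (x₁ * (u * gnomonic w * q)) = x₀ * gnomonic w * q := fun w => by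
    rw [hu]; group
  have hy0 : u * gnomonic w₀ * q = gnomonic w₁ := by
    have := hy w₀
    rw [h] at this
    exact mul_left_cancel (mul_left_cancel this)
  have hcont : Continuous fun w => u * gnomonic w * q :=
    (continuous_const.mul continuous_gnomonic).mul continuous_const
  have hpos : 0 < ((u * gnomonic w₀ * q : UnitQuaternion) : ℍ[ℝ]).re := by
    rw [hy0]; exact gnomonic_re_pos _
  refine ⟨u, ?_, ?_⟩
  · have e : ((u * gnomonic w₀ * q : UnitQuaternion) : ℍ[ℝ]) =
        ‖1 + imag w₀‖⁻¹ • ((u : ℍ[ℝ]) * (1 + imag w₀) * q) := by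
      rw [Metric.unitSphere.coe_mul, Metric.unitSphere.coe_mul, coe_gnomonic, mul_smul_comm,
        smul_mul_assoc]
    rw [e, Quaternion.re_smul, smul_eq_mul] at hpos
    exact pos_of_mul_pos_right hpos (inv_nonneg.2 (norm_nonneg _))
  · have h3 : ContinuousAt (fun w => ((u * gnomonic w * q : UnitQuaternion) : ℍ[ℝ]).re) w₀ :=
      (rePart.continuous.comp (continuous_subtype_val.comp hcont)).continuousAt
    have h4 : ContinuousAt (fun w => proj ((u * gnomonic w * q : UnitQuaternion) : ℍ[ℝ])) w₀ :=
      ContinuousAt.comp (g := proj) (continuousAt_proj hpos.ne')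
        (continuous_subtype_val.comp hcont).continuousAt
    have h5 : proj ((u * gnomonic w₀ * q : UnitQuaternion) : ℍ[ℝ]) ∈ Metric.ball (0 : E3) (1 / 4) := by
      rw [hy0, proj_gnomonic]; exact hw₁
    filter_upwards [h3.eventually (lt_mem_nhds hpos),
      h4.eventually (Metric.isOpen_ball.mem_nhds h5)] with w h6 h7
    rw [hp.chart_symm_apply, hf, ← hy, hp.map_mul hb, ← gnomonic_proj h6, hp.chart_apply _ h7]
    exact proj_mul_gnomonic_mul _ _ _

theorem contDiffAt_proj_mul {u q : UnitQuaternion} {w₀ : E3}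
    (h : 0 < ((u : ℍ[ℝ]) * (1 + imag w₀) * q).re) :
    ContDiffAt ℝ ∞ (fun w => proj ((u : ℍ[ℝ]) * (1 + imag w) * q)) w₀ := by
  refine ContDiffAt.comp (g := proj) w₀ (contDiffAt_proj h.ne') ?_
  have : ContDiff ℝ ∞ fun w => 1 + imag w := contDiff_const.add imag.contDiff
  exact ((contDiff_const.mul this).mul contDiff_const).contDiffAt

/-- The smooth atlas of the quotient. -/
abbrev chartedSpace (hp : IsIcosahedralQuotient p) : ChartedSpace E3 M where
  atlas := Set.range hp.chart
  chartAt y := hp.chart (Function.surjInv hp.surjective y)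
  mem_chart_source y := by
    have := hp.mem_chart_source (Function.surjInv hp.surjective y)
    rwa [Function.surjInv_eq hp.surjective] at this
  chart_mem_atlas y := ⟨_, rfl⟩

theorem isManifold (hp : IsIcosahedralQuotient p) :
    letI := hp.chartedSpace
    IsManifold (𝓡 3) ∞ M := by
  let := hp.chartedSpace
  refine isManifold_of_contDiffOn _ _ _ ?_
  rintro _ _ ⟨x₀, rfl⟩ ⟨x₁, rfl⟩
  intro w hw
  simp only [modelWithCornersSelf_coe_symm, Set.preimage_id_eq, id_eq,
    modelWithCornersSelf_coe, Set.range_id, Set.inter_univ, OpenPartialHomeomorph.trans_source,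
    OpenPartialHomeomorph.symm_source, Set.mem_inter_iff, Set.mem_preimage] at hw
  obtain ⟨u, hu, he⟩ := hp.chart_comp_eventuallyEq (f := id) (q := 1) (fun x => by simp) x₀ x₁ hw.2
  exact ((contDiffAt_proj_mul hu).congr_of_eventuallyEq he).contDiffWithinAt

/-- Maps induced by right multiplications preserve the orientation given by the atlas. -/
theorem hasPositiveJacobian (hp : IsIcosahedralQuotient p) {f : M → M} {q : UnitQuaternion}
    (hf : ∀ x, f (p x) = p (x * q)) :
    letI := hp.chartedSpace
    HasPositiveJacobian (Set.range hp.chart) f := by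
  let := hp.chartedSpace
  rintro _ ⟨x₀, rfl⟩ _ ⟨x₁, rfl⟩ y hy hfy
  obtain ⟨w, hw, rfl⟩ := hy
  simp only at hfy ⊢
  obtain ⟨u, hu, he⟩ := hp.chart_comp_eventuallyEq hf x₀ x₁ hfy
  rw [hp.chart_apply _ hw, he.fderiv_eq]
  exact det_fderiv_proj_pos (norm_eq_of_mem_sphere u) (norm_eq_of_mem_sphere q) hu

theorem isOrientedAtlas (hp : IsIcosahedralQuotient p) :
    letI := hp.chartedSpace
    IsOrientedAtlas (M := M) (Set.range hp.chart) := by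
  let := hp.chartedSpace
  have := hp.isManifold
  refine ⟨IsManifold.subset_maximalAtlas, fun x => ?_, hp.hasPositiveJacobian (q := 1) fun x => by simp⟩
  obtain ⟨x, rfl⟩ := hp.surjective x
  exact ⟨_, ⟨x, rfl⟩, hp.mem_chart_source x⟩

theorem contMDiff_mul_gnomonic (x₀ : UnitQuaternion) :
    ContMDiff (𝓡 3) (𝓡 3) ∞ fun w : E3 => x₀ * gnomonic w := by
  have h : ContMDiff (𝓡 3) 𝓘(ℝ, ℍ[ℝ]) ∞ fun w : E3 => (x₀ : ℍ[ℝ]) * gnomonic w :=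
    (contDiff_const.mul contDiff_gnomonic).contMDiff
  exact h.codRestrict_sphere fun w => (x₀ * gnomonic w).2

theorem contMDiff_mul_mul (a b : UnitQuaternion) :
    ContMDiff (𝓡 3) (𝓡 3) ∞ fun x : UnitQuaternion => a * x * b := by
  have h1 : ContDiff ℝ ∞ fun y : ℍ[ℝ] => (a : ℍ[ℝ]) * y * b :=
    (contDiff_const.mul contDiff_id).mul contDiff_const
  have h : ContMDiff (𝓡 3) 𝓘(ℝ, ℍ[ℝ]) ∞ fun x : UnitQuaternion => (a : ℍ[ℝ]) * x * b :=
    h1.contMDiff.comp contMDiff_coe_sphere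
  exact h.codRestrict_sphere fun x => (a * x * b).2

/-- The atlas is the one for which the quotient map is a local diffeomorphism: on the cap around
`x₀`, its composition with a chart is the central projection. -/
theorem isLocalDiffeomorph (hp : IsIcosahedralQuotient p) :
    letI := hp.chartedSpace
    IsLocalDiffeomorph (𝓡 3) (𝓡 3) ∞ p := by
  let := hp.chartedSpace
  have := hp.isManifold
  intro x₀
  have hmem : hp.chart x₀ ∈ IsManifold.maximalAtlas (𝓡 3) ∞ M :=
    IsManifold.subset_maximalAtlas ⟨x₀, rfl⟩
  -- The cap around `x₀`.
  let U : Set UnitQuaternion := {x | 0 < ((x₀⁻¹ * x : UnitQuaternion) : ℍ[ℝ]).re ∧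
    proj ((x₀⁻¹ * x : UnitQuaternion) : ℍ[ℝ]) ∈ Metric.ball (0 : E3) (1 / 4)}
  have hpU : ∀ x ∈ U, p x = p (x₀ * gnomonic (proj ((x₀⁻¹ * x : UnitQuaternion) : ℍ[ℝ]))) := by
    intro x hx
    rw [gnomonic_proj hx.1, mul_inv_cancel_left]
  have hsm : ContMDiffOn (𝓡 3) (𝓡 3) ∞
      (fun x : UnitQuaternion => proj ((x₀⁻¹ * x : UnitQuaternion) : ℍ[ℝ])) U := by
    intro x hx
    have h1 : ContMDiff (𝓡 3) 𝓘(ℝ, ℍ[ℝ]) ∞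
        fun x : UnitQuaternion => ((x₀⁻¹ * x : UnitQuaternion) : ℍ[ℝ]) := by
      have := contMDiff_coe_sphere.comp (contMDiff_mul_mul x₀⁻¹ 1)
      simp only [mul_one] at this
      exact this
    exact (ContMDiffAt.comp x (contDiffAt_proj hx.1.ne').contMDiffAt h1.contMDiffAt).contMDiffWithinAt
  have hU : U = (fun w => x₀ * gnomonic w) '' Metric.ball (0 : E3) (1 / 4) := by
    ext x
    constructor
    · intro hx
      refine ⟨_, hx.2, ?_⟩
      simp only
      rw [gnomonic_proj hx.1, mul_inv_cancel_left]
    · rintro ⟨w, hw, rfl⟩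
      simp only [U, Set.mem_ofPred_eq, inv_mul_cancel_left, proj_gnomonic]
      exact ⟨gnomonic_re_pos w, hw⟩
  let Φ : PartialDiffeomorph (𝓡 3) (𝓡 3) UnitQuaternion M ∞ :=
    { toFun := p
      invFun := fun y => x₀ * gnomonic (hp.chart x₀ y)
      source := U
      target := (hp.chart x₀).source
      map_source' := fun x hx => by
        rw [hpU x hx]; exact ⟨_, hx.2, rfl⟩
      map_target' := fun y hy => by
        rw [hU]; exact ⟨_, (hp.chart x₀).map_source hy, rfl⟩
      left_inv' := fun x hx => by
        rw [hpU x hx, hp.chart_apply _ hx.2, gnomonic_proj hx.1, mul_inv_cancel_left]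
      right_inv' := fun y hy => (hp.chart x₀).left_inv hy
      open_source := by
        rw [hU]
        exact ((Homeomorph.mulLeft x₀).isOpenMap.comp isOpenMap_gnomonic) _ Metric.isOpen_ball
      open_target := (hp.chart x₀).open_source
      contMDiffOn_toFun := by
        have h := (contMDiffOn_symm_of_mem_maximalAtlas hmem).comp hsm fun x hx => hx.2
        exact h.congr hpU
      contMDiffOn_invFun :=
        (contMDiff_mul_gnomonic x₀).comp_contMDiffOn (contMDiffOn_of_mem_maximalAtlas hmem) }
  refine ⟨Φ, ?_, fun x _ => rfl⟩
  show x₀ ∈ U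
  rw [hU]
  exact ⟨0, Metric.mem_ball_self (by norm_num), by simp only [gnomonic_zero, mul_one]⟩

end IsIcosahedralQuotient

/-! ### The height function on the quotient -/

theorem deriv_bump_nonneg (s : ℝ) : 0 ≤ deriv bump s := bump_mono.deriv_nonneg

theorem deriv_bump_eq_zero {s : ℝ} (h : s ≤ 0.9352) : deriv bump s = 0 := by
  rcases h.lt_or_eq with h | rfl
  · have : bump =ᶠ[nhds s] fun _ => 0 := by
      filter_upwards [gt_mem_nhds h] with t ht
      exact bump_eq_zero ht.le
    rw [this.deriv_eq, deriv_const]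
  · refine IsLocalMin.deriv_eq_zero (Filter.Eventually.of_forall fun t => ?_)
    rw [bump_eq_zero le_rfl]
    exact bump_nonneg t

/-- Through each point of the level surface passes a smooth curve along which the height function
has nonzero derivative: it runs in the direction of the centre of the closest cell. -/
theorem exists_curve {x : UnitQuaternion} (hx : height x = level) :
    ∃ c : ℝ → UnitQuaternion, ContMDiff 𝓘(ℝ, ℝ) (𝓡 3) ∞ c ∧ c 0 = x ∧
      deriv (fun t => height (c t)) 0 ≠ 0 := by
  obtain ⟨γ, hγ, hmax⟩ := Finset.exists_max_image IsCell.finite.toFinset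
    (fun v => ⟪(x : ℍ[ℝ]), v⟫_ℝ) ⟨cellCenter, by simpa using isCell_cellCenter⟩
  replace hγ : IsCell γ := by simpa using hγ
  have hlarge := hγ.le_inner hx.le fun η hη => hmax η (by simpa using hη)
  have hxx : ⟪(x : ℍ[ℝ]), (x : ℍ[ℝ])⟫_ℝ = 1 := by
    rw [real_inner_self_eq_norm_sq, norm_eq_of_mem_sphere, one_pow]
  set d : ℍ[ℝ] := γ - ⟪(x : ℍ[ℝ]), γ⟫_ℝ • (x : ℍ[ℝ]) with hd
  have hxd : ⟪(x : ℍ[ℝ]), d⟫_ℝ = 0 := by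
    rw [hd, inner_sub_right, inner_smul_right, hxx]; ring
  -- Along `d`, the inner products with all vertices that contribute to the height decrease, because
  -- `⟪γ, v⟫ ≤ φ² / 2 < 0.9352 * 1.4009`.
  have hdv : ∀ v, IsUnitIcosian v → 0.9352 < ⟪(x : ℍ[ℝ]), v⟫_ℝ → ⟪d, v⟫_ℝ < 0 := by
    intro v hv h
    have h1 := hγ.inner_vertex_le hv
    have h2 := goldenRatio_bounds
    rw [Real.goldenRatio_sq] at h1
    rw [hd, inner_sub_left, inner_smul_left, RCLike.conj_to_real]
    nlinarith
  have hn : ∀ t : ℝ, ‖(x : ℍ[ℝ]) + t • d‖ ^ 2 = 1 + t ^ 2 * ‖d‖ ^ 2 := by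
    intro t
    rw [norm_add_sq_real, inner_smul_right, hxd, norm_eq_of_mem_sphere, norm_smul, mul_pow,
      Real.norm_eq_abs, sq_abs]
    ring
  have hne : ∀ t : ℝ, (x : ℍ[ℝ]) + t • d ≠ 0 := by
    intro t h
    have := hn t
    rw [h, norm_zero] at this
    nlinarith [mul_nonneg (sq_nonneg t) (sq_nonneg ‖d‖)]
  have hlin : ContDiff ℝ ∞ fun t : ℝ => (x : ℍ[ℝ]) + t • d :=
    contDiff_const.add (contDiff_id.smul contDiff_const)
  have hsm : ContDiff ℝ ∞ fun t : ℝ => (nrm ((x : ℍ[ℝ]) + t • d) : ℍ[ℝ]) := by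
    simp only [coe_nrm (hne _)]
    exact ((hlin.norm ℝ hne).inv fun t => norm_ne_zero_iff.2 (hne t)).smul hlin
  refine ⟨fun t => nrm ((x : ℍ[ℝ]) + t • d),
    hsm.contMDiff.codRestrict_sphere fun t => (nrm ((x : ℍ[ℝ]) + t • d)).2, ?_, ?_⟩
  · simp only [zero_smul, add_zero, nrm_coe]
  -- The normalization does not contribute to the derivative at `t = 0`.
  have hnd : HasDerivAt (fun t : ℝ => ‖(x : ℍ[ℝ]) + t • d‖) 0 0 := by
    have h1 : HasDerivAt (fun t : ℝ => √(1 + t ^ 2 * ‖d‖ ^ 2)) 0 0 := by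
      have h2 : HasDerivAt (fun t : ℝ => 1 + t ^ 2 * ‖d‖ ^ 2) 0 0 := by
        have := ((hasDerivAt_pow 2 (0 : ℝ)).mul_const (‖d‖ ^ 2)).const_add 1
        simpa using this
      have := h2.sqrt (by norm_num)
      simpa using this
    refine h1.congr_of_eventuallyEq (Filter.Eventually.of_forall fun t => ?_)
    simp only
    rw [← hn, Real.sqrt_sq (norm_nonneg _)]
  have hinn : ∀ v, HasDerivAt (fun t : ℝ => ⟪(nrm ((x : ℍ[ℝ]) + t • d) : ℍ[ℝ]), v⟫_ℝ) ⟪d, v⟫_ℝ 0 := by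
    intro v
    have h1 : HasDerivAt (fun t : ℝ => ⟪(x : ℍ[ℝ]), v⟫_ℝ + t * ⟪d, v⟫_ℝ) ⟪d, v⟫_ℝ 0 := by
      have := ((hasDerivAt_id (0 : ℝ)).mul_const ⟪d, v⟫_ℝ).const_add ⟪(x : ℍ[ℝ]), v⟫_ℝ
      simpa using this
    have h2 := h1.div hnd (norm_ne_zero_iff.2 (hne 0))
    simp only [zero_smul, add_zero, norm_eq_of_mem_sphere, mul_one, mul_zero, sub_zero, one_pow,
      div_one] at h2
    refine h2.congr_of_eventuallyEq (Filter.Eventually.of_forall fun t => ?_)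
    simp only [Pi.div_apply]
    rw [coe_nrm_inner (hne t), inner_add_left, inner_smul_left, RCLike.conj_to_real]
  have hder : HasDerivAt (fun t : ℝ => height (nrm ((x : ℍ[ℝ]) + t • d)))
      (∑ v ∈ unitIcosians, deriv bump ⟪(x : ℍ[ℝ]), v⟫_ℝ * ⟪d, v⟫_ℝ) 0 := by
    unfold height
    refine HasDerivAt.fun_sum fun v _ => ?_
    have h1 := ((contDiff_bump.differentiable (by norm_num))
      ⟪(nrm ((x : ℍ[ℝ]) + (0 : ℝ) • d) : ℍ[ℝ]), v⟫_ℝ).hasDerivAt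
    have h2 := h1.comp (0 : ℝ) (hinn v)
    simp only [zero_smul, add_zero, nrm_coe] at h2
    exact h2
  rw [hder.deriv]
  refine ne_of_lt ?_
  have hex : ∃ v, IsUnitIcosian v ∧ 0.9352 < ⟪(x : ℍ[ℝ]), v⟫_ℝ := by
    by_contra hcon
    push Not at hcon
    rw [height_eq_zero hcon] at hx
    exact level_pos.ne hx
  obtain ⟨v, hv, hv'⟩ := hex
  refine (Finset.sum_lt_sum (g := fun _ => (0 : ℝ)) (fun u hu => ?_)
    ⟨v, mem_unitIcosians.2 hv, ?_⟩).trans_eq Finset.sum_const_zero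
  · by_cases h : 0.9352 < ⟪(x : ℍ[ℝ]), u⟫_ℝ
    · exact mul_nonpos_of_nonneg_of_nonpos (deriv_bump_nonneg _)
        (hdv u (mem_unitIcosians.1 hu) h).le
    · rw [deriv_bump_eq_zero (not_lt.1 h), zero_mul]
  · obtain ⟨s, hs, hs'⟩ := hasDerivAt_bump_pos hv'
    rw [hs'.deriv]
    exact mul_neg_of_pos_of_neg hs (hdv v hv hv')

namespace IsIcosahedralQuotient

variable {M : Type*} [TopologicalSpace M] {p : UnitQuaternion → M}

/-- The quotient by a finite group acting continuously is Hausdorff. -/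
theorem t2Space (hp : IsIcosahedralQuotient p) : T2Space M := by
  rw [t2Space_iff_of_isOpenQuotientMap (π := p) ⟨hp.surjective, hp.continuous, hp.isOpenMap⟩]
  have hfin : {b : UnitQuaternion | b ∈ binaryIcosahedralGroup}.Finite := by
    refine Set.Finite.of_finite_image (f := Subtype.val) (IsUnitIcosian.finite.subset ?_)
      Subtype.val_injective.injOn
    rintro _ ⟨b, hb, rfl⟩
    exact ⟨b, hb, rfl⟩
  have e : {q : UnitQuaternion × UnitQuaternion | p q.1 = p q.2} =
      ⋃ b ∈ {b : UnitQuaternion | b ∈ binaryIcosahedralGroup}, {q | q.2 = b * q.1} := by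
    ext q
    simp only [Set.mem_ofPred_eq, hp.fibres, Set.mem_iUnion, exists_prop]
  rw [e]
  exact hfin.isClosed_biUnion fun b _ =>
    isClosed_eq continuous_snd (continuous_const.mul continuous_fst)

theorem compactSpace (hp : IsIcosahedralQuotient p) : CompactSpace M := by
  have : CompactSpace UnitQuaternion := Metric.sphere.compactSpace 0 1
  have h := isCompact_univ.image hp.continuous
  rw [Set.image_univ, hp.surjective.range_eq] at h
  exact ⟨h⟩

theorem connectedSpace (hp : IsIcosahedralQuotient p) : ConnectedSpace M := by
  have hr : 1 < Module.rank ℝ ℍ[ℝ] := by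
    rw [Quaternion.rank_eq_four]; norm_num
  have : ConnectedSpace UnitQuaternion :=
    isConnected_iff_connectedSpace.1 (isConnected_sphere hr 0 zero_le_one)
  exact hp.surjective.connectedSpace hp.continuous

/-- A map from the quotient is smooth if it is so after composition with the quotient map. -/
theorem contMDiff_of_comp (hp : IsIcosahedralQuotient p) {E H N : Type*} [NormedAddCommGroup E]
    [NormedSpace ℝ E] [TopologicalSpace H] {I : ModelWithCorners ℝ E H} [TopologicalSpace N]
    [ChartedSpace H N] {f : M → N} :
    letI := hp.chartedSpace
    ContMDiff (𝓡 3) I ∞ (fun x => f (p x)) → ContMDiff (𝓡 3) I ∞ f := by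
  let := hp.chartedSpace
  intro h y
  obtain ⟨x, rfl⟩ := hp.surjective y
  have hx := hp.isLocalDiffeomorph x
  have h1 := hx.localInverse_contMDiffAt
  refine (ContMDiffAt.comp (p x) (h _) h1).congr_of_eventuallyEq ?_
  filter_upwards [hx.localInverse_eventuallyEq_right] with z hz
  exact congrArg f hz.symm

/-- The height function on the quotient. -/
def heightFun (hp : IsIcosahedralQuotient p) (y : M) : ℝ :=
  height (Function.surjInv (f := p) hp.surjective y : UnitQuaternion)

theorem heightFun_map (hp : IsIcosahedralQuotient p) (x : UnitQuaternion) :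
    hp.heightFun (p x) = height x := by
  obtain ⟨b, hb, h⟩ := (hp.fibres _ _).1 (Function.surjInv_eq hp.surjective (p x)).symm
  rw [heightFun, h, height_coe_mul hb]

theorem contMDiff_heightFun (hp : IsIcosahedralQuotient p) :
    letI := hp.chartedSpace
    ContMDiff (𝓡 3) 𝓘(ℝ, ℝ) ∞ hp.heightFun := by
  let := hp.chartedSpace
  refine hp.contMDiff_of_comp ?_
  simp only [heightFun_map]
  exact contDiff_height.contMDiff.comp contMDiff_coe_sphere

theorem continuous_heightFun (hp : IsIcosahedralQuotient p) : Continuous hp.heightFun := by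
  let := hp.chartedSpace
  exact hp.contMDiff_heightFun.continuous

theorem exists_curve (hp : IsIcosahedralQuotient p) {y : M} (hy : hp.heightFun y = level) :
    letI := hp.chartedSpace
    ∃ c : ℝ → M, ContMDiff 𝓘(ℝ, ℝ) (𝓡 3) ∞ c ∧ c 0 = y ∧
      deriv (fun t => hp.heightFun (c t)) 0 ≠ 0 := by
  let := hp.chartedSpace
  obtain ⟨x, rfl⟩ := hp.surjective y
  rw [heightFun_map] at hy
  obtain ⟨c, h1, h2, h3⟩ := PoincareSphere.exists_curve hy
  refine ⟨p ∘ c, hp.isLocalDiffeomorph.contMDiff.comp h1, by rw [Function.comp, h2], ?_⟩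
  simpa only [Function.comp, heightFun_map] using h3

/-- The level is a regular value of the height function on the quotient, and so are the
corresponding values of its affine images. -/
theorem mfderiv_heightFun_ne_zero (hp : IsIcosahedralQuotient p) {y : M}
    (hy : hp.heightFun y = level) {f : M → ℝ} (hf : ∃ r s : ℝ, r ≠ 0 ∧
      ∀ z, f z = r * hp.heightFun z + s) :
    letI := hp.chartedSpace
    mfderiv (𝓡 3) 𝓘(ℝ, ℝ) f y ≠ 0 := by
  let := hp.chartedSpace
  obtain ⟨r, s, hr, hf⟩ := hf
  obtain ⟨c, h1, rfl, h3⟩ := hp.exists_curve hy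
  intro h0
  have hfs : ContMDiff (𝓡 3) 𝓘(ℝ, ℝ) ∞ f := by
    rw [funext hf]
    have h : ContDiff ℝ ∞ fun t : ℝ => r * t + s := by fun_prop
    exact h.contMDiff.comp hp.contMDiff_heightFun
  have h4 := mfderiv_comp (0 : ℝ) (hfs.mdifferentiable (by norm_num) (c 0))
    (h1.mdifferentiable (by norm_num) 0)
  rw [h0, ContinuousLinearMap.zero_comp, mfderiv_eq_fderiv] at h4
  have h5 : deriv (f ∘ c) 0 = 0 := by
    rw [← fderiv_apply_one_eq_deriv, h4]; rfl
  have h6 : f ∘ c = fun t => r * hp.heightFun (c t) + s := funext fun t => hf _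
  rw [h6, deriv_add_const, deriv_const_mul_field] at h5
  exact h3 ((mul_eq_zero.1 h5).resolve_left hr)

/-- A point of the level surface is not interior to the superlevel set, as the height is not
extremal there along the curve of `exists_curve`. -/
theorem frontier_upper (hp : IsIcosahedralQuotient p) :
    frontier {y | level ≤ hp.heightFun y} = {y | hp.heightFun y = level} := by
  let := hp.chartedSpace
  apply subset_antisymm
  · exact (frontier_le_subset_eq continuous_const hp.continuous_heightFun).trans
      fun y hy => Eq.symm hy
  · intro y hy
    have hcl : IsClosed {y | level ≤ hp.heightFun y} :=
      isClosed_le continuous_const hp.continuous_heightFun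
    rw [hcl.frontier_eq]
    refine ⟨(show hp.heightFun y = level from hy).ge, fun hint => ?_⟩
    obtain ⟨c, h1, rfl, h3⟩ := hp.exists_curve hy
    refine h3 (IsLocalMin.deriv_eq_zero ?_)
    filter_upwards [h1.continuous.continuousAt.eventually (mem_interior_iff_mem_nhds.1 hint)]
      with t ht
    exact (show hp.heightFun (c 0) = level from hy).trans_le ht

theorem frontier_lower (hp : IsIcosahedralQuotient p) :
    frontier {y | hp.heightFun y ≤ level} = {y | hp.heightFun y = level} := by
  let := hp.chartedSpace
  apply subset_antisymm
  · exact frontier_le_subset_eq hp.continuous_heightFun continuous_const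
  · intro y hy
    have hcl : IsClosed {y | hp.heightFun y ≤ level} :=
      isClosed_le hp.continuous_heightFun continuous_const
    rw [hcl.frontier_eq]
    refine ⟨(show hp.heightFun y = level from hy).le, fun hint => ?_⟩
    obtain ⟨c, h1, rfl, h3⟩ := hp.exists_curve hy
    refine h3 (IsLocalMax.deriv_eq_zero ?_)
    filter_upwards [h1.continuous.continuousAt.eventually (mem_interior_iff_mem_nhds.1 hint)]
      with t ht
    exact ht.trans (show hp.heightFun (c 0) = level from hy).ge

theorem isHeegaardSplitting (hp : IsIcosahedralQuotient p) :
    letI := hp.chartedSpace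
    IsHeegaardSplitting {y | level ≤ hp.heightFun y} {y | hp.heightFun y ≤ level} 6 := by
  let := hp.chartedSpace
  have hinter : {y | level ≤ hp.heightFun y} ∩ {y | hp.heightFun y ≤ level} =
      {y | hp.heightFun y = level} := by
    ext y
    exact ⟨fun h => le_antisymm h.2 h.1,
      fun h => ⟨(show hp.heightFun y = level from h).ge, (show hp.heightFun y = level from h).le⟩⟩
  refine ⟨?_, ?_, ?_, ?_, ?_, ?_, ?_⟩
  · have e : {y | level ≤ hp.heightFun y} = p '' {x | level ≤ height (x : ℍ[ℝ])} := by
      ext y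
      constructor
      · intro h
        obtain ⟨x, rfl⟩ := hp.surjective y
        exact ⟨x, (h : level ≤ _).trans_eq (hp.heightFun_map x), rfl⟩
      · rintro ⟨x, h, rfl⟩
        exact (h : level ≤ _).trans_eq (hp.heightFun_map x).symm
    rw [e]
    exact isHandlebody_upper hp.continuous hp.fibres
  · have e : {y | hp.heightFun y ≤ level} = p '' {x | height (x : ℍ[ℝ]) ≤ level} := by
      ext y
      constructor
      · intro h
        obtain ⟨x, rfl⟩ := hp.surjective y
        exact ⟨x, (hp.heightFun_map x).symm.trans_le h, rfl⟩
      · rintro ⟨x, h, rfl⟩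
        exact (hp.heightFun_map x).trans_le h
    rw [e]
    exact isHandlebody_lower hp.continuous hp.fibres
  · intro y hy
    rw [hp.frontier_upper] at hy
    have h : ContDiff ℝ ∞ fun t : ℝ => level - t := by fun_prop
    exact ⟨Set.univ, fun z => level - hp.heightFun z, isOpen_univ, Set.mem_univ _,
      (h.contMDiff.comp hp.contMDiff_heightFun).contMDiffOn,
      hp.mfderiv_heightFun_ne_zero hy ⟨-1, level, by norm_num, fun z => by ring⟩,
      fun z _ => (sub_nonpos (a := level) (b := hp.heightFun z)).symm⟩
  · intro y hy
    rw [hp.frontier_lower] at hy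
    have h : ContDiff ℝ ∞ fun t : ℝ => t - level := by fun_prop
    exact ⟨Set.univ, fun z => hp.heightFun z - level, isOpen_univ, Set.mem_univ _,
      (h.contMDiff.comp hp.contMDiff_heightFun).contMDiffOn,
      hp.mfderiv_heightFun_ne_zero hy ⟨1, -level, by norm_num, fun z => by ring⟩,
      fun z _ => (sub_nonpos (a := hp.heightFun z) (b := level)).symm⟩
  · exact Set.eq_univ_of_forall fun y => le_total level (hp.heightFun y)
  · rw [hinter, hp.frontier_upper]
  · rw [hinter, hp.frontier_lower]

/-- An action by right multiplications with elements of the binary icosahedral group preserves the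
Heegaard splitting. -/
theorem isType12 (hp : IsIcosahedralQuotient p) {G : Type*} [Group G] (ρ : G →* Equiv.Perm M)
    (hρ : ∀ g, ∃ q ∈ binaryIcosahedralGroup, ∀ x, ρ g (p x) = p (x * q))
    (hinj : Function.Injective ρ) (hcard : Nat.card G = 60) :
    letI := hp.chartedSpace
    IsType12 ρ 6 := by
  let := hp.chartedSpace
  have hinv : ∀ g y, hp.heightFun (ρ g y) = hp.heightFun y := by
    intro g y
    obtain ⟨q, hq, h⟩ := hρ g
    obtain ⟨x, rfl⟩ := hp.surjective y
    rw [h, heightFun_map, heightFun_map]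
    have := height_mul .one (isUnitIcosian_coe.2 hq) (x : ℍ[ℝ])
    rwa [one_mul] at this
  refine
    { manifold := hp.isManifold
      hausdorff := hp.t2Space
      compact := hp.compactSpace
      connected := hp.connectedSpace
      faithful := hinj
      smooth := fun g => ?_
      oriented := ⟨_, hp.isOrientedAtlas, fun g => ?_⟩
      one_lt_genus := by norm_num
      card_eq := hcard
      splitting := ⟨_, _, hp.isHeegaardSplitting, fun g => ⟨?_, ?_⟩⟩ }
  · obtain ⟨q, -, h⟩ := hρ g
    refine hp.contMDiff_of_comp ?_
    simp only [h]
    have h1 := contMDiff_mul_mul 1 q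
    simp only [one_mul] at h1
    exact hp.isLocalDiffeomorph.contMDiff.comp h1
  · obtain ⟨q, -, h⟩ := hρ g
    exact hp.hasPositiveJacobian h
  · rw [Equiv.image_eq_preimage_symm]
    ext y
    rw [Set.mem_preimage, Set.mem_ofPred_eq, Set.mem_ofPred_eq, ← hinv g, Equiv.apply_symm_apply]
  · rw [Equiv.image_eq_preimage_symm]
    ext y
    rw [Set.mem_preimage, Set.mem_ofPred_eq, Set.mem_ofPred_eq, ← hinv g, Equiv.apply_symm_apply]

end IsIcosahedralQuotient

/-! ### Maps from the binary icosahedral group onto the alternating group -/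

namespace Icosian

/-- The list of unit icosians is closed under multiplication. As the product of two unit icosians is
known to be a unit icosian, no rounding can occur. -/
theorem mul_mem_all {x y : Icosian} (hx : x ∈ all) (hy : y ∈ all) :
    Exact x y ∧ mul x y ∈ all := by
  obtain ⟨z, hz, h⟩ := isUnitIcosian_iff.1 ((isUnitIcosian_of_mem hx).mul (isUnitIcosian_of_mem hy))
  have e : ∀ a b : GoldenInt, a.toReal / 2 = b.toReal / 4 → b = a + a := by
    intro a b hab
    have h2 : toH (b, 0, 0, 0) = toH (a + a, 0, 0, 0) := by
      have : b.toReal = (a + a).toReal := by rw [toReal_add]; linarith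
      simp only [toH, this]; rfl
    exact congrArg Prod.fst (toH_injective h2)
  have h0 : (toH z).re = (toH x * toH y).re := by rw [h]
  have h1 : (toH z).imI = (toH x * toH y).imI := by rw [h]
  have h2 : (toH z).imJ = (toH x * toH y).imJ := by rw [h]
  have h3 : (toH z).imK = (toH x * toH y).imK := by rw [h]
  rw [Quaternion.re_mul] at h0
  rw [Quaternion.imI_mul] at h1
  rw [Quaternion.imJ_mul] at h2
  rw [Quaternion.imK_mul] at h3
  simp only [toH] at h0 h1 h2 h3
  have hr : rawMul x y = z + z := by
    refine Prod.ext (e _ _ ?_) (Prod.ext (e _ _ ?_) (Prod.ext (e _ _ ?_) (e _ _ ?_))) <;>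
      simp only [rawMul, toReal_add, toReal_sub, toReal_mul] <;> linarith
  have hh : ∀ a : GoldenInt, half (a + a) = a := by
    intro a
    refine Prod.ext ?_ ?_ <;> simp only [half, Prod.fst_add, Prod.snd_add] <;> omega
  have hm : mul x y = z := by
    simp only [mul, hr, Prod.fst_add, Prod.snd_add, hh]
  exact ⟨by rw [Exact, hm, hr], by rwa [hm]⟩

/-- The unit quaternion encoded by an element of the list `all`; a junk value for other
icosians. -/
def unit (x : Icosian) : UnitQuaternion := nrm (toH x)

theorem coe_unit {x : Icosian} (hx : x ∈ all) : (unit x : ℍ[ℝ]) = toH x := by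
  have h := (isUnitIcosian_of_mem hx).norm
  exact congrArg Subtype.val (nrm_coe ⟨toH x, mem_sphere_zero_iff_norm.2 h⟩)

theorem unit_injOn {x y : Icosian} (hx : x ∈ all) (hy : y ∈ all) (h : unit x = unit y) :
    x = y :=
  toH_injective (by rw [← coe_unit hx, ← coe_unit hy, h])

theorem unit_mul {x y : Icosian} (hx : x ∈ all) (hy : y ∈ all) :
    unit x * unit y = unit (mul x y) := by
  obtain ⟨he, hm⟩ := mul_mem_all hx hy
  refine Subtype.ext ?_
  rw [coe_unit hm, toH_mul he, ← coe_unit hx, ← coe_unit hy]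
  rfl

theorem one_mem_all : one ∈ all := by decide +kernel

theorem unit_one : unit one = 1 := by
  refine Subtype.ext ?_
  rw [coe_unit one_mem_all, toH_one]
  rfl

theorem unit_conj {x : Icosian} (hx : x ∈ all) (hx' : conj x ∈ all) :
    unit (conj x) = (unit x)⁻¹ := by
  refine eq_inv_of_mul_eq_one_left (Subtype.ext ?_)
  show (unit (conj x) : ℍ[ℝ]) * unit x = 1
  rw [coe_unit hx, coe_unit hx', toH_conj, quaternion_star_mul_self (isUnitIcosian_of_mem hx).norm]

theorem list_prod_unit (l : List Icosian) (hl : ∀ x ∈ l, x ∈ all) :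
    l.foldr mul one ∈ all ∧ (l.map unit).prod = unit (l.foldr mul one) := by
  induction l with
  | nil => exact ⟨one_mem_all, unit_one.symm⟩
  | cons x l ih =>
    obtain ⟨h1, h2⟩ := ih fun y hy => hl y (List.mem_cons_of_mem _ hy)
    have hx := hl x List.mem_cons_self
    refine ⟨(mul_mem_all hx h1).2, ?_⟩
    rw [List.map_cons, List.prod_cons, h2, unit_mul hx h1, List.foldr_cons]

theorem unit_pow {x : Icosian} (hx : x ∈ all) (n : ℕ) :
    unit x ^ n = unit ((List.replicate n x).foldr mul one) := by
  rw [← (list_prod_unit _ fun y hy => (List.eq_of_mem_replicate hy) ▸ hx).2, List.map_replicate,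
    List.prod_replicate]

theorem mem_binaryIcosahedralGroup_iff {s : UnitQuaternion} :
    s ∈ binaryIcosahedralGroup ↔ ∃ x ∈ all, unit x = s := by
  constructor
  · intro hs
    obtain ⟨x, hx, h⟩ := isUnitIcosian_iff.1 ⟨s, hs, rfl⟩
    exact ⟨x, hx, Subtype.ext ((coe_unit hx).trans h)⟩
  · rintro ⟨x, hx, rfl⟩
    rw [← isUnitIcosian_coe, coe_unit hx]
    exact isUnitIcosian_of_mem hx

theorem unit_mem {x : Icosian} (hx : x ∈ all) : unit x ∈ binaryIcosahedralGroup :=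
  mem_binaryIcosahedralGroup_iff.2 ⟨x, hx, rfl⟩

theorem closure_hur_zeta :
    binaryIcosahedralGroup = Subgroup.closure {unit hur, unit zeta} := by
  have hh : hur ∈ all := by decide +kernel
  have hz : zeta ∈ all := by decide +kernel
  unfold binaryIcosahedralGroup
  congr 1
  ext s
  rw [← toH_hur, ← toH_zeta, ← coe_unit hh, ← coe_unit hz]
  simp only [Set.mem_ofPred_eq, Set.mem_insert_iff, Set.mem_singleton_iff, Subtype.ext_iff]

/-- A group of unit quaternions which is listed without repetition by a list of unit icosians has as
many elements as the list. -/
theorem card_eq_length {G : Type*} (f : G → UnitQuaternion) (hf : Function.Injective f)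
    {l : List Icosian} (hl : l.Nodup) (hall : ∀ x ∈ l, x ∈ all)
    (h : ∀ s, (∃ g, f g = s) ↔ ∃ x ∈ l, unit x = s) : Nat.card G = l.length := by
  rw [← List.toFinset_card_of_nodup hl, ← Nat.card_eq_finsetCard]
  have h1 : ∀ x : l.toFinset, ∃ g, f g = unit x := fun x =>
    (h _).2 ⟨x, List.mem_toFinset.1 x.2, rfl⟩
  choose k hk using h1
  symm
  refine Nat.card_eq_of_bijective k ⟨fun x y hxy => Subtype.ext ?_, fun g => ?_⟩
  · refine unit_injOn (hall _ (List.mem_toFinset.1 x.2)) (hall _ (List.mem_toFinset.1 y.2)) ?_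
    rw [← hk, ← hk, hxy]
  · obtain ⟨x, hx, e⟩ := (h _).1 ⟨g, rfl⟩
    exact ⟨⟨x, List.mem_toFinset.2 hx⟩, hf (by rw [hk, e])⟩

theorem card_binaryIcosahedralGroup : Nat.card binaryIcosahedralGroup = 120 := by
  rw [← length_all]
  refine card_eq_length Subtype.val Subtype.val_injective all_nodup (fun _ h => h) fun s => ?_
  rw [← mem_binaryIcosahedralGroup_iff]
  exact ⟨fun ⟨g, hg⟩ => hg ▸ g.2, fun hs => ⟨⟨s, hs⟩, rfl⟩⟩

theorem hurwitz_subset : ∀ x ∈ hurwitz, x ∈ all := by decide +kernel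
theorem hurwitz_nodup : hurwitz.Nodup := by decide +kernel
theorem length_hurwitz : hurwitz.length = 24 := by decide +kernel
theorem mul_mem_hurwitz : ∀ x ∈ hurwitz, ∀ y ∈ hurwitz, mul x y ∈ hurwitz := by decide +kernel
theorem conj_mem_hurwitz : ∀ x ∈ hurwitz, conj x ∈ hurwitz := by decide +kernel

/-- The only elements of the binary icosahedral group with Hurwitz units as conjugates by `1`, `ζ`
and `ζ²` are `±1`. -/
theorem eq_one_or_of_conj_mem_hurwitz : ∀ x ∈ all,
    (∀ y ∈ [one, zeta, mul zeta zeta], mul (mul y x) (conj y) ∈ hurwitz) →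
      x = one ∨ x = negOne := by
  decide +kernel

/-- The binary tetrahedral group of the 24 Hurwitz units, as a subgroup of index 5. -/
def binaryTetrahedralGroup : Subgroup binaryIcosahedralGroup where
  carrier := {s | ∃ x ∈ hurwitz, unit x = s}
  one_mem' := ⟨one, by decide +kernel, unit_one⟩
  mul_mem' := by
    rintro s t ⟨x, hx, h⟩ ⟨y, hy, h'⟩
    refine ⟨mul x y, mul_mem_hurwitz x hx y hy, ?_⟩
    rw [← unit_mul (hurwitz_subset x hx) (hurwitz_subset y hy), h, h']
    rfl
  inv_mem' := by
    rintro s ⟨x, hx, h⟩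
    have hc := conj_mem_hurwitz x hx
    refine ⟨conj x, hc, ?_⟩
    rw [unit_conj (hurwitz_subset x hx) (hurwitz_subset _ hc), h]
    rfl

theorem mem_binaryTetrahedralGroup {s : binaryIcosahedralGroup} :
    s ∈ binaryTetrahedralGroup ↔ ∃ x ∈ hurwitz, unit x = s := Iff.rfl

theorem card_binaryTetrahedralGroup : Nat.card binaryTetrahedralGroup = 24 := by
  rw [← length_hurwitz]
  refine card_eq_length (fun s : binaryTetrahedralGroup => ((s : binaryIcosahedralGroup) : UnitQuaternion))
    (fun s t h => ?_) hurwitz_nodup hurwitz_subset fun s => ?_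
  · have h' : ((s : binaryIcosahedralGroup) : UnitQuaternion) = (t : binaryIcosahedralGroup) := h
    exact Subtype.ext (Subtype.ext h')
  constructor
  · rintro ⟨g, rfl⟩
    exact g.2
  · rintro ⟨x, hx, rfl⟩
    exact ⟨⟨⟨unit x, unit_mem (hurwitz_subset x hx)⟩, ⟨x, hx, rfl⟩⟩, rfl⟩

instance : Finite binaryIcosahedralGroup :=
  Nat.finite_of_card_ne_zero (by rw [card_binaryIcosahedralGroup]; norm_num)

theorem card_quotient : Nat.card (binaryIcosahedralGroup ⧸ binaryTetrahedralGroup) = 5 := by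
  have h := Subgroup.card_eq_card_quotient_mul_card_subgroup binaryTetrahedralGroup
  rw [card_binaryIcosahedralGroup, card_binaryTetrahedralGroup] at h
  omega

theorem unit_negOne : (unit negOne : ℍ[ℝ]) = -1 := by
  rw [coe_unit (by decide +kernel), toH_negOne]

/-- The binary icosahedral group has no homomorphism onto a group of order two: the generators have
odd powers equal to `-1 = i²`, which is a square. -/
theorem hom_units_eq_one (s : binaryIcosahedralGroup →* ℤˣ) (q : binaryIcosahedralGroup) :
    s q = 1 := by
  have key : ∀ x, x ∈ all → ∀ y, ∀ hy : y ∈ all, (List.replicate 2 y).foldr mul one = negOne →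
      ∀ n, Odd n → (List.replicate n x).foldr mul one = negOne →
      ∀ h : unit x ∈ binaryIcosahedralGroup, s ⟨unit x, h⟩ = 1 := by
    intro x hx y hy h1 n ⟨k, hk⟩ h2 h
    have e : (⟨unit x, h⟩ : binaryIcosahedralGroup) ^ n = ⟨unit y, unit_mem hy⟩ ^ 2 := by
      refine Subtype.ext ?_
      show unit x ^ n = unit y ^ 2
      rw [unit_pow hx, unit_pow hy, h1, h2]
    have e' := congrArg s e
    rwa [map_pow, map_pow, Int.units_sq, hk, pow_succ, pow_mul, Int.units_sq, one_pow,
      one_mul] at e'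
  obtain ⟨q, hq⟩ := q
  have hq' := hq
  rw [closure_hur_zeta] at hq'
  have gen : ∀ t ∈ ({unit hur, unit zeta} : Set UnitQuaternion),
      ∀ h : t ∈ binaryIcosahedralGroup, s ⟨t, h⟩ = 1 := by
    rintro t (rfl | rfl)
    · exact key hur (by decide +kernel) unitI (by decide +kernel) (by decide +kernel) 3 (by decide)
        (by decide +kernel)
    · exact key zeta (by decide +kernel) unitI (by decide +kernel) (by decide +kernel) 5 (by decide)
        (by decide +kernel)
  have : ∃ h : q ∈ binaryIcosahedralGroup, s ⟨q, h⟩ = 1 := by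
    refine Subgroup.closure_induction (G := UnitQuaternion)
      (p := fun q _ => ∃ h : q ∈ binaryIcosahedralGroup, s ⟨q, h⟩ = 1) ?_ ?_ ?_ ?_ hq'
    · intro t ht
      have h : t ∈ binaryIcosahedralGroup := by
        rw [closure_hur_zeta]; exact Subgroup.subset_closure ht
      exact ⟨h, gen t ht h⟩
    · exact ⟨one_mem _, map_one s⟩
    · rintro a b _ _ ⟨ha, ha'⟩ ⟨hb, hb'⟩
      refine ⟨mul_mem ha hb, ?_⟩
      have := map_mul s ⟨a, ha⟩ ⟨b, hb⟩
      rw [ha', hb', one_mul] at this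
      exact this
    · rintro a _ ⟨ha, ha'⟩
      refine ⟨inv_mem ha, ?_⟩
      have := map_inv s ⟨a, ha⟩
      rw [ha', inv_one] at this
      exact this
  exact this.2

/-- The kernel of the action on the cosets of the binary tetrahedral group is contained in `±1`. -/
theorem eq_one_or_of_mem_normalCore {q : binaryIcosahedralGroup}
    (hq : q ∈ binaryTetrahedralGroup.normalCore) :
    (q : UnitQuaternion) = 1 ∨ (q : UnitQuaternion) = unit negOne := by
  obtain ⟨x, hx, h⟩ := mem_binaryIcosahedralGroup_iff.1 q.2
  have hy : ∀ y ∈ [one, zeta, mul zeta zeta], y ∈ all ∧ conj y ∈ all := by decide +kernel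
  have key := eq_one_or_of_conj_mem_hurwitz x hx fun y hy' => by
    obtain ⟨h1, h2⟩ := hy y hy'
    obtain ⟨z, hz, e⟩ := mem_binaryTetrahedralGroup.1 (hq ⟨unit y, unit_mem h1⟩)
    have e' : unit z = unit (mul (mul y x) (conj y)) := by
      rw [e, ← unit_mul (mul_mem_all h1 hx).2 h2, ← unit_mul h1 hx, h, unit_conj h1 h2]
      rfl
    rwa [← unit_injOn (hurwitz_subset z hz) (mul_mem_all (mul_mem_all h1 hx).2 h2).2 e']
  rw [← h]
  exact key.imp (fun e => by rw [e, unit_one]) fun e => by rw [e]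

theorem card_alternatingGroup_five : Nat.card (alternatingGroup (Fin 5)) = 60 := by
  have h := two_mul_nat_card_alternatingGroup (α := Fin 5)
  rw [Nat.card_eq_fintype_card (α := Equiv.Perm (Fin 5)), Fintype.card_perm, Fintype.card_fin] at h
  have : Nat.factorial 5 = 120 := rfl
  omega

/-- The binary icosahedral group maps onto the alternating group of degree 5, by its action on the
cosets of the binary tetrahedral group; the kernel consists of `±1`. -/
theorem exists_hom_alternatingGroup :
    ∃ f : binaryIcosahedralGroup →* alternatingGroup (Fin 5), Function.Surjective f ∧
      ∀ q : binaryIcosahedralGroup, (q : UnitQuaternion) = unit negOne → f q = 1 := by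
  let e : binaryIcosahedralGroup ⧸ binaryTetrahedralGroup ≃ Fin 5 :=
    Finite.equivFinOfCardEq card_quotient
  let f₀ : binaryIcosahedralGroup →* Equiv.Perm (Fin 5) :=
    e.permCongrHom.toMonoidHom.comp (MulAction.toPermHom _ _)
  let f : binaryIcosahedralGroup →* alternatingGroup (Fin 5) :=
    f₀.codRestrict _ fun q => Equiv.Perm.mem_alternatingGroup.2
      (hom_units_eq_one (Equiv.Perm.sign.comp f₀) q)
  have hker : ∀ q, f q = 1 → (q : UnitQuaternion) = 1 ∨ (q : UnitQuaternion) = unit negOne := by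
    intro q hq
    refine eq_one_or_of_mem_normalCore ?_
    rw [Subgroup.normalCore_eq_ker, MonoidHom.mem_ker]
    have h1 : f₀ q = 1 := congrArg Subtype.val hq
    exact (map_eq_one_iff e.permCongrHom e.permCongrHom.injective).1 h1
  -- The kernel has at most two elements, hence the image has at least `60`.
  have hsurj : Function.Surjective f := by
    have h1 : Nat.card f.ker ≤ 2 := by
      refine (Nat.card_le_card_of_injective (fun s : f.ker =>
        (⟨((s : binaryIcosahedralGroup) : UnitQuaternion), ?_⟩ :
          ({1, unit negOne} : Set UnitQuaternion))) ?_).trans ?_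
      · exact hker s s.2
      · intro s t hst
        have h' : ((s : binaryIcosahedralGroup) : UnitQuaternion) = (t : binaryIcosahedralGroup) :=
          Subtype.mk.inj hst
        exact Subtype.ext (Subtype.ext h')
      · rw [Nat.card_coe_set_eq]
        exact Set.ncard_insert_le _ _ |>.trans (by rw [Set.ncard_singleton])
    have h2 := Subgroup.card_eq_card_quotient_mul_card_subgroup f.ker
    rw [Nat.card_congr (QuotientGroup.quotientKerEquivRange f).toEquiv,
      card_binaryIcosahedralGroup] at h2
    rw [← MonoidHom.range_eq_top]
    refine Subgroup.eq_top_of_card_eq _ (le_antisymm (Subgroup.card_le_card_group _) ?_)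
    rw [card_alternatingGroup_five]
    nlinarith
  refine ⟨f, hsurj, fun q hq => ?_⟩
  -- the image of the central element `-1` is central, hence trivial
  have hc : ∀ r, f q * f r = f r * f q := by
    intro r
    rw [← map_mul, ← map_mul]
    congr 1
    refine Subtype.ext (Subtype.ext ?_)
    show ((q : UnitQuaternion) : ℍ[ℝ]) * (r : UnitQuaternion) =
      ((r : UnitQuaternion) : ℍ[ℝ]) * (q : UnitQuaternion)
    rw [hq, unit_negOne]; simp
  have : f q ∈ Subgroup.center (alternatingGroup (Fin 5)) := by
    rw [Subgroup.mem_center_iff]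
    intro g
    obtain ⟨r, rfl⟩ := hsurj g
    exact (hc r).symm
  rw [alternatingGroup.center_eq_bot (by simp)] at this
  exact Subgroup.mem_bot.1 this

/-- A homomorphism of the binary icosahedral group onto the alternating group of degree 5 is
injective modulo `±1`. -/
theorem sq_eq_one_of_surjective (f : binaryIcosahedralGroup →* alternatingGroup (Fin 5))
    (hf : Function.Surjective f) {q : binaryIcosahedralGroup} (hq : f q = 1) : q ^ 2 = 1 := by
  have h2 := Subgroup.card_eq_card_quotient_mul_card_subgroup f.ker
  rw [Nat.card_congr (QuotientGroup.quotientKerEquivOfSurjective f hf).toEquiv,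
    card_binaryIcosahedralGroup, card_alternatingGroup_five] at h2
  have h3 : Nat.card f.ker = 2 := by omega
  have h4 := pow_card_eq_one' (x := (⟨q, hq⟩ : f.ker))
  rw [h3] at h4
  exact congrArg Subtype.val h4

theorem coe_eq_or_of_sq {q : UnitQuaternion} (hq : q ^ 2 = 1) :
    (q : ℍ[ℝ]) = 1 ∨ (q : ℍ[ℝ]) = -1 := by
  have : (q : ℍ[ℝ]) * q = 1 := by
    have := congrArg Subtype.val hq
    rwa [pow_two] at this
  exact mul_self_eq_one_iff.1 this

end Icosian

/-! ### Rotations of the 3-sphere as pairs of unit quaternions -/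

theorem coe_inv_mul_coe (a : UnitQuaternion) : ((a⁻¹ : UnitQuaternion) : ℍ[ℝ]) * a = 1 :=
  congrArg Subtype.val (inv_mul_cancel a)

theorem coe_mul_coe_inv (a : UnitQuaternion) : (a : ℍ[ℝ]) * (a⁻¹ : UnitQuaternion) = 1 :=
  congrArg Subtype.val (mul_inv_cancel a)

theorem coe_inv_eq_star (a : UnitQuaternion) : ((a⁻¹ : UnitQuaternion) : ℍ[ℝ]) = star (a : ℍ[ℝ]) := by
  have h := quaternion_star_mul_self (norm_eq_of_mem_sphere a)
  calc ((a⁻¹ : UnitQuaternion) : ℍ[ℝ]) = star (a : ℍ[ℝ]) * a * (a⁻¹ : UnitQuaternion) := by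
        rw [h, one_mul]
    _ = star (a : ℍ[ℝ]) := by rw [mul_assoc, coe_mul_coe_inv, mul_one]

/-- The isometry `x ↦ a x b⁻¹` of the quaternions. -/
def mulIsometry (a b : UnitQuaternion) : ℍ[ℝ] ≃ₗᵢ[ℝ] ℍ[ℝ] where
  toFun x := a * x * (b⁻¹ : UnitQuaternion)
  invFun x := (a⁻¹ : UnitQuaternion) * x * b
  map_add' x y := by rw [mul_add, add_mul]
  map_smul' c x := by rw [RingHom.id_apply, mul_smul_comm, smul_mul_assoc]
  left_inv x := by
    show ((a⁻¹ : UnitQuaternion) : ℍ[ℝ]) * (a * x * (b⁻¹ : UnitQuaternion)) * b = x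
    rw [mul_assoc, mul_assoc, coe_inv_mul_coe, mul_one, ← mul_assoc, coe_inv_mul_coe, one_mul]
  right_inv x := by
    show (a : ℍ[ℝ]) * ((a⁻¹ : UnitQuaternion) * x * b) * (b⁻¹ : UnitQuaternion) = x
    rw [mul_assoc, mul_assoc, coe_mul_coe_inv, mul_one, ← mul_assoc, coe_mul_coe_inv, one_mul]
  norm_map' x := by
    show ‖(a : ℍ[ℝ]) * x * (b⁻¹ : UnitQuaternion)‖ = ‖x‖
    rw [norm_mul, norm_mul, norm_eq_of_mem_sphere, norm_eq_of_mem_sphere, one_mul, mul_one]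

theorem mulIsometry_apply (a b : UnitQuaternion) (x : ℍ[ℝ]) :
    mulIsometry a b x = a * x * (b⁻¹ : UnitQuaternion) := rfl

/-- The homomorphism from pairs `(a, b)` of unit quaternions to the rotations `x ↦ a x b⁻¹`,
transported to the 3-sphere by an isometry `A`. -/
def twoSided (A : ℍ[ℝ] ≃ₗᵢ[ℝ] E4) : UnitQuaternion × UnitQuaternion →* (E4 ≃ₗᵢ[ℝ] E4) where
  toFun p := A.symm.trans ((mulIsometry p.1 p.2).trans A)
  map_one' := by
    ext1 x
    show A (((1 : UnitQuaternion) : ℍ[ℝ]) * A.symm x * ((1 : UnitQuaternion)⁻¹ : UnitQuaternion)) = x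
    rw [inv_one]
    simp
  map_mul' p q := by
    ext1 x
    show A (mulIsometry (p.1 * q.1) (p.2 * q.2) (A.symm x)) =
      A (mulIsometry p.1 p.2 (A.symm (A (mulIsometry q.1 q.2 (A.symm x)))))
    rw [A.symm_apply_apply]
    congr 1
    simp only [mulIsometry_apply, mul_inv_rev, Metric.unitSphere.coe_mul, mul_assoc]

section TwoSided

variable (A : ℍ[ℝ] ≃ₗᵢ[ℝ] E4)

theorem twoSided_apply (a b : UnitQuaternion) (x : ℍ[ℝ]) :
    twoSided A (a, b) (A x) = A (a * x * (b⁻¹ : UnitQuaternion)) := by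
  show A (mulIsometry a b (A.symm (A x))) = _
  rw [A.symm_apply_apply, mulIsometry_apply]

theorem isometry_ext {f g : E4 ≃ₗᵢ[ℝ] E4} (h : ∀ x, f (A x) = g (A x)) : f = g := by
  ext1 y
  obtain ⟨x, rfl⟩ := A.surjective y
  exact h x

/-- The reflection in the hyperplane orthogonal to the unit quaternion `s` is `x ↦ -s x̄ s`. -/
theorem reflection_apply_unit (s : UnitQuaternion) (x : ℍ[ℝ]) :
    (ℝ ∙ A s)ᗮ.reflection (A x) = A (-(s * star x * s)) := by
  have h1 : (s : ℍ[ℝ]) * star x * s + x = (2 * ⟪(s : ℍ[ℝ]), x⟫_ℝ) • (s : ℍ[ℝ]) := by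
    have h2 := Quaternion.self_add_star ((s : ℍ[ℝ]) * star x)
    have h3 := congrArg (· * (s : ℍ[ℝ])) h2
    simp only [add_mul, star_mul, star_star] at h3
    rw [mul_assoc x, quaternion_star_mul_self (norm_eq_of_mem_sphere s), mul_one,
      ← Quaternion.inner_def] at h3
    rw [h3, ← Quaternion.coe_mul_eq_smul]
    push_cast
    rfl
  rw [Submodule.reflection_orthogonal_apply, Submodule.reflection_singleton_apply,
    LinearIsometryEquiv.inner_map_map, LinearIsometryEquiv.norm_map, norm_eq_of_mem_sphere,
    eq_sub_of_add_eq h1]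
  simp only [map_sub, map_add, map_smul, RCLike.ofReal_one, one_pow, div_one, neg_sub, mul_smul,
    two_smul]

/-- The reflection in the hyperplane orthogonal to the image of `1`; it is conjugate to
`x ↦ -x̄`. -/
def reflectionOne : E4 ≃ₗᵢ[ℝ] E4 := (ℝ ∙ A 1)ᗮ.reflection

theorem reflectionOne_apply (x : ℍ[ℝ]) : reflectionOne A (A x) = A (-star x) := by
  have := reflection_apply_unit A 1 x
  rw [Metric.unitSphere.coe_one, one_mul, mul_one] at this
  exact this

theorem reflectionOne_mul_self : reflectionOne A * reflectionOne A = 1 := by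
  refine isometry_ext A fun x => ?_
  show reflectionOne A (reflectionOne A (A x)) = A x
  rw [reflectionOne_apply, reflectionOne_apply, star_neg, star_star, neg_neg]

theorem reflectionOne_mul_twoSided (a b : UnitQuaternion) :
    reflectionOne A * twoSided A (a, b) = twoSided A (b, a) * reflectionOne A := by
  refine isometry_ext A fun x => ?_
  show reflectionOne A (twoSided A (a, b) (A x)) = twoSided A (b, a) (reflectionOne A (A x))
  rw [twoSided_apply, reflectionOne_apply, reflectionOne_apply, twoSided_apply, star_mul, star_mul,
    coe_inv_eq_star, coe_inv_eq_star, star_star, mul_neg, neg_mul, mul_assoc]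

theorem reflection_eq_twoSided_mul (s : UnitQuaternion) :
    (ℝ ∙ A s)ᗮ.reflection = twoSided A (s, s⁻¹) * reflectionOne A := by
  refine isometry_ext A fun x => ?_
  show _ = twoSided A (s, s⁻¹) (reflectionOne A (A x))
  rw [reflection_apply_unit, reflectionOne_apply, twoSided_apply, inv_inv, mul_neg, neg_mul]

theorem reflection_mul_reflection (s t : UnitQuaternion) :
    (ℝ ∙ A s)ᗮ.reflection * (ℝ ∙ A t)ᗮ.reflection = twoSided A (s * t⁻¹, s⁻¹ * t) := by
  rw [reflection_eq_twoSided_mul, reflection_eq_twoSided_mul, mul_assoc, ← mul_assoc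
    (reflectionOne A), reflectionOne_mul_twoSided, mul_assoc, reflectionOne_mul_self, mul_one,
    ← map_mul]
  rfl

/-- Composing the identification `A` with quaternionic conjugation exchanges left and right
multiplications. -/
theorem twoSided_reflectionOne_trans (a b : UnitQuaternion) :
    twoSided (A.trans (reflectionOne A)) (a, b) = twoSided A (b, a) := by
  refine isometry_ext (A.trans (reflectionOne A)) fun x => ?_
  rw [twoSided_apply]
  show reflectionOne A (A _) = twoSided A (b, a) (reflectionOne A (A x))
  rw [← twoSided_apply]
  exact congrArg (fun f => f (A x)) (reflectionOne_mul_twoSided A a b)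

theorem isometryDet_reflectionOne : isometryDet (reflectionOne A) = -1 := by
  show LinearEquiv.det ((ℝ ∙ A 1)ᗮ.reflection).toLinearEquiv = -1
  have h := Submodule.linearEquiv_det_reflection (ℝ ∙ A 1)ᗮ
  have h0 : A 1 ≠ 0 := by simp
  rw [Submodule.orthogonal_orthogonal, finrank_span_singleton h0, pow_one] at h
  exact h

theorem exists_mul_self_eq_unit (a : UnitQuaternion) : ∃ s : UnitQuaternion, s * s = a := by
  obtain ⟨v, hv⟩ := exists_mul_self_eq (norm_eq_of_mem_sphere a)
  have h1 : ‖v‖ = 1 := by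
    have := congrArg norm hv
    rw [norm_mul, norm_eq_of_mem_sphere] at this
    nlinarith [norm_nonneg v]
  exact ⟨⟨v, mem_sphere_zero_iff_norm.2 h1⟩, Subtype.ext hv⟩

/-- The isometries `x ↦ a x b⁻¹` have determinant one: it is positive, as `a` and `b` are squares of
unit quaternions, and a root of unity, as `a` and `b` have finite order. -/
theorem isometryDet_twoSided {a b : UnitQuaternion} (ha : a ∈ binaryIcosahedralGroup)
    (hb : b ∈ binaryIcosahedralGroup) : isometryDet (twoSided A (a, b)) = 1 := by
  have hpos : 0 < ((isometryDet (twoSided A (a, b)) : ℝˣ) : ℝ) := by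
    obtain ⟨s, rfl⟩ := exists_mul_self_eq_unit a
    obtain ⟨t, rfl⟩ := exists_mul_self_eq_unit b
    rw [← Prod.mk_mul_mk, map_mul, map_mul, Units.val_mul]
    exact (mul_self_nonneg _).lt_of_ne' (mul_self_ne_zero.2 (Units.ne_zero _))
  have hpow : ∀ c : UnitQuaternion, c ∈ binaryIcosahedralGroup → c ^ 120 = 1 := by
    intro c hc
    have := pow_card_eq_one' (x := (⟨c, hc⟩ : binaryIcosahedralGroup))
    rw [Icosian.card_binaryIcosahedralGroup] at this
    exact congrArg Subtype.val this
  have h1 : isometryDet (twoSided A (a, b)) ^ 120 = 1 := by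
    rw [← map_pow, ← map_pow, Prod.pow_mk, hpow a ha, hpow b hb]
    show isometryDet (twoSided A 1) = 1
    rw [map_one, map_one]
  refine Units.ext ?_
  have h2 := congrArg Units.val h1
  rw [Units.val_pow_eq_pow_val, Units.val_one] at h2
  exact (pow_eq_one_iff_of_nonneg hpos.le (by norm_num)).1 h2

end TwoSided

/-! ### The tetrahedral group -/

namespace Icosian

/-- The normals of the faces of a Coxeter tetrahedron with Coxeter group `H₄`. -/
def root : Fin 4 → Icosian :=
  ![((-1, 1), (-1, 0), (0, 1), (0, 0)), ((0, 0), (0, 0), (0, 0), (-2, 0)),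
    ((0, 0), (0, 0), (-2, 0), (0, 0)), ((-1, 0), (1, 0), (1, 0), (1, 0))]

theorem root_mem : ∀ i, root i ∈ all ∧ conj (root i) ∈ all := by decide +kernel

/-- The left factor of the product of the reflections in four roots. -/
def leftFactor (i j k l : Fin 4) : Icosian :=
  [root i, conj (root j), root k, conj (root l)].foldr mul one

/-- The right factor of the product of the reflections in four roots. -/
def rightFactor (i j k l : Fin 4) : Icosian :=
  [conj (root i), root j, conj (root k), root l].foldr mul one

theorem unit_leftFactor (i j k l : Fin 4) : leftFactor i j k l ∈ all ∧
    unit (leftFactor i j k l) =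
      unit (root i) * (unit (root j))⁻¹ * (unit (root k) * (unit (root l))⁻¹) := by
  obtain ⟨h1, h2⟩ := list_prod_unit [root i, conj (root j), root k, conj (root l)] (by
    simp only [List.mem_cons, List.not_mem_nil, or_false]
    rintro x (rfl | rfl | rfl | rfl)
    exacts [(root_mem _).1, (root_mem _).2, (root_mem _).1, (root_mem _).2])
  refine ⟨h1, h2.symm.trans ?_⟩
  simp only [List.map_cons, List.map_nil, List.prod_cons, List.prod_nil, mul_one,
    unit_conj (root_mem _).1 (root_mem _).2, mul_assoc]

theorem unit_rightFactor (i j k l : Fin 4) : rightFactor i j k l ∈ all ∧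
    unit (rightFactor i j k l) =
      (unit (root i))⁻¹ * unit (root j) * ((unit (root k))⁻¹ * unit (root l)) := by
  obtain ⟨h1, h2⟩ := list_prod_unit [conj (root i), root j, conj (root k), root l] (by
    simp only [List.mem_cons, List.not_mem_nil, or_false]
    rintro x (rfl | rfl | rfl | rfl)
    exacts [(root_mem _).2, (root_mem _).1, (root_mem _).2, (root_mem _).1])
  refine ⟨h1, h2.symm.trans ?_⟩
  simp only [List.map_cons, List.map_nil, List.prod_cons, List.prod_nil, mul_one,
    unit_conj (root_mem _).1 (root_mem _).2, mul_assoc]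

variable {A : ℍ[ℝ] ≃ₗᵢ[ℝ] E4} {ν : Fin 4 → E4}

theorem reflection_mem (hν : ∀ i, A (unit (root i)) = ν i) (i : Fin 4) :
    (ℝ ∙ A (unit (root i)))ᗮ.reflection ∈ coxeterGroup ν := by
  rw [hν]
  exact Subgroup.subset_closure ⟨i, rfl⟩

/-- A power of a Coxeter element whose right factor is trivial. -/
theorem twoSided_leftFactor_mem (hν : ∀ i, A (unit (root i)) = ν i) (i j k l : Fin 4) (n : ℕ)
    (hn : (List.replicate n (rightFactor i j k l)).foldr mul one = one) :
    twoSided A (unit (leftFactor i j k l) ^ n, 1) ∈ coxeterGroup ν := by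
  have h1 : twoSided A (unit (leftFactor i j k l), unit (rightFactor i j k l)) ∈
      coxeterGroup ν := by
    rw [(unit_leftFactor i j k l).2, (unit_rightFactor i j k l).2, ← Prod.mk_mul_mk, map_mul,
      ← reflection_mul_reflection, ← reflection_mul_reflection]
    exact mul_mem (mul_mem (reflection_mem hν i) (reflection_mem hν j))
      (mul_mem (reflection_mem hν k) (reflection_mem hν l))
  have h2 := pow_mem h1 n
  rwa [← map_pow, Prod.pow_mk, unit_pow (unit_rightFactor i j k l).1, hn, unit_one] at h2

/-- The Coxeter group contains the left multiplications by the binary icosahedral group. A Coxeter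
element of `H₄` has order `30` and is of the form `x ↦ a x b⁻¹`, where the orders of `a` and `b`
divide `10` and `6`, up to exchange. So it has powers which are left multiplications, and those of
three Coxeter elements generate the group. -/
theorem twoSided_left_mem (hν : ∀ i, A (unit (root i)) = ν i) {a : UnitQuaternion}
    (ha : a ∈ binaryIcosahedralGroup) : twoSided A (a, 1) ∈ coxeterGroup ν := by
  let N : Subgroup UnitQuaternion :=
    (coxeterGroup ν).comap ((twoSided A).comp (MonoidHom.inl _ _))
  have h1 : unit (leftFactor 0 3 1 2) ^ 6 ∈ N :=
    twoSided_leftFactor_mem hν 0 3 1 2 6 (by decide +kernel)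
  have h2 : unit (leftFactor 0 2 3 1) ^ 6 ∈ N :=
    twoSided_leftFactor_mem hν 0 2 3 1 6 (by decide +kernel)
  have h3 : unit (leftFactor 0 1 3 2) ^ 5 ∈ N :=
    twoSided_leftFactor_mem hν 0 1 3 2 5 (by decide +kernel)
  suffices h : binaryIcosahedralGroup ≤ N from h ha
  rw [closure_hur_zeta, Subgroup.closure_le]
  rintro _ (rfl | rfl)
  · have e : unit hur = (unit (leftFactor 0 3 1 2) ^ 6) ^ 4 * (unit (leftFactor 0 1 3 2) ^ 5) ^ 2 := by
      rw [← pow_mul, ← pow_mul, unit_pow (unit_leftFactor _ _ _ _).1,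
        unit_pow (unit_leftFactor _ _ _ _).1, unit_mul (by decide +kernel) (by decide +kernel)]
      exact congrArg unit (by decide +kernel)
    rw [e]
    exact mul_mem (pow_mem h1 4) (pow_mem h3 2)
  · have e : unit zeta = (unit (leftFactor 0 3 1 2) ^ 6) ^ 3 * (unit (leftFactor 0 2 3 1) ^ 6) ^ 2 := by
      rw [← pow_mul, ← pow_mul, unit_pow (unit_leftFactor _ _ _ _).1,
        unit_pow (unit_leftFactor _ _ _ _).1, unit_mul (by decide +kernel) (by decide +kernel)]
      exact congrArg unit (by decide +kernel)
    rw [e]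
    exact mul_mem (pow_mem h1 3) (pow_mem h2 2)

theorem twoSided_mem (hν : ∀ i, A (unit (root i)) = ν i) {a b : UnitQuaternion}
    (ha : a ∈ binaryIcosahedralGroup) (hb : b ∈ binaryIcosahedralGroup) :
    twoSided A (a, b) ∈ coxeterGroup ν := by
  -- conjugation with a reflection exchanges the two factors
  have hs := unit_mem (root_mem 0).1
  have h1 := reflection_mem hν 0
  have h2 := mul_mem (mul_mem h1 (twoSided_left_mem hν (mul_mem (mul_mem hs hb) (inv_mem hs)))) h1
  rw [reflection_eq_twoSided_mul, mul_assoc (twoSided A _) (reflectionOne A),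
    reflectionOne_mul_twoSided, mul_assoc, mul_assoc, ← mul_assoc (reflectionOne A),
    reflectionOne_mul_twoSided, mul_assoc (twoSided A _) (reflectionOne A),
    reflectionOne_mul_self, mul_one, ← map_mul, ← map_mul] at h2
  have h3 := mul_mem (twoSided_left_mem hν ha) h2
  rw [← map_mul] at h3
  convert h3 using 2
  simp only [Prod.mk_mul_mk]
  refine Prod.ext ?_ ?_ <;> simp only <;> group

/-- The elements of the Coxeter group are of the form `x ↦ a x b⁻¹` or `x ↦ -a x̄ b⁻¹`, as the
generating reflections are of the second form. -/
theorem exists_of_mem_coxeterGroup (hν : ∀ i, A (unit (root i)) = ν i) {g : E4 ≃ₗᵢ[ℝ] E4}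
    (hg : g ∈ coxeterGroup ν) : ∃ a ∈ binaryIcosahedralGroup, ∃ b ∈ binaryIcosahedralGroup,
      g = twoSided A (a, b) ∨ g = twoSided A (a, b) * reflectionOne A := by
  refine Subgroup.closure_induction (p := fun g _ => ∃ a ∈ binaryIcosahedralGroup,
    ∃ b ∈ binaryIcosahedralGroup, g = twoSided A (a, b) ∨ g = twoSided A (a, b) * reflectionOne A)
    ?_ ?_ ?_ ?_ hg
  · rintro _ ⟨i, rfl⟩
    have hs := unit_mem (root_mem i).1
    refine ⟨_, hs, _, inv_mem hs, Or.inr ?_⟩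
    simp only [← hν]
    exact reflection_eq_twoSided_mul A _
  · exact ⟨1, one_mem _, 1, one_mem _, Or.inl (map_one _).symm⟩
  · rintro g h - - ⟨a, ha, b, hb, hg⟩ ⟨c, hc, d, hd, hh⟩
    have h1 : twoSided A (a, b) * reflectionOne A * twoSided A (c, d) =
        twoSided A (a * d, b * c) * reflectionOne A := by
      rw [mul_assoc, reflectionOne_mul_twoSided, ← mul_assoc, ← map_mul]; rfl
    rcases hg with rfl | rfl <;> rcases hh with rfl | rfl
    · exact ⟨_, mul_mem ha hc, _, mul_mem hb hd, Or.inl (map_mul _ _ _).symm⟩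
    · refine ⟨_, mul_mem ha hc, _, mul_mem hb hd, Or.inr ?_⟩
      rw [← mul_assoc, ← map_mul]; rfl
    · exact ⟨_, mul_mem ha hd, _, mul_mem hb hc, Or.inr h1⟩
    · refine ⟨_, mul_mem ha hd, _, mul_mem hb hc, Or.inl ?_⟩
      rw [← mul_assoc, h1, mul_assoc, reflectionOne_mul_self, mul_one]
  · rintro g - ⟨a, ha, b, hb, rfl | rfl⟩
    · exact ⟨_, inv_mem ha, _, inv_mem hb, Or.inl (map_inv _ _).symm⟩
    · refine ⟨_, inv_mem hb, _, inv_mem ha, Or.inr ?_⟩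
      rw [mul_inv_rev, ← map_inv, ← reflectionOne_mul_twoSided,
        inv_eq_of_mul_eq_one_left (reflectionOne_mul_self A)]
      rfl

/-- The tetrahedral group consists of the rotations `x ↦ a x b⁻¹` with `a` and `b` in the binary
icosahedral group. -/
theorem mem_tetrahedralGroup_iff (hν : ∀ i, A (unit (root i)) = ν i) {g : E4 ≃ₗᵢ[ℝ] E4} :
    g ∈ tetrahedralGroup ν ↔ ∃ a ∈ binaryIcosahedralGroup, ∃ b ∈ binaryIcosahedralGroup,
      g = twoSided A (a, b) := by
  constructor
  · rintro ⟨h1, h2⟩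
    obtain ⟨a, ha, b, hb, h | h⟩ := exists_of_mem_coxeterGroup hν h1
    · exact ⟨a, ha, b, hb, h⟩
    · have h3 : isometryDet g = 1 := h2
      rw [h, map_mul, isometryDet_twoSided A ha hb, isometryDet_reflectionOne, one_mul] at h3
      have := congrArg Units.val h3
      norm_num at this
  · rintro ⟨a, ha, b, hb, rfl⟩
    exact ⟨twoSided_mem hν ha hb, isometryDet_twoSided A ha hb⟩

end Icosian

/-! ### Coxeter tetrahedra and unit icosians -/

namespace Icosian

theorem inner_toH (x y : Icosian) : ⟪toH x, toH y⟫_ℝ =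
    (x.1.toReal * y.1.toReal + x.2.1.toReal * y.2.1.toReal + x.2.2.1.toReal * y.2.2.1.toReal +
      x.2.2.2.toReal * y.2.2.2.toReal) / 4 := by
  rw [quaternion_inner_eq]
  simp only [toH]
  ring

/-- The matrix `-cos (π / mᵢⱼ)` of the Coxeter group `H₄`. -/
theorem inner_root :
    ⟪toH (root 0), toH (root 2)⟫_ℝ = -Real.cos (Real.pi / (5 : ℕ)) ∧
    ⟪toH (root 1), toH (root 3)⟫_ℝ = -Real.cos (Real.pi / (3 : ℕ)) ∧
    ⟪toH (root 1), toH (root 2)⟫_ℝ = -Real.cos (Real.pi / (2 : ℕ)) ∧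
    ⟪toH (root 0), toH (root 3)⟫_ℝ = -Real.cos (Real.pi / (2 : ℕ)) ∧
    ⟪toH (root 0), toH (root 1)⟫_ℝ = -Real.cos (Real.pi / (2 : ℕ)) ∧
    ⟪toH (root 2), toH (root 3)⟫_ℝ = -Real.cos (Real.pi / (3 : ℕ)) := by
  simp only [inner_toH, Nat.cast_ofNat, Real.cos_pi_div_five, Real.cos_pi_div_two,
    Real.cos_pi_div_three]
  refine ⟨?_, ?_, ?_, ?_, ?_, ?_⟩ <;> simp [root, GoldenInt.toReal, Real.goldenRatio] <;> ring

theorem linearIndependent_root : LinearIndependent ℝ fun i => toH (root i) := by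
  rw [Fintype.linearIndependent_iff]
  intro c hc
  rw [Fin.sum_univ_four] at hc
  have hb := goldenRatio_bounds
  have e0 : (c 0 • toH (root 0) + c 1 • toH (root 1) + c 2 • toH (root 2) +
    c 3 • toH (root 3)).re = 0 := by rw [hc]; rfl
  have e1 : (c 0 • toH (root 0) + c 1 • toH (root 1) + c 2 • toH (root 2) +
    c 3 • toH (root 3)).imI = 0 := by rw [hc]; rfl
  have e2 : (c 0 • toH (root 0) + c 1 • toH (root 1) + c 2 • toH (root 2) +
    c 3 • toH (root 3)).imJ = 0 := by rw [hc]; rfl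
  have e3 : (c 0 • toH (root 0) + c 1 • toH (root 1) + c 2 • toH (root 2) +
    c 3 • toH (root 3)).imK = 0 := by rw [hc]; rfl
  simp only [Quaternion.re_add, Quaternion.imI_add, Quaternion.imJ_add, Quaternion.imK_add,
    Quaternion.re_smul, Quaternion.imI_smul, Quaternion.imJ_smul, Quaternion.imK_smul,
    smul_eq_mul] at e0 e1 e2 e3
  simp [toH, root, GoldenInt.toReal] at e0 e1 e2 e3
  have h0 : c 0 = 0 := by
    have : c 0 * (φ - 2) = 0 := by linarith
    rcases mul_eq_zero.1 this with h | h
    · exact h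
    · linarith
  rw [h0] at e0 e1 e2
  intro i
  fin_cases i
  · exact h0
  all_goals simp only [Fin.mk_one, Fin.reduceFinMk]; linarith

/-- The Coxeter tetrahedron exists. -/
theorem isSphericalCoxeterTetrahedron_root (A : ℍ[ℝ] ≃ₗᵢ[ℝ] E4) :
    IsSphericalCoxeterTetrahedron 5 3 2 2 2 3 fun i => A (toH (root i)) := by
  obtain ⟨h1, h2, h3, h4, h5, h6⟩ := inner_root
  refine ⟨?_, fun i => ?_, ?_, ?_, ?_, ?_, ?_, ?_⟩
  · exact linearIndependent_root.map' (A.toLinearEquiv : ℍ[ℝ] →ₗ[ℝ] E4) A.toLinearEquiv.ker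
  · rw [LinearIsometryEquiv.norm_map]
    exact (isUnitIcosian_of_mem (root_mem i).1).norm
  all_goals rwa [LinearIsometryEquiv.inner_map_map]

/-- The Coxeter tetrahedron is unique up to isometry, since it is determined by its Gram matrix. -/
theorem exists_isometry_root {ν : Fin 4 → E4} (hν : IsSphericalCoxeterTetrahedron 5 3 2 2 2 3 ν) :
    ∃ A : ℍ[ℝ] ≃ₗᵢ[ℝ] E4, ∀ i, A (unit (root i)) = ν i := by
  have hc : Fintype.card (Fin 4) = Module.finrank ℝ ℍ[ℝ] := by
    rw [Quaternion.finrank_eq_four, Fintype.card_fin]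
  have hc' : Fintype.card (Fin 4) = Module.finrank ℝ E4 := by
    rw [finrank_euclideanSpace]
  let b := basisOfLinearIndependentOfCardEqFinrank linearIndependent_root hc
  let b' := basisOfLinearIndependentOfCardEqFinrank hν.linearIndependent hc'
  let L : ℍ[ℝ] ≃ₗ[ℝ] E4 := b.equiv b' (Equiv.refl _)
  have hb : ∀ i, b i = toH (root i) := fun i =>
    congrFun (coe_basisOfLinearIndependentOfCardEqFinrank linearIndependent_root hc) i
  have hL : ∀ i, L (toH (root i)) = ν i := by
    intro i
    rw [← hb, Module.Basis.equiv_apply]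
    exact congrFun (coe_basisOfLinearIndependentOfCardEqFinrank hν.linearIndependent hc') i
  have hgram : ∀ i j, ⟪ν i, ν j⟫_ℝ = ⟪toH (root i), toH (root j)⟫_ℝ := by
    obtain ⟨h1, h2, h3, h4, h5, h6⟩ := inner_root
    have hs : ∀ i, ⟪ν i, ν i⟫_ℝ = ⟪toH (root i), toH (root i)⟫_ℝ := fun i => by
      rw [real_inner_self_eq_norm_sq, real_inner_self_eq_norm_sq, hν.norm_eq,
        (isUnitIcosian_of_mem (root_mem i).1).norm]
    have hlt : ∀ i j, i < j → ⟪ν i, ν j⟫_ℝ = ⟪toH (root i), toH (root j)⟫_ℝ := by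
      intro i j hij
      fin_cases i <;> fin_cases j <;> simp at hij
      exacts [hν.angle_c.trans h5.symm, hν.angle_n.trans h1.symm, hν.angle_b.trans h4.symm,
        hν.angle_a.trans h3.symm, hν.angle_m.trans h2.symm, hν.angle_d.trans h6.symm]
    intro i j
    rcases lt_trichotomy i j with h | rfl | h
    · exact hlt i j h
    · exact hs i
    · rw [real_inner_comm, hlt j i h, real_inner_comm]
  have hinner : ∀ x y, ⟪L x, L y⟫_ℝ = ⟪x, y⟫_ℝ := by
    have h : (innerₗ E4).compl₁₂ (L : ℍ[ℝ] →ₗ[ℝ] E4) L = innerₗ ℍ[ℝ] := by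
      refine LinearMap.BilinForm.ext_basis b fun i j => ?_
      rw [LinearMap.compl₁₂_apply, innerₗ_apply_apply, innerₗ_apply_apply, hb, hb]
      show ⟪L _, L _⟫_ℝ = _
      rw [hL, hL, hgram]
    exact fun x y => LinearMap.congr_fun₂ h x y
  refine ⟨L.isometryOfInner hinner, fun i => ?_⟩
  rw [coe_unit (root_mem i).1]
  exact hL i

end Icosian

/-- The central quaternions are real. -/
theorem star_eq_self_of_forall_mul_comm {q : ℍ[ℝ]} (h : ∀ x, q * x = x * q) : star q = q := by
  have hi : q * Icosian.toH Icosian.unitI = Icosian.toH Icosian.unitI * q := h _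
  have hj : q * Icosian.toH Icosian.unitJ = Icosian.toH Icosian.unitJ * q := h _
  have h1 := congrArg (fun x : ℍ[ℝ] => x.imK) hi
  have h2 := congrArg (fun x : ℍ[ℝ] => x.imJ) hi
  have h3 := congrArg (fun x : ℍ[ℝ] => x.imK) hj
  simp only [Quaternion.imK_mul, Quaternion.imJ_mul] at h1 h2 h3
  simp [Icosian.toH, Icosian.unitI, Icosian.unitJ, GoldenInt.toReal] at h1 h2 h3
  apply Quaternion.ext
  · rw [Quaternion.re_star]
  · rw [Quaternion.imI_star]; linarith
  · rw [Quaternion.imJ_star]; linarith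
  · rw [Quaternion.imK_star]; linarith

/-! ### Surjections onto the alternating group -/

/-- If a simple centreless group is a quotient of a direct product, then one of the two factors
lies in the kernel. -/
theorem forall_eq_one_or_forall_eq_one {G H S : Type*} [Group G] [Group H] [Group S]
    [IsSimpleGroup S] (hS : Subgroup.center S = ⊥) (F : G × H →* S) (hF : Function.Surjective F) :
    (∀ a, F (a, 1) = 1) ∨ ∀ b, F (1, b) = 1 := by
  have hab : ∀ a b, F (a, b) = F (a, 1) * F (1, b) := fun a b => by
    rw [← map_mul, Prod.mk_mul_mk, mul_one, one_mul]
  have hcomm : ∀ a b, F (a, 1) * F (1, b) = F (1, b) * F (a, 1) := fun a b => by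
    rw [← map_mul, ← map_mul, Prod.mk_mul_mk, Prod.mk_mul_mk, mul_one, one_mul, one_mul, mul_one]
  let N := (F.comp (MonoidHom.inl G H)).range
  have hN : N.Normal := by
    refine ⟨?_⟩
    rintro _ ⟨c, rfl⟩ g
    obtain ⟨⟨a, b⟩, rfl⟩ := hF g
    refine ⟨a * c * a⁻¹, ?_⟩
    show F (a * c * a⁻¹, 1) = F (a, b) * F (c, 1) * (F (a, b))⁻¹
    rw [← map_inv, ← map_mul, ← map_mul]
    congr 1
    simp
  -- The image of the first factor is normal. If it is trivial, the first factor is in the kernel;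
  -- otherwise it is everything, and the image of the second factor, which commutes with it, is
  -- central.
  rcases hN.eq_bot_or_eq_top with h | h
  · refine Or.inl fun a => ?_
    have : F (a, 1) ∈ N := ⟨a, rfl⟩
    rwa [h, Subgroup.mem_bot] at this
  · refine Or.inr fun b => ?_
    have : F (1, b) ∈ Subgroup.center S := by
      rw [Subgroup.mem_center_iff]
      intro g
      obtain ⟨a, rfl⟩ : g ∈ N := h ▸ Subgroup.mem_top g
      exact hcomm a b
    rwa [hS, Subgroup.mem_bot] at this

section Surjection

variable {A : ℍ[ℝ] ≃ₗᵢ[ℝ] E4} {T : Subgroup (E4 ≃ₗᵢ[ℝ] E4)}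

/-- The isometry `A` identifies `T` with the group of the rotations `x ↦ a x b⁻¹` with `a` and `b`
in the binary icosahedral group. -/
def IsIcosahedralModel (A : ℍ[ℝ] ≃ₗᵢ[ℝ] E4) (T : Subgroup (E4 ≃ₗᵢ[ℝ] E4)) : Prop :=
  ∀ g, g ∈ T ↔ ∃ a ∈ binaryIcosahedralGroup, ∃ b ∈ binaryIcosahedralGroup, g = twoSided A (a, b)

namespace IsIcosahedralModel

/-- The two factors of the rotations may be exchanged. -/
theorem reflectionOne_trans (hT : IsIcosahedralModel A T) :
    IsIcosahedralModel (A.trans (reflectionOne A)) T := by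
  intro g
  simp only [hT g, twoSided_reflectionOne_trans]
  exact ⟨fun ⟨a, ha, b, hb, h⟩ => ⟨b, hb, a, ha, h⟩, fun ⟨a, ha, b, hb, h⟩ => ⟨b, hb, a, ha, h⟩⟩

/-- The covering of `T` by the product of two copies of the binary icosahedral group. -/
def hom (hT : IsIcosahedralModel A T) : binaryIcosahedralGroup × binaryIcosahedralGroup →* T :=
  ((twoSided A).comp (binaryIcosahedralGroup.subtype.prodMap
    binaryIcosahedralGroup.subtype)).codRestrict T fun p =>
      (hT _).2 ⟨p.1, p.1.2, p.2, p.2.2, rfl⟩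

theorem coe_hom (hT : IsIcosahedralModel A T) (a b : binaryIcosahedralGroup) :
    (hT.hom (a, b) : E4 ≃ₗᵢ[ℝ] E4) = twoSided A (a, b) := rfl

theorem hom_surjective (hT : IsIcosahedralModel A T) : Function.Surjective hT.hom := by
  rintro ⟨g, hg⟩
  obtain ⟨a, ha, b, hb, rfl⟩ := (hT g).1 hg
  exact ⟨(⟨a, ha⟩, ⟨b, hb⟩), rfl⟩

/-- The rotation `x ↦ a x b⁻¹` is trivial only for `a = b = ± 1`. -/
theorem eq_one_or_of_twoSided_eq_one {a b : UnitQuaternion} (h : twoSided A (a, b) = 1) :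
    (a : ℍ[ℝ]) = 1 ∨ (a : ℍ[ℝ]) = -1 := by
  have h1 : ∀ x : ℍ[ℝ], a * x * (b⁻¹ : UnitQuaternion) = x := fun x => by
    refine A.injective ?_
    rw [← twoSided_apply, h]
    rfl
  have hab : a = b := by
    have := h1 1
    rw [mul_one] at this
    exact mul_inv_eq_one.1 (Subtype.ext this)
  have h2 : ∀ x : ℍ[ℝ], (a : ℍ[ℝ]) * x = x * a := fun x => by
    have := congrArg (· * (a : ℍ[ℝ])) (h1 x)
    simp only [← hab] at this
    rwa [mul_assoc, coe_inv_mul_coe, mul_one] at this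
  have h3 : (a : ℍ[ℝ]) * a = 1 := by
    have : star (a : ℍ[ℝ]) = a := star_eq_self_of_forall_mul_comm h2
    have h4 := quaternion_self_mul_star (norm_eq_of_mem_sphere a)
    rwa [this] at h4
  exact mul_self_eq_one_iff.1 h3

/-- The group `T` maps onto the alternating group of degree 5. -/
theorem exists_surjective (hT : IsIcosahedralModel A T) :
    ∃ σ : T →* alternatingGroup (Fin 5), Function.Surjective σ := by
  obtain ⟨f, hf, hf'⟩ := Icosian.exists_hom_alternatingGroup
  let F := f.comp (MonoidHom.fst binaryIcosahedralGroup binaryIcosahedralGroup)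
  have hker : hT.hom.ker ≤ F.ker := by
    rintro ⟨a, b⟩ hab
    have h1 : twoSided A (a, b) = 1 := congrArg Subtype.val hab
    show f a = 1
    rcases eq_one_or_of_twoSided_eq_one h1 with h | h
    · have : a = 1 := Subtype.ext (Subtype.ext h)
      rw [this, map_one]
    · exact hf' a (Subtype.ext (h.trans Icosian.unit_negOne.symm))
  refine ⟨hT.hom.liftOfSurjective hT.hom_surjective ⟨F, hker⟩, fun g => ?_⟩
  obtain ⟨a, rfl⟩ := hf g
  exact ⟨hT.hom (a, 1), MonoidHom.liftOfRightInverse_comp_apply _ _ _ _ _⟩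

/-- If the left multiplications lie in the kernel of a surjection, then they are the kernel. -/
theorem mem_ker_iff_of_forall_eq_one (hT : IsIcosahedralModel A T)
    {σ : T →* alternatingGroup (Fin 5)} (hσ : Function.Surjective σ)
    (h : ∀ a, σ (hT.hom (a, 1)) = 1) (t : T) :
    t ∈ σ.ker ↔ ∃ a ∈ binaryIcosahedralGroup, (t : E4 ≃ₗᵢ[ℝ] E4) = twoSided A (a, 1) := by
  have hab : ∀ a b, σ (hT.hom (a, b)) = σ (hT.hom (1, b)) := fun a b => by
    have := map_mul (σ.comp hT.hom) (a, 1) (1, b)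
    rw [Prod.mk_mul_mk, mul_one, one_mul] at this
    simp only [MonoidHom.comp_apply] at this
    rw [this, h, one_mul]
  constructor
  · intro ht
    obtain ⟨⟨a, b⟩, rfl⟩ := hT.hom_surjective t
    have hs : Function.Surjective ((σ.comp hT.hom).comp (MonoidHom.inr _ _)) := by
      intro g
      obtain ⟨t, rfl⟩ := hσ g
      obtain ⟨⟨c, d⟩, rfl⟩ := hT.hom_surjective t
      exact ⟨d, (hab c d).symm⟩
    -- The right factor of an element of the kernel is `±1`, hence can be moved to the left.
    have hb := Icosian.sq_eq_one_of_surjective _ hs (q := b) ((hab a b).symm.trans ht)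
    have hb' := Icosian.coe_eq_or_of_sq (congrArg Subtype.val hb)
    refine ⟨a * b, mul_mem a.2 b.2, isometry_ext A fun x => ?_⟩
    rw [coe_hom, twoSided_apply, twoSided_apply, coe_inv_eq_star, inv_one]
    show A _ = A ((a : UnitQuaternion) * ((b : UnitQuaternion) : ℍ[ℝ]) * x * 1)
    rcases hb' with h' | h' <;> rw [h'] <;> simp
  · rintro ⟨a, ha, e⟩
    have : t = hT.hom (⟨a, ha⟩, 1) := Subtype.ext e
    rw [this]
    exact h _

end IsIcosahedralModel

end Surjection

/-- The kernel of a surjection onto the alternating group of degree 5 is a group of left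
multiplications, after composing with the conjugation of the quaternions if necessary. -/
theorem exists_isIcosahedralModel {ν : Fin 4 → E4}
    (hν : IsSphericalCoxeterTetrahedron 5 3 2 2 2 3 ν)
    {σ : tetrahedralGroup ν →* alternatingGroup (Fin 5)} (hσ : Function.Surjective σ) :
    ∃ A, IsIcosahedralModel A (tetrahedralGroup ν) ∧ ∀ t, t ∈ σ.ker ↔
      ∃ a ∈ binaryIcosahedralGroup, (t : E4 ≃ₗᵢ[ℝ] E4) = twoSided A (a, 1) := by
  obtain ⟨A, hA⟩ := Icosian.exists_isometry_root hν
  have hT : IsIcosahedralModel A (tetrahedralGroup ν) := fun g =>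
    Icosian.mem_tetrahedralGroup_iff hA
  have : IsSimpleGroup (alternatingGroup (Fin 5)) := alternatingGroup.isSimpleGroup (by simp)
  rcases forall_eq_one_or_forall_eq_one (alternatingGroup.center_eq_bot (by simp))
    (σ.comp hT.hom) (hσ.comp hT.hom_surjective) with h | h
  · exact ⟨A, hT, hT.mem_ker_iff_of_forall_eq_one hσ h⟩
  · refine ⟨_, hT.reflectionOne_trans, hT.reflectionOne_trans.mem_ker_iff_of_forall_eq_one hσ
      fun a => ?_⟩
    have : hT.reflectionOne_trans.hom (a, 1) = hT.hom (1, a) := 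
      Subtype.ext (twoSided_reflectionOne_trans A a 1)
    rw [this]
    exact h a

/-! ### The quotient of the 3-sphere -/

section SphereMap

variable (A : ℍ[ℝ] ≃ₗᵢ[ℝ] E4)

theorem continuous_sphereMap {E F : Type*} [NormedAddCommGroup E] [NormedSpace ℝ E]
    [NormedAddCommGroup F] [NormedSpace ℝ F] (B : E ≃ₗᵢ[ℝ] F) : Continuous (sphereMap B) :=
  (B.continuous.comp continuous_subtype_val).subtype_mk _

theorem sphereMap_symm_apply (x : S3) : sphereMap A (sphereMap A.symm x) = x :=
  Subtype.ext (A.apply_symm_apply x)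

theorem sphereMap_apply_symm (q : UnitQuaternion) : sphereMap A.symm (sphereMap A q) = q :=
  Subtype.ext (A.symm_apply_apply q)

theorem contMDiff_sphereMap : ContMDiff (𝓡 3) (𝓡 3) ∞ (sphereMap A) := by
  have : Fact (Module.finrank ℝ E4 = 3 + 1) := ⟨finrank_euclideanSpace_fin⟩
  have h : ContMDiff (𝓡 3) 𝓘(ℝ, E4) ∞ fun x : UnitQuaternion => A (x : ℍ[ℝ]) :=
    A.toContinuousLinearEquiv.contDiff.contMDiff.comp contMDiff_coe_sphere
  exact h.codRestrict_sphere fun x => (sphereMap A x).2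

theorem contMDiff_sphereMap_symm : ContMDiff (𝓡 3) (𝓡 3) ∞ (sphereMap A.symm) := by
  have : Fact (Module.finrank ℝ E4 = 3 + 1) := ⟨finrank_euclideanSpace_fin⟩
  have h : ContMDiff (𝓡 3) 𝓘(ℝ, ℍ[ℝ]) ∞ fun x : S3 => A.symm (x : E4) :=
    A.symm.toContinuousLinearEquiv.contDiff.contMDiff.comp contMDiff_coe_sphere
  exact h.codRestrict_sphere fun x => (sphereMap A.symm x).2

/-- The diffeomorphism between the 3-sphere and the unit quaternions induced by an isometry. -/
def sphereDiffeomorph : Diffeomorph (𝓡 3) (𝓡 3) S3 UnitQuaternion ∞ where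
  toFun := sphereMap A.symm
  invFun := sphereMap A
  left_inv := sphereMap_symm_apply A
  right_inv := sphereMap_apply_symm A
  contMDiff_toFun := contMDiff_sphereMap_symm A
  contMDiff_invFun := contMDiff_sphereMap A

theorem sphereMap_twoSided {T : Subgroup (E4 ≃ₗᵢ[ℝ] E4)} {t : T} {a b : UnitQuaternion}
    (h : (t : E4 ≃ₗᵢ[ℝ] E4) = twoSided A (a, b)) (q : UnitQuaternion) :
    t • sphereMap A q = sphereMap A (a * q * b⁻¹) := by
  refine Subtype.ext ?_
  show (t : E4 ≃ₗᵢ[ℝ] E4) (A q) = A _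
  rw [h, twoSided_apply]
  rfl

end SphereMap

section Quotient

variable {A : ℍ[ℝ] ≃ₗᵢ[ℝ] E4} {T : Subgroup (E4 ≃ₗᵢ[ℝ] E4)} {K : Subgroup T}

instance : ContinuousConstSMul K S3 := ⟨fun k => continuous_sphereMap (k : T).1⟩

/-- The elements of `K` correspond to the left multiplications with elements of the binary
icosahedral group. -/
def IsLeftIcosahedral (A : ℍ[ℝ] ≃ₗᵢ[ℝ] E4) (K : Subgroup T) : Prop :=
  ∀ t : T, t ∈ K ↔ ∃ a ∈ binaryIcosahedralGroup, (t : E4 ≃ₗᵢ[ℝ] E4) = twoSided A (a, 1)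

namespace IsLeftIcosahedral

/-- Left multiplications act freely. -/
theorem eq_one_of_smul_eq (hK : IsLeftIcosahedral A K) {k : T} (hk : k ∈ K) {x : S3}
    (hx : k • x = x) : k = 1 := by
  obtain ⟨a, -, h⟩ := (hK k).1 hk
  rw [← sphereMap_symm_apply A x, sphereMap_twoSided A h] at hx
  have h1 := congrArg (sphereMap A.symm) hx
  rw [sphereMap_apply_symm, sphereMap_apply_symm, inv_one, mul_one, mul_eq_right] at h1
  refine Subtype.ext ?_
  rw [h, h1]
  exact map_one _

/-- The fibres of the quotient projection are the orbits of the left multiplications. -/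
theorem sphereProj_eq_iff (hK : IsLeftIcosahedral A K) (hT : IsIcosahedralModel A T)
    (x y : UnitQuaternion) : sphereProj K (sphereMap A x) = sphereProj K (sphereMap A y) ↔
      ∃ b ∈ binaryIcosahedralGroup, y = b * x := by
  have h0 : sphereProj K (sphereMap A x) = sphereProj K (sphereMap A y) ↔
      ∃ k : K, k • sphereMap A x = sphereMap A y := by
    rw [eq_comm]
    exact Quotient.eq
  rw [h0]
  constructor
  · rintro ⟨⟨k, hk⟩, e⟩
    obtain ⟨a, ha, h⟩ := (hK k).1 hk
    refine ⟨a, ha, ?_⟩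
    have e' : k • sphereMap A x = sphereMap A y := e
    rw [sphereMap_twoSided A h] at e'
    have h1 := congrArg (sphereMap A.symm) e'
    rw [sphereMap_apply_symm, sphereMap_apply_symm, inv_one, mul_one] at h1
    exact h1.symm
  · rintro ⟨b, hb, rfl⟩
    have hbT := (hT _).2 ⟨b, hb, 1, one_mem _, rfl⟩
    refine ⟨⟨⟨twoSided A (b, 1), hbT⟩, (hK _).2 ⟨b, hb, rfl⟩⟩, ?_⟩
    refine (sphereMap_twoSided A (t := ⟨_, hbT⟩) rfl x).trans ?_
    rw [inv_one, mul_one]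

theorem isIcosahedralQuotient (hK : IsLeftIcosahedral A K) (hT : IsIcosahedralModel A T) :
    IsIcosahedralQuotient fun q => sphereProj K (sphereMap A q) where
  continuous := continuous_quotient_mk'.comp (continuous_sphereMap A)
  isOpenMap := by
    have h : IsOpenMap (sphereProj K) := isOpenMap_quotient_mk'_mul
    exact h.comp (sphereDiffeomorph A).symm.toHomeomorph.isOpenMap
  surjective y := by
    obtain ⟨x, rfl⟩ := Quotient.exists_rep y
    refine ⟨sphereMap A.symm x, ?_⟩
    simp only [sphereMap_symm_apply]
    rfl
  fibres := hK.sphereProj_eq_iff hT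

theorem isLocalDiffeomorph_sphereProj (hK : IsLeftIcosahedral A K) (hT : IsIcosahedralModel A T) :
    letI := (hK.isIcosahedralQuotient hT).chartedSpace
    IsLocalDiffeomorph (𝓡 3) (𝓡 3) ∞ (sphereProj K) := by
  let := (hK.isIcosahedralQuotient hT).chartedSpace
  intro x
  have h := ((sphereDiffeomorph A).isLocalDiffeomorph x).comp (𝓡 3) _
    ((hK.isIcosahedralQuotient hT).isLocalDiffeomorph _)
  have e : (fun q => sphereProj K (sphereMap A q)) ∘ sphereDiffeomorph A = sphereProj K := by
    ext y
    show sphereProj K (sphereMap A (sphereMap A.symm y)) = _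
    rw [sphereMap_symm_apply]
  rwa [e] at h

end IsLeftIcosahedral

/-- The action of `T` on the orbit space of a normal subgroup. -/
def quotientAction (K : Subgroup T) [K.Normal] : T →* Equiv.Perm (SphereQuotient K) :=
  letI : MulAction T (SphereQuotient K) :=
    { smul := fun t => Quotient.map' (t • ·) (by
        rintro _ y ⟨k, rfl⟩
        refine ⟨⟨t * k * t⁻¹, ‹K.Normal›.conj_mem k k.2 t⟩, ?_⟩
        show (t * k * t⁻¹) • t • y = t • (k : T) • y
        rw [smul_smul, smul_smul, inv_mul_cancel_right])
      one_smul := by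
        rintro ⟨x⟩
        exact congrArg (sphereProj K) (one_smul T x)
      mul_smul := by
        rintro s t ⟨x⟩
        exact congrArg (sphereProj K) (mul_smul s t x) }
  MulAction.toPermHom _ _

theorem quotientAction_eq_one (K : Subgroup T) [K.Normal] {t : T} (ht : t ∈ K) :
    quotientAction K t = 1 := by
  ext1 y
  obtain ⟨x, rfl⟩ := Quotient.exists_rep y
  exact Quotient.sound ⟨⟨t, ht⟩, rfl⟩

/-- Right multiplication with `i` acts non-trivially on the quotient, as `x i x⁻¹` is not a unit
icosian for `x = (24 + 7 j) / 25`. -/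
theorem exists_forall_ne_mul : ∃ q ∈ binaryIcosahedralGroup, ∃ x : UnitQuaternion,
    ∀ b ∈ binaryIcosahedralGroup, x * q ≠ b * x := by
  have hi : Icosian.unitI ∈ Icosian.all := by decide +kernel
  let x : ℍ[ℝ] := ⟨24 / 25, 0, 7 / 25, 0⟩
  have hx : ‖x‖ = 1 := by
    have : ‖x‖ ^ 2 = 1 := by
      rw [← real_inner_self_eq_norm_sq, quaternion_inner_eq]
      simp only [x]; norm_num
    exact (pow_eq_one_iff_of_nonneg (norm_nonneg _) two_ne_zero).1 this
  refine ⟨_, Icosian.unit_mem hi, ⟨x, mem_sphere_zero_iff_norm.2 hx⟩, fun b hb h => ?_⟩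
  have h1 : x * Icosian.toH Icosian.unitI = (b : ℍ[ℝ]) * x := by
    rw [← Icosian.coe_unit hi]
    exact congrArg Subtype.val h
  have h2 : (b : ℍ[ℝ]) = x * Icosian.toH Icosian.unitI * star x := by
    rw [h1, mul_assoc, quaternion_self_mul_star hx, mul_one]
  have hI0 : (Icosian.toH Icosian.unitI).re = 0 := by
    simp [Icosian.toH, Icosian.unitI, GoldenInt.toReal]
  have hI1 : (Icosian.toH Icosian.unitI).imI = 1 := by
    simp [Icosian.toH, Icosian.unitI, GoldenInt.toReal]
  have hI2 : (Icosian.toH Icosian.unitI).imJ = 0 := by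
    simp [Icosian.toH, Icosian.unitI, GoldenInt.toReal]
  have hI3 : (Icosian.toH Icosian.unitI).imK = 0 := by
    simp [Icosian.toH, Icosian.unitI, GoldenInt.toReal]
  have h3 : (b : ℍ[ℝ]).imI = 527 / 625 := by
    rw [h2, Quaternion.imI_mul, Quaternion.re_mul, Quaternion.imI_mul, Quaternion.imJ_mul,
      Quaternion.imK_mul, Quaternion.re_star, Quaternion.imI_star, Quaternion.imJ_star,
      Quaternion.imK_star, hI0, hI1, hI2, hI3]
    simp only [x]
    norm_num
  have h4 : ⟪(b : ℍ[ℝ]), Icosian.toH Icosian.unitI⟫_ℝ = 527 / 625 := by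
    rw [quaternion_inner_eq, hI0, hI1, hI2, hI3, h3]
    norm_num
  have hb' := goldenRatio_bounds
  -- The number `527 / 625` lies between `φ / 2` and `1`, so it is not an inner product of two unit
  -- icosians.
  have h5 : (b : ℍ[ℝ]) ≠ Icosian.toH Icosian.unitI := by
    intro h
    rw [h, hI1] at h3
    norm_num at h3
  have := (isUnitIcosian_coe.2 hb).inner_le (Icosian.isUnitIcosian_of_mem hi) h5
  rw [h4] at this
  linarith

end Quotient

end PoincareSphere

end

open PoincareSphere in
theorem corollary2p7 :
    (∃ ν : Fin 4 → E4, IsSphericalCoxeterTetrahedron 5 3 2 2 2 3 ν) ∧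
    ∀ ν : Fin 4 → E4, IsSphericalCoxeterTetrahedron 5 3 2 2 2 3 ν →
      (∃ φ : tetrahedralGroup ν →* alternatingGroup (Fin 5), Function.Surjective φ) ∧
      ∀ φ : tetrahedralGroup ν →* alternatingGroup (Fin 5), Function.Surjective φ →
        -- the kernel acts freely on the 3-sphere
        (∀ k ∈ φ.ker, ∀ x : S3, k • x = x → k = 1) ∧
        -- the smooth structure on the quotient for which the projection is a local diffeomorphism
        ∃ _ : ChartedSpace E3 (SphereQuotient φ.ker),
          IsManifold (𝓡 3) ∞ (SphereQuotient φ.ker) ∧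
          IsLocalDiffeomorph (𝓡 3) (𝓡 3) ∞ (sphereProj φ.ker) ∧
          -- the quotient is (isometric to) the spherical Poincaré homology sphere
          (∃ A : Quaternion ℝ ≃ₗᵢ[ℝ] E4,
            IsPoincareSphere (fun q => sphereProj φ.ker (sphereMap A q))) ∧
          -- the projected action of the tetrahedral group
          ∃ ρ : alternatingGroup (Fin 5) →* Equiv.Perm (SphereQuotient φ.ker),
            (∀ (t : tetrahedralGroup ν) (x : S3),
              ρ (φ t) (sphereProj φ.ker x) = sphereProj φ.ker (t • x)) ∧
            IsType12 ρ 6 := by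
  refine ⟨⟨_, Icosian.isSphericalCoxeterTetrahedron_root Quaternion.linearIsometryEquivTuple⟩,
    fun ν hν => ⟨?_, fun φ hφ => ?_⟩⟩
  · obtain ⟨A, hA⟩ := Icosian.exists_isometry_root hν
    exact IsIcosahedralModel.exists_surjective (A := A) fun g =>
      Icosian.mem_tetrahedralGroup_iff hA
  -- In suitable coordinates, the kernel consists of left multiplications.
  obtain ⟨A, hT, hK⟩ := exists_isIcosahedralModel hν hφ
  replace hK : IsLeftIcosahedral A φ.ker := hK
  have hp := hK.isIcosahedralQuotient hT
  refine ⟨fun k hk x hx => hK.eq_one_of_smul_eq hk hx, hp.chartedSpace, hp.isManifold,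
    hK.isLocalDiffeomorph_sphereProj hT, ⟨A, ?_⟩, ?_⟩
  · let := hp.chartedSpace
    exact ⟨hp.isLocalDiffeomorph, hp.surjective, hp.fibres⟩
  let ρ : alternatingGroup (Fin 5) →* Equiv.Perm (SphereQuotient φ.ker) :=
    φ.liftOfSurjective hφ ⟨quotientAction φ.ker, fun t ht => quotientAction_eq_one φ.ker ht⟩
  have hρ : ∀ (t : tetrahedralGroup ν) (x : S3),
      ρ (φ t) (sphereProj φ.ker x) = sphereProj φ.ker (t • x) := by
    intro t x
    have : ρ (φ t) = quotientAction φ.ker t := MonoidHom.liftOfRightInverse_comp_apply _ _ _ _ _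
    rw [this]
    rfl
  -- On the quotient by left multiplications, `x ↦ a x b⁻¹` induces the right multiplication by
  -- `b⁻¹`.
  have hρ' : ∀ t : tetrahedralGroup ν, ∀ a ∈ binaryIcosahedralGroup, ∀ b,
      (t : E4 ≃ₗᵢ[ℝ] E4) = twoSided A (a, b) → ∀ x : UnitQuaternion,
      ρ (φ t) (sphereProj φ.ker (sphereMap A x)) = sphereProj φ.ker (sphereMap A (x * b⁻¹)) := by
    intro t a ha b h x
    rw [hρ, sphereMap_twoSided A h, eq_comm, hK.sphereProj_eq_iff hT]
    exact ⟨a, ha, mul_assoc _ _ _⟩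
  refine ⟨ρ, hρ, hp.isType12 ρ ?_ ?_ Icosian.card_alternatingGroup_five⟩
  · intro g
    obtain ⟨t, rfl⟩ := hφ g
    obtain ⟨a, ha, b, hb, h⟩ := (hT t).1 t.2
    exact ⟨b⁻¹, inv_mem hb, hρ' t a ha b h⟩
  · have : IsSimpleGroup (alternatingGroup (Fin 5)) := alternatingGroup.isSimpleGroup (by simp)
    rw [← MonoidHom.ker_eq_bot_iff]
    -- The action is faithful, since the group is simple and some right multiplication acts
    -- non-trivially.
    refine (ρ.normal_ker.eq_bot_or_eq_top).resolve_right fun htop => ?_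
    obtain ⟨q, hq, x, hx⟩ := exists_forall_ne_mul
    have hqT := (hT _).2 ⟨1, one_mem _, q⁻¹, inv_mem hq, rfl⟩
    have h1 := hρ' ⟨_, hqT⟩ 1 (one_mem _) q⁻¹ rfl x
    have h2 : ρ (φ ⟨_, hqT⟩) = 1 := by
      have : φ ⟨_, hqT⟩ ∈ ρ.ker := htop ▸ Subgroup.mem_top _
      exact this
    rw [h2, Equiv.Perm.one_apply, inv_inv, hK.sphereProj_eq_iff hT] at h1
    obtain ⟨b, hb, e⟩ := h1
    exact hx b hb e
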